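/- Let $M\ge 1$ and, for $m=1,\dots,M$, let $\alpha_m,\beta_m>0$ and $$\Phi_m(r)=\tfrac12\alpha_m r^2+\tfrac13\beta_m r^3+\Psi_m(r),$$ where $\Psi_m:\mathbb R\to\mathbb R$ is of class $C^2$, $\Psi_m'(0)=0$, and there are constants $\gamma_m$ with $|\Psi_m''(r)|\le\gamma_m r^2$ for all $|r|\le 1$. For $\eta>0$ put $(\mathcal A_\eta Y)(x)=\frac1\eta\int_{x-\eta/2}^{x+\eta/2}Y(\xi)\,d\xi$, and put $$c_\varepsilon^2=c_0^2+\varepsilon^2,\qquad c_0^2=\sum_{m=1}^M\alpha_m m^2,\qquad d_1=\frac{12}{\sum_{m=1}^M\alpha_m m^4},\qquad d_2=\frac{12\sum_{m=1}^M\beta_m m^3}{\sum_{m=1}^M\alpha_m m^4}.$$ Then the equation $W_0''=d_1W_0-d_2W_0^2$ has exactly one even solution $W_0\in C^2(\mathbb R)\cap L^2(\mathbb R)$ that is not identically zero (the KdV wave), and the following holds. There is $C_0>0$ such that for every $C\ge C_0$ there is $\varepsilon_0>0$ such that for every $0<\varepsilon\le\varepsilon_0$ the nonlocal traveling wave equation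 $$\varepsilon^2c_\varepsilon^2W=\sum_{m=1}^M m\,\mathcal A_{m\varepsilon}\,\Phi_m'\bigl(m\varepsilon^2\mathcal A_{m\varepsilon}W\bigr)$$ has exactly one even solution $W_\varepsilon\in L^2(\mathbb R)$ with $$\|W_\varepsilon-W_0\|_2+\|W_\varepsilon-W_0\|_\infty\le C\varepsilon^2 .$$ Moreover, $W_\varepsilon$ is nonnegative and as smooth as the potentials: it is of class $C^2$, and for each $k\in\mathbb N\cup\{\infty\}$ it is of class $C^k$ whenever all $\Psi_m$ are of class $C^k$; in particular, $W_\varepsilon$ is $C^\infty$ if all $\Psi_m$ are. -/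

import Mathlib

open MeasureTheory

namespace AtomicChain

/-- The averaging (convolution) operator
`(A_η Y)(x) = η⁻¹ ∫_{x-η/2}^{x+η/2} Y(ξ) dξ`. -/
noncomputable def avg (η : ℝ) (Y : ℝ → ℝ) (x : ℝ) : ℝ :=
  1 / η * ∫ ξ in (x - η / 2)..(x + η / 2), Y ξ

/-- The interaction potentials `Φ_m(r) = α_m r² / 2 + β_m r³ / 3 + Ψ_m(r)`. -/
noncomputable def potential (α β : ℕ → ℝ) (Ψ : ℕ → ℝ → ℝ) (m : ℕ) (r : ℝ) : ℝ :=
  1 / 2 * α m * r ^ 2 + 1 / 3 * β m * r ^ 3 + Ψ m r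

/-- The squared sound speed `c_0² = ∑_{m=1}^M α_m m²`. -/
noncomputable def soundSpeedSq (M : ℕ) (α : ℕ → ℝ) : ℝ :=
  ∑ m ∈ Finset.Icc 1 M, α m * (m : ℝ) ^ 2

/-- The wave speed `c_ε = √(c_0² + ε²)`. -/
noncomputable def waveSpeed (M : ℕ) (α : ℕ → ℝ) (ε : ℝ) : ℝ :=
  Real.sqrt (soundSpeedSq M α + ε ^ 2)

/-- The coefficient `d_1 = 12 / ∑ α_m m⁴` of the leading order equation. -/
noncomputable def dOne (M : ℕ) (α : ℕ → ℝ) : ℝ :=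
  12 / ∑ m ∈ Finset.Icc 1 M, α m * (m : ℝ) ^ 4

/-- The coefficient `d_2 = 12 (∑ β_m m³) / ∑ α_m m⁴` of the leading order equation. -/
noncomputable def dTwo (M : ℕ) (α β : ℕ → ℝ) : ℝ :=
  12 * (∑ m ∈ Finset.Icc 1 M, β m * (m : ℝ) ^ 3) /
    ∑ m ∈ Finset.Icc 1 M, α m * (m : ℝ) ^ 4

/-- `W` is an even solution in `L²(ℝ)`, not identically zero, of the leading order equation
`W'' = d_1 W - d_2 W²`. -/
structure IsKdVWave (M : ℕ) (α β : ℕ → ℝ) (W : ℝ → ℝ) : Prop where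
  contDiff : ContDiff ℝ 2 W
  ode : ∀ x, deriv (deriv W) x = dOne M α * W x - dTwo M α β * W x ^ 2
  memLp : MemLp W 2 volume
  even : ∀ x, W (-x) = W x
  nontrivial : ∃ x, W x ≠ 0

/-- The nonlocal travelling wave equation
`ε² c² W = ∑_{m=1}^M m A_{mε} Φ_m'(m ε² A_{mε} W)`, as an identity between elements of `L²(ℝ)`,
that is, almost everywhere. -/
def SolvesTravelingWave (M : ℕ) (Φ : ℕ → ℝ → ℝ) (ε c : ℝ) (W : ℝ → ℝ) : Prop :=
  ∀ᵐ x : ℝ, ε ^ 2 * c ^ 2 * W x =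
    ∑ m ∈ Finset.Icc 1 M, (m : ℝ) *
      avg (m * ε) (fun y => deriv (Φ m) (m * ε ^ 2 * avg (m * ε) W y)) x

/-- `W ∈ L²_even(ℝ)` solves the nonlocal travelling wave equation with speed `c_ε` and satisfies
`‖W - W₀‖_2 + ‖W - W₀‖_∞ ≤ C ε²`. -/
structure IsWaveNear (M : ℕ) (α β : ℕ → ℝ) (Ψ : ℕ → ℝ → ℝ) (W₀ : ℝ → ℝ) (C ε : ℝ)
    (W : ℝ → ℝ) : Prop where
  memLp : MemLp W 2 volume
  even : ∀ᵐ x : ℝ, W (-x) = W x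
  solves : SolvesTravelingWave M (potential α β Ψ) ε (waveSpeed M α ε) W
  near : eLpNorm (W - W₀) 2 volume + eLpNorm (W - W₀) ⊤ volume ≤ ENNReal.ofReal (C * ε ^ 2)

end AtomicChain

/-! Put c_ε² = c₀² + ε² into the equation and divide by ε⁴. It becomes B_ε W = F_ε(W), where B_ε = 1
+ ∑ α_m m² (1 - A_{mε}²)/ε² is `dispOp`, F_ε(W) = ∑ A_{mε} f_m(A_{mε} W) is `forceOp`, and f_m(y) =
β_m m³ y² + ε⁻⁴ m Ψ_m'(mε² y). Since A_η² = 1 + (η²/12)∂² + O(η⁴) on smooth functions and Ψ_m'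
contributes O(ε²), the formal limit is W - W''/d₁ = (d₂/d₁) W², the KdV equation. Its even L²
solution is an explicit multiple of sech²(√d₁ x/2): the energy vanishes at infinity, which fixes the
height at 0, and the Cauchy problem does the rest.

The heart is `exists_norm_le_linearization`: with Q_ε the linearised quadratic part (`quadOp`), B_ε
- Q_ε is bounded below on even functions uniformly in ε. The proof is quantitative, without
compactness. Write u = f + z with B_ε z = Q_ε u, so that ‖f‖ ≤ ‖(B_ε - Q_ε)u‖ because B_ε ≥ 1. The
part z need not have a derivative, but its translates by at most Mε differ from it by O(ε): the
defect ‖z‖² - ‖A_η z‖² is the variance of the translates of z, and the quadratic form of B_ε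
controls it. Test z against an even g = L₀v, where L₀ is the linearised KdV operator, inverted on
even functions by an explicit Green function (the decaying kernel element is odd). Shifting the
averages onto z, two derivatives of v suffice to replace L₀ by B_ε - Q_ε with an error O(ε), and
(B_ε - Q_ε)z = Q_ε f. Hence ‖z‖ ≤ C‖f‖ + Cε‖u‖, and the last term is absorbed.

The rest is a Newton-type contraction around W₀, whose residual is O(ε²) in L². An L² ball of radius
τ√ε suffices for the nonlinear estimates because ‖A_η u‖_∞ ≤ ‖u‖/√η; it contains every ball of
radius Cε² once ε is small, which gives uniqueness for every C. The sup norm error is read off from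
the equation, since u itself is recovered from averages of u plus ε² B_ε u. Nonnegativity follows
since F_ε(W) ≥ 0 and B_ε has a positive inverse, and smoothness by bootstrapping, because each
average gains a derivative. -/

namespace AtomicChain

/-! ### Translations, reflection and averages on L² -/

open scoped RealInnerProductSpace
open Filter Topology

/-- The real Hilbert space `L²(ℝ)`. -/
abbrev L2 : Type := Lp ℝ 2 (volume : Measure ℝ)

/-- Translation `u ↦ u(· + t)` on `L²(ℝ)`. -/
noncomputable def shift (t : ℝ) : L2 →ₗᵢ[ℝ] L2 :=
  Lp.compMeasurePreservingₗᵢ ℝ (fun x => x + t) (measurePreserving_add_right volume t)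

/-- Reflection `u ↦ u(-·)` on `L²(ℝ)`. -/
noncomputable def reflect : L2 →ₗᵢ[ℝ] L2 :=
  Lp.compMeasurePreservingₗᵢ ℝ (fun x => -x) (Measure.measurePreserving_neg volume)

lemma coeFn_shift (t : ℝ) (u : L2) : shift t u =ᵐ[volume] fun x => u (x + t) :=
  Lp.coeFn_compMeasurePreserving u (measurePreserving_add_right volume t)

lemma coeFn_reflect (u : L2) : reflect u =ᵐ[volume] fun x => u (-x) :=
  Lp.coeFn_compMeasurePreserving u (Measure.measurePreserving_neg volume)

lemma ae_comp_add {p : ℝ → Prop} (h : ∀ᵐ x, p x) (t : ℝ) : ∀ᵐ x, p (x + t) :=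
  (measurePreserving_add_right volume t).quasiMeasurePreserving.ae h

lemma ae_comp_neg {p : ℝ → Prop} (h : ∀ᵐ x, p x) : ∀ᵐ x : ℝ, p (-x) :=
  (Measure.measurePreserving_neg (volume : Measure ℝ)).quasiMeasurePreserving.ae h

lemma shift_zero (u : L2) : shift 0 u = u := by
  apply Lp.ext
  filter_upwards [coeFn_shift 0 u] with x hx
  simpa using hx

lemma shift_shift (s t : ℝ) (u : L2) : shift s (shift t u) = shift (s + t) u := by
  apply Lp.ext
  filter_upwards [coeFn_shift s (shift t u), ae_comp_add (coeFn_shift t u) s,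
    coeFn_shift (s + t) u] with x h1 h2 h3
  rw [h1, h2, h3, add_assoc]

lemma reflect_reflect (u : L2) : reflect (reflect u) = u := by
  apply Lp.ext
  filter_upwards [coeFn_reflect (reflect u), ae_comp_neg (coeFn_reflect u)] with x h1 h2
  rw [h1, h2, neg_neg]

lemma reflect_shift (t : ℝ) (u : L2) : reflect (shift t u) = shift (-t) (reflect u) := by
  apply Lp.ext
  filter_upwards [coeFn_reflect (shift t u), ae_comp_neg (coeFn_shift t u),
    coeFn_shift (-t) (reflect u), ae_comp_add (coeFn_reflect u) (-t)] with x h1 h2 h3 h4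
  rw [h1, h2, h3, h4]
  congr 1
  ring

lemma continuous_shift (u : L2) : Continuous fun t => shift t u := by
  have h : Continuous fun t : ℝ => (ContinuousMap.mk (fun x : ℝ => x + t) (by fun_prop)) := by
    refine ContinuousMap.continuous_of_continuous_uncurry _ ?_
    change Continuous fun p : ℝ × ℝ => p.2 + p.1
    fun_prop
  exact (continuous_const (y := u)).compMeasurePreservingLp h
    (fun t => measurePreserving_add_right volume t) (by norm_num)

lemma inner_shift_left (t : ℝ) (u v : L2) : ⟪shift t u, v⟫ = ⟪u, shift (-t) v⟫ := by
  rw [← (shift (-t)).inner_map_map (shift t u) v, shift_shift, neg_add_cancel, shift_zero]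

lemma inner_reflect_left (u v : L2) : ⟪reflect u, v⟫ = ⟪u, reflect v⟫ := by
  rw [← reflect.inner_map_map (reflect u) v, reflect_reflect]

lemma integrable_smul_shift {k : ℝ → ℝ} (hk : Integrable k) (u : L2) :
    Integrable fun t => k t • shift t u :=
  hk.smul_bdd ‖u‖ (continuous_shift u).aestronglyMeasurable
    (Eventually.of_forall fun t => ((shift t).norm_map u).le)

/-- This is the hypothesis of Fubini in `coeFn_integral_smul_shift`. The inner integral of |u(x +
t)| over s is the scalar product of the indicator of s with |`shift t u`|, hence continuous and
bounded in t. -/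
lemma integrable_kernel_prod {k : ℝ → ℝ} (hk : Integrable k) (u : L2) {s : Set ℝ}
    (hs : MeasurableSet s) (hμs : volume s ≠ ⊤) :
    Integrable (fun p : ℝ × ℝ => k p.1 * u (p.2 + p.1)) (volume.prod (volume.restrict s)) := by
  have hfin : IsFiniteMeasure (volume.restrict s) := ⟨by simpa using hμs.lt_top⟩
  have hmeas : AEStronglyMeasurable (fun p : ℝ × ℝ => k p.1 * u (p.2 + p.1))
      ((volume : Measure ℝ).prod (volume.restrict s)) := by
    refine (hk.aestronglyMeasurable.comp_fst).mul ?_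
    have h1 : AEStronglyMeasurable (fun p : ℝ × ℝ => u (p.2 + p.1))
        ((volume : Measure ℝ).prod volume) := by
      have := (Lp.aestronglyMeasurable u).comp_quasiMeasurePreserving
        (Measure.quasiMeasurePreserving_snd (μ := (volume : Measure ℝ)) (ν := volume) |>.comp
          (measurePreserving_prod_add (volume : Measure ℝ) volume).quasiMeasurePreserving)
      refine this.congr (Eventually.of_forall fun p => ?_)
      simp [add_comm]
    refine h1.mono_ac ?_
    exact Measure.AbsolutelyContinuous.prod Measure.AbsolutelyContinuous.rfl
      Measure.absolutelyContinuous_restrict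
  rw [integrable_prod_iff hmeas]
  have hint : ∀ t, IntegrableOn (fun x => u (x + t)) s := fun t =>
    (((Lp.memLp (shift t u)).restrict s).integrable (by norm_num)).congr
      (ae_restrict_of_ae (coeFn_shift t u))
  refine ⟨Eventually.of_forall fun t => (hint t).const_mul (k t), ?_⟩
  simp_rw [norm_mul, integral_const_mul]
  have hval : ∀ t, ∫ x in s, ‖u (x + t)‖ = ⟪indicatorConstLp 2 hs hμs (1 : ℝ), |shift t u|⟫ := by
    intro t
    rw [L2.inner_indicatorConstLp_one hs hμs]
    refine integral_congr_ae (ae_restrict_of_ae ?_)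
    filter_upwards [coeFn_shift t u, Lp.coeFn_abs (shift t u)] with x h1 h2
    rw [h2, h1, Real.norm_eq_abs]
  simp_rw [hval]
  refine hk.norm.mul_bdd (c := ‖indicatorConstLp 2 hs hμs (1 : ℝ)‖ * ‖u‖) ?_ ?_
  · have habs : Continuous fun t => |shift t u| := (continuous_shift u).sup (continuous_shift u).neg
    exact (continuous_const.inner habs).aestronglyMeasurable
  · refine Eventually.of_forall fun t => ?_
    refine (norm_inner_le_norm _ _).trans ?_
    rw [norm_abs_eq_norm, (shift t).norm_map]

/-- A superposition of translates is given pointwise by a convolution integral. -/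
lemma coeFn_integral_smul_shift {k : ℝ → ℝ} (hk : Integrable k) (u : L2) :
    (∫ t, k t • shift t u : L2) =ᵐ[volume] fun x => ∫ t, k t * u (x + t) := by
  -- Pointwise values do not commute with the Bochner integral, but scalar products with indicators
  -- do; it is enough to compare integrals over sets of finite measure.
  refine ae_eq_of_forall_setIntegral_eq_of_sigmaFinite ?_ ?_ ?_
  · intro s hs hμs
    have hfin : IsFiniteMeasure (volume.restrict s) := ⟨by simpa using hμs⟩
    exact ((Lp.memLp _).restrict s).integrable (by norm_num)
  · intro s hs hμs
    exact (integrable_kernel_prod hk u hs hμs.ne).integral_prod_right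
  · intro s hs hμs
    have h1 : ∫ x in s, (∫ t, k t • shift t u : L2) x =
        ∫ t, k t * ∫ x in s, u (x + t) := by
      rw [← L2.inner_indicatorConstLp_one (𝕜 := ℝ) hs hμs.ne,
        ← integral_inner (𝕜 := ℝ) (integrable_smul_shift hk u)]
      refine integral_congr_ae (Eventually.of_forall fun t => ?_)
      simp only [inner_smul_right]
      rw [L2.inner_indicatorConstLp_one hs hμs.ne]
      congr 1
      exact integral_congr_ae (ae_restrict_of_ae (coeFn_shift t u))
    rw [h1, ← integral_integral_swap (integrable_kernel_prod hk u hs hμs.ne)]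
    simp_rw [integral_const_mul]

/-- The averaging operator `A_η` on `L²(ℝ)`. -/
noncomputable def mean (η : ℝ) : L2 →L[ℝ] L2 :=
  LinearMap.mkContinuous
    { toFun := fun u => (1 / η) • ∫ t in (-(η / 2))..(η / 2), shift t u
      map_add' := fun u v => by
        simp only [map_add]
        rw [intervalIntegral.integral_add ((continuous_shift u).intervalIntegrable _ _)
          ((continuous_shift v).intervalIntegrable _ _), smul_add]
      map_smul' := fun c u => by
        simp only [map_smul, RingHom.id_apply]
        rw [intervalIntegral.integral_smul, smul_comm] }
    1 (fun u => by
      simp only [LinearMap.coe_mk, AddHom.coe_mk, norm_smul]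
      have h := intervalIntegral.norm_integral_le_of_norm_le_const (a := -(η / 2)) (b := η / 2)
        (f := fun t => shift t u) (C := ‖u‖) (fun t _ => ((shift t).norm_map u).le)
      have e : η / 2 - -(η / 2) = η := by ring
      rw [e] at h
      -- For η = 0 the convention 1 / 0 = 0 makes the operator vanish, so the bound 1 holds for
      -- every real η.
      rcases eq_or_ne η 0 with rfl | hη
      · simp
      calc ‖1 / η‖ * ‖∫ t in (-(η / 2))..(η / 2), shift t u‖ ≤ ‖1 / η‖ * (‖u‖ * |η|) := by gcongr
        _ = 1 * ‖u‖ := by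
          rw [Real.norm_eq_abs, abs_div, abs_one]
          field_simp)

lemma mean_apply (η : ℝ) (u : L2) :
    mean η u = (1 / η) • ∫ t in (-(η / 2))..(η / 2), shift t u := rfl

lemma norm_mean_le (η : ℝ) (u : L2) : ‖mean η u‖ ≤ ‖u‖ := by
  simpa using (mean η).le_of_opNorm_le (LinearMap.mkContinuous_norm_le _ zero_le_one _) u

lemma coeFn_mean {η : ℝ} (hη : 0 < η) (u : L2) : mean η u =ᵐ[volume] avg η u := by
  have hk : Integrable (Set.indicator (Set.Ioc (-(η / 2)) (η / 2)) fun _ => (1 : ℝ)) :=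
    (integrable_indicator_iff measurableSet_Ioc).2 (by simp)
  have h1 : ∫ t in (-(η / 2))..(η / 2), shift t u =
      ∫ t, Set.indicator (Set.Ioc (-(η / 2)) (η / 2)) (fun _ => (1 : ℝ)) t • shift t u := by
    rw [intervalIntegral.integral_of_le (by linarith), ← integral_indicator measurableSet_Ioc]
    refine integral_congr_ae (Eventually.of_forall fun t => ?_)
    by_cases ht : t ∈ Set.Ioc (-(η / 2)) (η / 2) <;> simp [ht]
  filter_upwards [coeFn_integral_smul_shift hk u,
    Lp.coeFn_smul (1 / η) (∫ t in (-(η / 2))..(η / 2), shift t u)] with x h2 h3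
  rw [mean_apply, h3, Pi.smul_apply, h1, h2, avg, smul_eq_mul]
  congr 1
  have h4 : ∫ t in (-(η / 2))..(η / 2), u (x + t) = ∫ ξ in (x - η / 2)..(x + η / 2), u ξ := by
    rw [intervalIntegral.integral_comp_add_left (fun ξ => u ξ) x, sub_eq_add_neg]
  rw [← h4, intervalIntegral.integral_of_le (by linarith), ← integral_indicator measurableSet_Ioc]
  refine integral_congr_ae (Eventually.of_forall fun t => ?_)
  by_cases ht : t ∈ Set.Ioc (-(η / 2)) (η / 2) <;> simp [ht]

lemma intervalIntegrable_shift (u : L2) (a b : ℝ) :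
    IntervalIntegrable (fun t => shift t u) volume a b :=
  (continuous_shift u).intervalIntegrable a b

lemma inner_mean_eq (η : ℝ) (u v : L2) :
    ⟪u, mean η v⟫ = (1 / η) * ∫ t in (-(η / 2))..(η / 2), ⟪u, shift t v⟫ := by
  rw [mean_apply, real_inner_smul_right]
  congr 1
  exact ((innerSL ℝ u).intervalIntegral_comp_comm (intervalIntegrable_shift v _ _)).symm

/-- The adjoint of the translation by t is the translation by -t, and the interval of averaging is
symmetric. -/
lemma inner_mean_left (η : ℝ) (u v : L2) : ⟪mean η u, v⟫ = ⟪u, mean η v⟫ := by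
  rw [real_inner_comm, inner_mean_eq, inner_mean_eq]
  congr 1
  have h := intervalIntegral.integral_comp_neg (a := -(η / 2)) (b := η / 2)
    (fun t => ⟪u, shift t v⟫)
  rw [neg_neg] at h
  rw [← h]
  refine intervalIntegral.integral_congr fun t _ => ?_
  rw [real_inner_comm, inner_shift_left]

lemma reflect_mean (η : ℝ) (u : L2) : reflect (mean η u) = mean η (reflect u) := by
  rw [mean_apply, mean_apply, map_smul]
  congr 1
  have h := intervalIntegral.integral_comp_neg (a := -(η / 2)) (b := η / 2)
    (fun t => shift t (reflect u))
  rw [neg_neg] at h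
  rw [← h, ← LinearIsometry.coe_toContinuousLinearMap,
    ← ContinuousLinearMap.intervalIntegral_comp_comm _ (intervalIntegrable_shift u _ _)]
  refine intervalIntegral.integral_congr fun t _ => ?_
  simp [reflect_shift]

/-- The variance identity for averages of translates. -/
lemma integral_norm_shift_sub_mean {η : ℝ} (hη : 0 < η) (u : L2) :
    ∫ t in (-(η / 2))..(η / 2), ‖shift t u - mean η u‖ ^ 2 = η * (‖u‖ ^ 2 - ‖mean η u‖ ^ 2) := by
  have h1 : ∀ t, ‖shift t u - mean η u‖ ^ 2 =
      (‖u‖ ^ 2 + ‖mean η u‖ ^ 2) - 2 * ⟪mean η u, shift t u⟫ := by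
    intro t
    rw [norm_sub_sq_real, (shift t).norm_map, real_inner_comm]
    ring
  simp_rw [h1]
  have h2 := inner_mean_eq η (mean η u) u
  rw [real_inner_self_eq_norm_sq] at h2
  rw [intervalIntegral.integral_sub (by simp)
    ((continuous_const.mul (continuous_const.inner (continuous_shift u))).intervalIntegrable _ _),
    intervalIntegral.integral_const, intervalIntegral.integral_const_mul]
  have h3 : ∫ t in (-(η / 2))..(η / 2), ⟪mean η u, shift t u⟫ = η * ‖mean η u‖ ^ 2 := by
    rw [h2]
    field_simp
  rw [h3, smul_eq_mul]
  ring

lemma norm_shift_sub_shift (s t : ℝ) (u : L2) : ‖shift s u - shift t u‖ = ‖shift (s - t) u - u‖ := by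
  rw [← (shift t).norm_map (shift (s - t) u - u), map_sub, shift_shift]
  congr 3
  ring_nf

lemma norm_shift_neg_sub (t : ℝ) (u : L2) : ‖shift (-t) u - u‖ = ‖shift t u - u‖ := by
  have := norm_shift_sub_shift 0 t u
  rw [zero_sub, shift_zero] at this
  rw [← this, norm_sub_rev]

/-- For every t the norm of `shift a u - u` equals that of the difference between the translates by
t + a and t, and both of these can be compared with the mean. Integrating over t in [-η/2, η/2 - a],
of length at least η/2, bounds it by the variance: 8 = 4 / (1/2). -/
lemma norm_shift_sub_sq_le_of_le_half {η a : ℝ} (hη : 0 < η) (ha : 0 ≤ a) (haη : a ≤ η / 2) (u : L2) :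
    ‖shift a u - u‖ ^ 2 ≤ 8 * (‖u‖ ^ 2 - ‖mean η u‖ ^ 2) := by
  set g : ℝ → ℝ := fun t => ‖shift t u - mean η u‖ ^ 2 with hg
  have hgc : Continuous g := ((continuous_shift u).sub continuous_const).norm.pow 2
  have hgi : ∀ b c, IntervalIntegrable g volume b c := fun b c => hgc.intervalIntegrable b c
  have hg0 : ∀ t, 0 ≤ g t := fun t => by positivity
  have h1 : ∀ t, ‖shift a u - u‖ ^ 2 ≤ 2 * g (t + a) + 2 * g t := by
    intro t
    have e : ‖shift a u - u‖ = ‖(shift (t + a) u - mean η u) - (shift t u - mean η u)‖ := by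
      rw [sub_sub_sub_cancel_right, norm_shift_sub_shift, add_sub_cancel_left]
    have := norm_sub_le (shift (t + a) u - mean η u) (shift t u - mean η u)
    rw [e]
    have h0 := norm_nonneg ((shift (t + a) u - mean η u) - (shift t u - mean η u))
    simp only [hg]
    nlinarith [sq_nonneg (‖shift (t + a) u - mean η u‖ - ‖shift t u - mean η u‖)]
  have h2 : ∫ t in (-(η / 2))..(η / 2 - a), ‖shift a u - u‖ ^ 2 ≤
      ∫ t in (-(η / 2))..(η / 2 - a), (2 * g (t + a) + 2 * g t) :=
    intervalIntegral.integral_mono_on (by linarith) (by simp)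
      (Continuous.intervalIntegrable (by fun_prop) _ _) fun t _ => h1 t
  have hgc' : Continuous fun t => 2 * g (t + a) := by fun_prop
  rw [intervalIntegral.integral_const, intervalIntegral.integral_add
    (hgc'.intervalIntegrable _ _) ((hgi _ _).const_mul 2), intervalIntegral.integral_const_mul,
    intervalIntegral.integral_const_mul, intervalIntegral.integral_comp_add_right, smul_eq_mul] at h2
  have h3 : ∫ t in (-(η / 2) + a)..(η / 2 - a + a), g t ≤ ∫ t in (-(η / 2))..(η / 2), g t :=
    intervalIntegral.integral_mono_interval (by linarith) (by linarith) (by linarith)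
      (Eventually.of_forall hg0) (hgi _ _)
  have h4 : ∫ t in (-(η / 2))..(η / 2 - a), g t ≤ ∫ t in (-(η / 2))..(η / 2), g t :=
    intervalIntegral.integral_mono_interval (by linarith) (by linarith) (by linarith)
      (Eventually.of_forall hg0) (hgi _ _)
  have h5 := integral_norm_shift_sub_mean hη u
  rw [h5] at h3 h4
  have h6 : η / 2 * ‖shift a u - u‖ ^ 2 ≤ (η / 2 - a - -(η / 2)) * ‖shift a u - u‖ ^ 2 := by
    gcongr
    linarith
  have h7 : η / 2 * ‖shift a u - u‖ ^ 2 ≤ η / 2 * (8 * (‖u‖ ^ 2 - ‖mean η u‖ ^ 2)) := by linarith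
  exact le_of_mul_le_mul_left h7 (by linarith)

/-- Translates by at most `η` are controlled by the defect `‖u‖² - ‖A_η u‖²`. -/
lemma norm_shift_sub_sq_le {η a : ℝ} (hη : 0 < η) (ha : |a| ≤ η) (u : L2) :
    ‖shift a u - u‖ ^ 2 ≤ 32 * (‖u‖ ^ 2 - ‖mean η u‖ ^ 2) := by
  have key : ∀ b, 0 ≤ b → b ≤ η → ‖shift b u - u‖ ^ 2 ≤ 32 * (‖u‖ ^ 2 - ‖mean η u‖ ^ 2) := by
    intro b hb hbη
    have h1 := norm_shift_sub_sq_le_of_le_half hη (a := b / 2) (by linarith) (by linarith) u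
    -- Two half steps; the factor 2, squared, turns the 8 into 32.
    have h2 : ‖shift b u - u‖ ≤ 2 * ‖shift (b / 2) u - u‖ := by
      have e : shift b u - u = (shift b u - shift (b / 2) u) + (shift (b / 2) u - u) := by abel
      rw [e]
      refine (norm_add_le _ _).trans ?_
      rw [norm_shift_sub_shift, sub_half]
      linarith
    have h0 := norm_nonneg (shift b u - u)
    nlinarith
  rcases le_total 0 a with h | h
  · exact key a h ((le_abs_self a).trans ha)
  · rw [← norm_shift_neg_sub]
    exact key (-a) (by linarith) ((neg_le_abs a).trans ha)

end AtomicChain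

/-! ### Taylor expansion of averages along translation orbits -/

namespace AtomicChain

open scoped RealInnerProductSpace
open Filter Topology

section Taylor

variable {E : Type*} [NormedAddCommGroup E] [NormedSpace ℝ E]

/-- A curve vanishing to second order at `0` is controlled by its second derivative. -/
lemma norm_le_of_second_deriv_le {g g1 g2 : ℝ → E} (h1 : ∀ t, HasDerivAt g (g1 t) t)
    (h2 : ∀ t, HasDerivAt g1 (g2 t) t) (g0 : g 0 = 0) (g10 : g1 0 = 0) {r δ : ℝ}
    (hδ : ∀ s, 0 ≤ s → s ≤ r → ‖g2 s‖ ≤ δ) {t : ℝ} (ht : 0 ≤ t) (htr : t ≤ r) :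
    ‖g t‖ ≤ δ * t ^ 2 := by
  have hb : ∀ s, 0 ≤ s → s ≤ t → ‖g1 s‖ ≤ δ * t := by
    intro s hs hst
    have := norm_image_sub_le_of_norm_deriv_le_segment' (f := g1) (f' := g2) (a := 0) (b := s)
      (C := δ) (fun x _ => (h2 x).hasDerivWithinAt)
      (fun x hx => hδ x hx.1 (by linarith [hx.2])) s ⟨hs, le_rfl⟩
    rw [g10, sub_zero, sub_zero] at this
    refine this.trans ?_
    have h0 : 0 ≤ δ := (norm_nonneg _).trans (hδ t ht htr)
    gcongr
  have := norm_image_sub_le_of_norm_deriv_le_segment' (f := g) (f' := g1) (a := 0) (b := t)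
    (C := δ * t) (fun x _ => (h1 x).hasDerivWithinAt)
    (fun x hx => hb x hx.1 hx.2.le) t ⟨ht, le_rfl⟩
  rw [g0, sub_zero, sub_zero] at this
  linarith

variable {φ φ1 φ2 : ℝ → E}

lemma hasDerivAt_comp_neg {f f' : ℝ → E} (h : ∀ t, HasDerivAt f (f' t) t) (t : ℝ) :
    HasDerivAt (fun s => f (-s)) (-f' (-t)) t := by
  simpa [Function.comp_def] using (h (-t)).scomp t (hasDerivAt_neg t)

/-- Value and first derivative of the second difference minus t² w vanish at 0, so only the
deviation of the symmetrised second derivative from 2w matters. Keeping w and δ free allows both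
strong and weak versions below. -/
lemma norm_second_difference_sub_le (h1 : ∀ t, HasDerivAt φ (φ1 t) t)
    (h2 : ∀ t, HasDerivAt φ1 (φ2 t) t) {r δ : ℝ} (w : E)
    (hδ : ∀ s, 0 ≤ s → s ≤ r → ‖φ2 s + φ2 (-s) - (2 : ℝ) • w‖ ≤ δ) {t : ℝ}
    (ht : 0 ≤ t) (htr : t ≤ r) :
    ‖φ t + φ (-t) - (2 : ℝ) • φ 0 - t ^ 2 • w‖ ≤ δ * t ^ 2 := by
  refine norm_le_of_second_deriv_le
    (g := fun t => φ t + φ (-t) - (2 : ℝ) • φ 0 - t ^ 2 • w)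
    (g1 := fun t => φ1 t - φ1 (-t) - (2 * t) • w)
    (g2 := fun t => φ2 t + φ2 (-t) - (2 : ℝ) • w) ?_ ?_ ?_ ?_ hδ ht htr
  · intro t
    have h3 := ((h1 t).add (hasDerivAt_comp_neg h1 t)).sub_const ((2 : ℝ) • φ 0)
    have h4 := ((hasDerivAt_pow 2 t).smul_const w)
    refine (h3.sub h4).congr_deriv ?_
    simp [sub_eq_add_neg]
  · intro t
    have h3 := (h2 t).sub (hasDerivAt_comp_neg h2 t)
    have h4 := (((hasDerivAt_id t).const_mul 2).smul_const w)
    refine (h3.sub h4).congr_deriv ?_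
    simp
  · simp [two_smul]
  · simp

/-- Taylor expansion of a symmetric average. -/
lemma norm_average_sub_le [CompleteSpace E] (h1 : ∀ t, HasDerivAt φ (φ1 t) t)
    (h2 : ∀ t, HasDerivAt φ1 (φ2 t) t) {η δ : ℝ} (hη : 0 < η) (w : E)
    (hδ : ∀ s, 0 ≤ s → s ≤ η / 2 → ‖φ2 s + φ2 (-s) - (2 : ℝ) • w‖ ≤ δ) :
    ‖(1 / η) • (∫ t in (-(η / 2))..(η / 2), φ t) - φ 0 - (η ^ 2 / 24) • w‖ ≤ η ^ 2 * δ := by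
  have hc : Continuous φ := continuous_iff_continuousAt.2 fun t => (h1 t).continuousAt
  have hci : ∀ a b, IntervalIntegrable φ volume a b := fun a b => hc.intervalIntegrable a b
  have hδ0 : 0 ≤ δ := (norm_nonneg _).trans (hδ 0 le_rfl (by linarith))
  -- Folding the interval at 0 produces second differences; the coefficient 1/24 comes from (1/η) ∫
  -- t² over [0, η/2].
  have e : (1 / η) • (∫ t in (-(η / 2))..(η / 2), φ t) - φ 0 - (η ^ 2 / 24) • w =
      (1 / η) • ∫ t in (0)..(η / 2), (φ t + φ (-t) - (2 : ℝ) • φ 0 - t ^ 2 • w) := by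
    have e1 : ∫ t in (0)..(η / 2), φ (-t) = ∫ t in (-(η / 2))..0, φ t := by
      rw [intervalIntegral.integral_comp_neg, neg_zero]
    have e2 : ∫ t in (0)..(η / 2), t ^ 2 • w = (η ^ 3 / 24) • w := by
      rw [intervalIntegral.integral_smul_const, integral_pow]
      congr 1
      ring
    have i1 : Continuous fun t => φ t + φ (-t) := by fun_prop
    have i2 : Continuous fun t : ℝ => t ^ 2 • w := by fun_prop
    have i4 : Continuous fun t => φ (-t) := by fun_prop
    have i3 : Continuous fun t => φ t + φ (-t) - (2 : ℝ) • φ 0 := by fun_prop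
    rw [intervalIntegral.integral_sub (i3.intervalIntegrable _ _)
      (i2.intervalIntegrable _ _), intervalIntegral.integral_sub (i1.intervalIntegrable _ _) (by simp),
      intervalIntegral.integral_add (hci _ _)
        (i4.intervalIntegrable _ _), e1, e2, add_comm (∫ t in (0)..(η / 2), φ t), intervalIntegral.integral_add_adjacent_intervals
        (hci _ _) (hci _ _), intervalIntegral.integral_const, smul_sub, smul_sub, smul_smul,
      smul_smul, smul_smul]
    · congr 2
      · rw [show 1 / η * (η / 2 - 0) * 2 = 1 by field_simp; ring, one_smul]
      · field_simp
  rw [e, norm_smul]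
  have h3 := intervalIntegral.norm_integral_le_of_norm_le_const (a := 0) (b := η / 2)
    (f := fun t => φ t + φ (-t) - (2 : ℝ) • φ 0 - t ^ 2 • w) (C := δ * η ^ 2) (by
      intro t ht
      rw [Set.uIoc_of_le (by linarith)] at ht
      refine (norm_second_difference_sub_le h1 h2 w hδ ht.1.le ht.2).trans ?_
      gcongr
      · exact ht.1.le
      · linarith [ht.2])
  rw [sub_zero, abs_of_pos (by linarith : (0 : ℝ) < η / 2)] at h3
  calc ‖1 / η‖ * _ ≤ ‖1 / η‖ * (δ * η ^ 2 * (η / 2)) := by gcongr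
    _ = η ^ 2 * δ / 2 := by
      rw [Real.norm_of_nonneg (by positivity)]
      field_simp
    _ ≤ η ^ 2 * δ := by
      have : 0 ≤ η ^ 2 * δ := by positivity
      linarith

lemma norm_average_sub_le' [CompleteSpace E] (h1 : ∀ t, HasDerivAt φ (φ1 t) t)
    (h2 : ∀ t, HasDerivAt φ1 (φ2 t) t) {η D : ℝ} (hη : 0 < η) (hD : ∀ s, ‖φ2 s‖ ≤ D) :
    ‖(1 / η) • (∫ t in (-(η / 2))..(η / 2), φ t) - φ 0‖ ≤ η ^ 2 * (2 * D) := by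
  have := norm_average_sub_le h1 h2 hη 0 (δ := 2 * D) (fun s _ _ => by
    rw [smul_zero, sub_zero]
    refine (norm_add_le _ _).trans ?_
    linarith [hD s, hD (-s)])
  simpa using this

end Taylor

/-- `u₁` and `u₂` are the first and second derivative of `u` in `L²(ℝ)`. -/
structure HasL2Derivs (u u₁ u₂ : L2) : Prop where
  first : ∀ t, HasDerivAt (fun s => shift s u) (shift t u₁) t
  second : ∀ t, HasDerivAt (fun s => shift s u₁) (shift t u₂) t

lemma HasL2Derivs.norm_mean_sub_le {u u₁ u₂ : L2} (h : HasL2Derivs u u₁ u₂) {η : ℝ} (hη : 0 < η) :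
    ‖mean η u - u‖ ≤ η ^ 2 * (2 * ‖u₂‖) := by
  have := norm_average_sub_le' h.first h.second hη (fun s => ((shift s).norm_map u₂).le)
  rwa [shift_zero, ← mean_apply] at this

/-- The second difference of the orbit of u₂ is itself O(η²) by its own second derivative u₄, which
gives order η⁴. It is applied to the solitary wave, which has all these derivatives. -/
lemma HasL2Derivs.norm_mean_sub_sub_le {u u₁ u₂ u₃ u₄ : L2} (h : HasL2Derivs u u₁ u₂)
    (h' : HasL2Derivs u₂ u₃ u₄) {η : ℝ} (hη : 0 < η) :
    ‖mean η u - u - (η ^ 2 / 24) • u₂‖ ≤ η ^ 4 * (2 * ‖u₄‖) := by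
  have := norm_average_sub_le h.first h.second hη u₂ (δ := 2 * ‖u₄‖ * η ^ 2) (fun s hs hs' => by
    have := norm_second_difference_sub_le h'.first h'.second (r := s) (δ := 2 * ‖u₄‖) 0
      (fun r _ _ => by
        rw [smul_zero, sub_zero]
        refine (norm_add_le _ _).trans ?_
        rw [(shift r).norm_map, (shift (-r)).norm_map]
        linarith) hs le_rfl
    rw [smul_zero, sub_zero, shift_zero] at this
    refine this.trans ?_
    gcongr
    linarith)
  rw [shift_zero, ← mean_apply] at this
  refine this.trans (le_of_eq ?_)
  ring

/-- A weak expansion that beats η² with only two derivatives of u: the translates of u₂ are moved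
onto z, where they cost δ. This is what makes the Green solution, known only to second order, usable
as a test function. -/
lemma HasL2Derivs.abs_inner_mean_sub_le {u u₁ u₂ : L2} (h : HasL2Derivs u u₁ u₂) {η δ : ℝ}
    (hη : 0 < η) (z : L2) (hz : ∀ s, |s| ≤ η → ‖shift s z - z‖ ≤ δ) :
    |⟪z, mean η u - u⟫ - η ^ 2 / 24 * ⟪z, u₂⟫| ≤ η ^ 2 * (2 * δ * ‖u₂‖) := by
  have hL : ∀ {v v' : L2}, (∀ t, HasDerivAt (fun s => shift s v) (shift t v') t) →
      ∀ t, HasDerivAt (fun s => ⟪z, shift s v⟫) ⟪z, shift t v'⟫ t := fun h t =>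
    ((innerSL ℝ z).hasFDerivAt.comp_hasDerivAt t (h t))
  have := norm_average_sub_le (hL h.first) (hL h.second) hη ⟪z, u₂⟫ (δ := 2 * δ * ‖u₂‖)
    (fun s hs hs' => by
      have e : ⟪z, shift s u₂⟫ + ⟪z, shift (-s) u₂⟫ - (2 : ℝ) • ⟪z, u₂⟫ =
          ⟪shift (-s) z - z, u₂⟫ + ⟪shift s z - z, u₂⟫ := by
        rw [inner_sub_left, inner_sub_left, inner_shift_left, inner_shift_left, neg_neg, smul_eq_mul]
        ring
      rw [e]
      refine (norm_add_le _ _).trans ?_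
      have h1 := norm_inner_le_norm (𝕜 := ℝ) (shift (-s) z - z) u₂
      have h2 := norm_inner_le_norm (𝕜 := ℝ) (shift s z - z) u₂
      rw [norm_shift_neg_sub] at h1
      have h3 : ‖shift s z - z‖ * ‖u₂‖ ≤ δ * ‖u₂‖ := by
        gcongr
        exact hz s (by rw [abs_of_nonneg hs]; linarith)
      linarith)
  rw [shift_zero, smul_eq_mul, smul_eq_mul, ← inner_mean_eq, ← inner_sub_right] at this
  exact this

/-- The fundamental theorem of calculus for translates. -/
lemma integral_shift_toLp {f f' : ℝ → ℝ} (hf : ∀ x, HasDerivAt f (f' x) x) (hc : Continuous f')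
    (hm : MemLp f 2 volume) (hm' : MemLp f' 2 volume) {a b : ℝ} (hab : a ≤ b) :
    ∫ t in a..b, shift t (hm'.toLp f') = shift b (hm.toLp f) - shift a (hm.toLp f) := by
  have hk : Integrable (Set.indicator (Set.Ioc a b) fun _ => (1 : ℝ)) :=
    (integrable_indicator_iff measurableSet_Ioc).2 (by simp)
  have h1 : ∫ t in a..b, shift t (hm'.toLp f') =
      ∫ t, Set.indicator (Set.Ioc a b) (fun _ => (1 : ℝ)) t • shift t (hm'.toLp f') := by
    rw [intervalIntegral.integral_of_le hab, ← integral_indicator measurableSet_Ioc]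
    refine integral_congr_ae (Eventually.of_forall fun t => ?_)
    by_cases ht : t ∈ Set.Ioc a b <;> simp [ht]
  rw [h1]
  apply Lp.ext
  filter_upwards [coeFn_integral_smul_shift hk (hm'.toLp f'),
    Lp.coeFn_sub (shift b (hm.toLp f)) (shift a (hm.toLp f)), coeFn_shift a (hm.toLp f),
    coeFn_shift b (hm.toLp f), ae_comp_add hm.coeFn_toLp a, ae_comp_add hm.coeFn_toLp b]
    with x h2 h3 h4 h5 h6 h7
  rw [h2, h3, Pi.sub_apply, h4, h5, h6, h7]
  have h8 : ∀ᵐ t, (hm'.toLp f' : ℝ → ℝ) (x + t) = f' (x + t) := by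
    simpa only [add_comm] using ae_comp_add hm'.coeFn_toLp x
  have h9 : ∫ t in a..b, f' (x + t) = f (x + b) - f (x + a) := by
    rw [intervalIntegral.integral_comp_add_left f' x]
    exact intervalIntegral.integral_eq_sub_of_hasDerivAt (fun y _ => hf y)
      (hc.intervalIntegrable _ _)
  rw [← h9, intervalIntegral.integral_of_le hab, ← integral_indicator measurableSet_Ioc]
  refine integral_congr_ae ?_
  filter_upwards [h8] with t ht
  by_cases hta : t ∈ Set.Ioc a b <;> simp [hta, ht]

/-- The orbit is the primitive of the continuous orbit of f', so classical derivatives lying in L²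
become derivatives of the translation orbit in norm. -/
lemma hasDerivAt_shift_toLp {f f' : ℝ → ℝ} (hf : ∀ x, HasDerivAt f (f' x) x) (hc : Continuous f')
    (hm : MemLp f 2 volume) (hm' : MemLp f' 2 volume) (t : ℝ) :
    HasDerivAt (fun s => shift s (hm.toLp f)) (shift t (hm'.toLp f')) t := by
  have h1 : (fun s => shift s (hm.toLp f)) =
      fun s => hm.toLp f + ∫ r in (0)..s, shift r (hm'.toLp f') := by
    funext s
    rcases le_total 0 s with h | h
    · rw [integral_shift_toLp hf hc hm hm' h, shift_zero]
      abel
    · rw [intervalIntegral.integral_symm, integral_shift_toLp hf hc hm hm' h, shift_zero]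
      abel
  rw [h1]
  exact ((continuous_shift _).integral_hasStrictDerivAt 0 t).hasDerivAt.const_add _

lemma hasL2Derivs_toLp {f f' f'' : ℝ → ℝ} (hf : ∀ x, HasDerivAt f (f' x) x)
    (hf' : ∀ x, HasDerivAt f' (f'' x) x) (hc : Continuous f'')
    (hm : MemLp f 2 volume) (hm' : MemLp f' 2 volume) (hm'' : MemLp f'' 2 volume) :
    HasL2Derivs (hm.toLp f) (hm'.toLp f') (hm''.toLp f'') :=
  ⟨hasDerivAt_shift_toLp hf (continuous_iff_continuousAt.2 fun x => (hf' x).continuousAt) hm hm',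
    hasDerivAt_shift_toLp hf' hc hm' hm''⟩

end AtomicChain

/-! ### Pointwise bounds for averages of L² functions -/

namespace AtomicChain

open scoped RealInnerProductSpace
open Filter Topology

lemma _root_.MeasureTheory.MemLp.intervalIntegrable_two {f : ℝ → ℝ} (hf : MemLp f 2 volume)
    (a b : ℝ) : IntervalIntegrable f volume a b :=
  ((hf.locallyIntegrable (by norm_num)).integrableOn_isCompact isCompact_uIcc).intervalIntegrable

lemma intervalIntegrable_coeFn (u : L2) (a b : ℝ) : IntervalIntegrable u volume a b :=
  (Lp.memLp u).intervalIntegrable_two a b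

lemma abs_intervalIntegral_le (u : L2) {a b : ℝ} (hab : a ≤ b) :
    |∫ t in a..b, u t| ≤ √(b - a) * ‖u‖ := by
  have hμ : volume (Set.Ioc a b) ≠ ⊤ := by simp
  rw [intervalIntegral.integral_of_le hab,
    ← L2.inner_indicatorConstLp_one (𝕜 := ℝ) measurableSet_Ioc hμ]
  refine (abs_real_inner_le_norm _ _).trans (le_of_eq ?_)
  rw [norm_indicatorConstLp (by norm_num) (by norm_num)]
  simp [Real.sqrt_eq_rpow, sub_nonneg.2 hab, measureReal_def]

lemma avg_congr_ae {η : ℝ} {f g : ℝ → ℝ} (h : f =ᵐ[volume] g) : avg η f = avg η g := by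
  funext x
  rw [avg, avg, intervalIntegral.integral_congr_ae (h.mono fun _ hx _ => hx)]

/-- Cauchy–Schwarz on an interval of length η. The loss η^(-1/2) dictates the radius of order √ε of
the ball in which the fixed point is sought. -/
lemma abs_avg_coeFn_le {η : ℝ} (hη : 0 < η) (u : L2) (x : ℝ) : |avg η u x| ≤ ‖u‖ / √η := by
  rw [avg, abs_mul, abs_of_pos (by positivity : 0 < 1 / η)]
  have h := abs_intervalIntegral_le u (a := x - η / 2) (b := x + η / 2) (by linarith)
  rw [show x + η / 2 - (x - η / 2) = η by ring] at h
  calc 1 / η * |∫ t in (x - η / 2)..(x + η / 2), u t| ≤ 1 / η * (√η * ‖u‖) := by gcongr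
    _ = ‖u‖ / √η := by
      have : √η ≠ 0 := by positivity
      nth_rewrite 1 [← Real.mul_self_sqrt hη.le]
      field_simp

lemma continuous_avg {η : ℝ} {f : ℝ → ℝ} (hf : ∀ a b, IntervalIntegrable f volume a b) :
    Continuous (avg η f) := by
  have h : avg η f = fun x => 1 / η * ((∫ t in (0)..(x + η / 2), f t) -
      ∫ t in (0)..(x - η / 2), f t) := by
    funext x
    rw [avg, intervalIntegral.integral_interval_sub_left (hf _ _) (hf _ _)]
  rw [h]
  have hp := intervalIntegral.continuous_primitive hf 0
  exact continuous_const.mul ((hp.comp (by fun_prop)).sub (hp.comp (by fun_prop)))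

lemma abs_avg_le_of_abs_le {η B : ℝ} (hη : 0 < η) {f : ℝ → ℝ} (hf : ∀ᵐ x, |f x| ≤ B) (x : ℝ) :
    |avg η f x| ≤ B := by
  rw [avg, abs_mul, abs_of_pos (by positivity : 0 < 1 / η)]
  have h := intervalIntegral.norm_integral_le_of_norm_le_const_ae (a := x - η / 2)
    (b := x + η / 2) (f := f) (C := B) (hf.mono fun y hy _ => hy)
  rw [show x + η / 2 - (x - η / 2) = η by ring, abs_of_pos hη, Real.norm_eq_abs] at h
  calc 1 / η * |∫ t in (x - η / 2)..(x + η / 2), f t| ≤ 1 / η * (B * η) := by gcongr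
    _ = B := by field_simp

/-- After cancelling the common part of the two windows, the difference is (1/η) times the integral
of u(t + η) - u(t) over an interval of length y - x. Thus the difference quotient of u plays the
role of a derivative in L². -/
lemma abs_avg_sub_avg_le {η : ℝ} (hη : 0 < η) (u : L2) {x y : ℝ} (hxy : x ≤ y) :
    |avg η u y - avg η u x| ≤ √(y - x) * ‖shift η u - u‖ / η := by
  have hi := intervalIntegrable_coeFn u
  have e : (∫ t in (y - η / 2)..(y + η / 2), u t) - ∫ t in (x - η / 2)..(x + η / 2), u t =
      ∫ t in (x - η / 2)..(y - η / 2), (shift η u - u : L2) t := by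
    have h1 : ∫ t in (x - η / 2)..(y - η / 2), (shift η u - u : L2) t =
        ∫ t in (x - η / 2)..(y - η / 2), (u (t + η) - u t) := by
      refine intervalIntegral.integral_congr_ae ?_
      filter_upwards [Lp.coeFn_sub (shift η u) u, coeFn_shift η u] with t h2 h3 _
      rw [h2, Pi.sub_apply, h3]
    have h2 : IntervalIntegrable (fun t => u (t + η)) volume (x - η / 2) (y - η / 2) :=
      (intervalIntegrable_coeFn (shift η u) _ _).congr_ae
        (ae_restrict_of_ae (coeFn_shift η u))
    rw [h1, intervalIntegral.integral_sub h2 (hi _ _), intervalIntegral.integral_comp_add_right,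
      show x - η / 2 + η = x + η / 2 by ring, show y - η / 2 + η = y + η / 2 by ring]
    rw [← intervalIntegral.integral_add_adjacent_intervals (hi (y - η / 2) (x + η / 2))
        (hi (x + η / 2) (y + η / 2)),
      ← intervalIntegral.integral_add_adjacent_intervals (hi (x - η / 2) (y - η / 2))
        (hi (y - η / 2) (x + η / 2))]
    ring
  rw [avg, avg, ← mul_sub, e, abs_mul, abs_of_pos (by positivity : 0 < 1 / η)]
  have h := abs_intervalIntegral_le (shift η u - u) (a := x - η / 2) (b := y - η / 2) (by linarith)
  rw [show y - η / 2 - (x - η / 2) = y - x by ring] at h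
  calc _ ≤ 1 / η * (√(y - x) * ‖shift η u - u‖) := by gcongr
    _ = _ := by ring

/-- A one-dimensional Sobolev inequality for averages. -/
lemma abs_avg_le {η : ℝ} (hη : 0 < η) (u : L2) (x : ℝ) :
    |avg η u x| ≤ ‖u‖ + ‖shift η u - u‖ / η := by
  have hc : Continuous (avg η u) := continuous_avg (intervalIntegrable_coeFn u)
  have h1 : |∫ y in x..(x + 1), avg η u y| ≤ ‖u‖ := by
    have h2 := abs_intervalIntegral_le (mean η u) (a := x) (b := x + 1) (by linarith)
    rw [intervalIntegral.integral_congr_ae ((coeFn_mean hη u).mono fun _ h _ => h)] at h2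
    refine h2.trans ?_
    rw [add_sub_cancel_left, Real.sqrt_one, one_mul]
    exact norm_mean_le η u
  have h3 : |∫ y in x..(x + 1), (avg η u y - avg η u x)| ≤ ‖shift η u - u‖ / η := by
    have := intervalIntegral.norm_integral_le_of_norm_le_const (a := x) (b := x + 1)
      (f := fun y => avg η u y - avg η u x) (C := ‖shift η u - u‖ / η) (by
        intro y hy
        rw [Set.uIoc_of_le (by linarith)] at hy
        refine (abs_avg_sub_avg_le hη u hy.1.le).trans ?_
        rw [mul_div_assoc]
        refine mul_le_of_le_one_left (by positivity) ?_
        exact Real.sqrt_le_one.2 (by linarith [hy.2]))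
    simpa using this
  rw [intervalIntegral.integral_sub (hc.intervalIntegrable _ _) (by simp),
    intervalIntegral.integral_const, add_sub_cancel_left, one_smul] at h3
  have h4 := abs_sub_abs_le_abs_sub (avg η u x) (∫ y in x..(x + 1), avg η u y)
  rw [abs_sub_comm] at h4
  linarith

lemma avg_add {η : ℝ} {f g : ℝ → ℝ} (hf : ∀ a b, IntervalIntegrable f volume a b)
    (hg : ∀ a b, IntervalIntegrable g volume a b) (x : ℝ) :
    avg η (fun y => f y + g y) x = avg η f x + avg η g x := by
  rw [avg, intervalIntegral.integral_add (hf _ _) (hg _ _), avg, avg, mul_add]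

lemma avg_sub {η : ℝ} {f g : ℝ → ℝ} (hf : ∀ a b, IntervalIntegrable f volume a b)
    (hg : ∀ a b, IntervalIntegrable g volume a b) (x : ℝ) :
    avg η (fun y => f y - g y) x = avg η f x - avg η g x := by
  rw [avg, intervalIntegral.integral_sub (hf _ _) (hg _ _), avg, avg, mul_sub]

lemma avg_const_mul (η c : ℝ) (f : ℝ → ℝ) (x : ℝ) :
    avg η (fun y => c * f y) x = c * avg η f x := by
  rw [avg, intervalIntegral.integral_const_mul, avg]
  ring

lemma avg_mono {η : ℝ} (hη : 0 < η) {f g : ℝ → ℝ} (hf : ∀ a b, IntervalIntegrable f volume a b)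
    (hg : ∀ a b, IntervalIntegrable g volume a b) (h : f ≤ᵐ[volume] g) (x : ℝ) :
    avg η f x ≤ avg η g x := by
  rw [avg, avg]
  refine mul_le_mul_of_nonneg_left ?_ (by positivity)
  exact intervalIntegral.integral_mono_ae (by linarith) (hf _ _) (hg _ _) h

lemma avg_comp_neg (η : ℝ) (f : ℝ → ℝ) (x : ℝ) : avg η (fun y => f (-y)) x = avg η f (-x) := by
  rw [avg, avg, intervalIntegral.integral_comp_neg]
  congr 2 <;> ring

/-- Averaging a twice differentiable function changes it by `O(η²)`. -/
lemma abs_avg_sub_le {η D : ℝ} (hη : 0 < η) {f f' f'' : ℝ → ℝ} (hf : ∀ x, HasDerivAt f (f' x) x)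
    (hf' : ∀ x, HasDerivAt f' (f'' x) x) (hD : ∀ x, |f'' x| ≤ D) (x : ℝ) :
    |avg η f x - f x| ≤ η ^ 2 * (2 * D) := by
  have h := norm_average_sub_le' (φ := fun t => f (x + t)) (φ1 := fun t => f' (x + t))
    (φ2 := fun t => f'' (x + t)) (fun t => by simpa using (hf (x + t)).comp_const_add x t)
    (fun t => by simpa using (hf' (x + t)).comp_const_add x t) hη (fun s => hD _)
  rw [intervalIntegral.integral_comp_add_left, add_zero, ← sub_eq_add_neg, Real.norm_eq_abs,
    smul_eq_mul] at h
  exact h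

end AtomicChain

/-! ### The sech² profile -/

namespace AtomicChain

open scoped RealInnerProductSpace
open Filter Topology

section Soliton

lemma integrable_exp_neg_mul_abs {b : ℝ} (hb : 0 < b) :
    Integrable fun x : ℝ => Real.exp (-b * |x|) := by
  rw [← integrableOn_univ, ← Set.Iic_union_Ioi (a := (0 : ℝ)), integrableOn_union]
  constructor
  · refine (integrableOn_exp_mul_Iic hb 0).congr_fun (fun x hx => ?_) measurableSet_Iic
    simp only
    rw [abs_of_nonpos hx]
    ring_nf
  · refine (integrableOn_exp_mul_Ioi (neg_neg_of_pos hb) 0).congr_fun (fun x hx => ?_)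
      measurableSet_Ioi
    simp only
    rw [abs_of_pos hx]

lemma memLp_two_of_abs_le_exp {f : ℝ → ℝ} (hf : Continuous f) {b C : ℝ} (hb : 0 < b)
    (h : ∀ x, |f x| ≤ C * Real.exp (-b * |x|)) : MemLp f 2 volume := by
  have h1 : MemLp (fun x : ℝ => C * Real.exp (-b * |x|)) 2 volume := by
    rw [memLp_two_iff_integrable_sq (by fun_prop)]
    refine ((integrable_exp_neg_mul_abs (b := 2 * b) (by linarith)).const_mul (C ^ 2)).congr
      (Eventually.of_forall fun x => ?_)
    simp only
    rw [mul_pow, ← Real.exp_nat_mul]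
    congr 2
    push_cast
    ring
  exact h1.mono hf.aestronglyMeasurable (Eventually.of_forall fun x =>
    (h x).trans (le_abs_self _))

/-- The profile `sech²(κ x)`. -/
noncomputable def sechSq (κ x : ℝ) : ℝ := (Real.cosh (κ * x) ^ 2)⁻¹

/-- The derivative of `sechSq`. -/
noncomputable def sechSqDeriv (κ x : ℝ) : ℝ :=
  -2 * κ * Real.sinh (κ * x) / Real.cosh (κ * x) * sechSq κ x

lemma sechSq_pos (κ x : ℝ) : 0 < sechSq κ x := by
  have := Real.cosh_pos (κ * x)
  unfold sechSq
  positivity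

lemma sechSq_le_one (κ x : ℝ) : sechSq κ x ≤ 1 := by
  have := Real.one_le_cosh (κ * x)
  exact inv_le_one_of_one_le₀ (by nlinarith)

lemma sechSq_neg (κ x : ℝ) : sechSq κ (-x) = sechSq κ x := by
  rw [sechSq, mul_neg, Real.cosh_neg, sechSq]

lemma sechSq_zero (κ : ℝ) : sechSq κ 0 = 1 := by simp [sechSq]

lemma half_exp_abs_le_cosh (y : ℝ) : Real.exp |y| / 2 ≤ Real.cosh y := by
  rw [← Real.cosh_abs, Real.cosh_eq]
  have := Real.exp_pos (-|y|)
  linarith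

lemma sechSq_le_exp {κ : ℝ} (hκ : 0 < κ) (x : ℝ) :
    sechSq κ x ≤ 4 * Real.exp (-(2 * κ) * |x|) := by
  have h1 := half_exp_abs_le_cosh (κ * x)
  have h2 : Real.exp (-(2 * κ) * |x|) = (Real.exp |κ * x| ^ 2)⁻¹ := by
    rw [← Real.exp_nat_mul, ← Real.exp_neg, abs_mul, abs_of_pos hκ]
    congr 1
    push_cast
    ring
  rw [h2, sechSq]
  have h3 := Real.exp_pos |κ * x|
  calc (Real.cosh (κ * x) ^ 2)⁻¹ ≤ ((Real.exp |κ * x| / 2) ^ 2)⁻¹ := by gcongr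
    _ = _ := by field_simp; norm_num

lemma hasDerivAt_cosh_mul (κ x : ℝ) :
    HasDerivAt (fun x => Real.cosh (κ * x)) (κ * Real.sinh (κ * x)) x := by
  simpa [mul_comm] using ((hasDerivAt_id x).const_mul κ).cosh

lemma hasDerivAt_sinh_mul (κ x : ℝ) :
    HasDerivAt (fun x => Real.sinh (κ * x)) (κ * Real.cosh (κ * x)) x := by
  simpa [mul_comm] using ((hasDerivAt_id x).const_mul κ).sinh

lemma hasDerivAt_sechSq (κ x : ℝ) : HasDerivAt (sechSq κ) (sechSqDeriv κ x) x := by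
  have hc := (Real.cosh_pos (κ * x)).ne'
  refine (((hasDerivAt_cosh_mul κ x).pow 2).inv (pow_ne_zero 2 hc)).congr_deriv ?_
  rw [sechSqDeriv, sechSq]
  simp only [Pi.pow_apply]
  field_simp
  norm_num
  try ring

lemma hasDerivAt_sechSqDeriv (κ x : ℝ) :
    HasDerivAt (sechSqDeriv κ) (κ ^ 2 * (4 * sechSq κ x - 6 * sechSq κ x ^ 2)) x := by
  have hc := (Real.cosh_pos (κ * x)).ne'
  refine (((((hasDerivAt_sinh_mul κ x).const_mul (-2 * κ)).div (hasDerivAt_cosh_mul κ x) hc)).mul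
    (hasDerivAt_sechSq κ x)).congr_deriv ?_
  rw [sechSqDeriv, sechSq]
  simp only [Pi.div_apply]
  have h := Real.cosh_sq (κ * x)
  field_simp
  have h' : Real.sinh (κ * x) ^ 2 = Real.cosh (κ * x) ^ 2 - 1 := by linarith
  simp only [h']
  ring

lemma abs_sechSqDeriv_le {κ : ℝ} (hκ : 0 < κ) (x : ℝ) : |sechSqDeriv κ x| ≤ 2 * κ * sechSq κ x := by
  have h1 : |Real.sinh (κ * x)| ≤ Real.cosh (κ * x) := by
    rw [Real.abs_sinh, ← Real.cosh_abs]
    exact (Real.sinh_lt_cosh _).le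
  rw [sechSqDeriv, abs_mul, abs_of_pos (sechSq_pos κ x), abs_div, abs_mul,
    abs_of_pos (Real.cosh_pos (κ * x))]
  refine mul_le_mul_of_nonneg_right ?_ (sechSq_pos κ x).le
  rw [div_le_iff₀ (Real.cosh_pos _), show |(-2 : ℝ) * κ| = 2 * κ by
    rw [abs_mul, abs_of_pos hκ]; norm_num]
  gcongr

lemma contDiff_sechSq (κ : ℝ) {n : WithTop ℕ∞} : ContDiff ℝ n (sechSq κ) := by
  unfold sechSq
  exact ((Real.contDiff_cosh.comp (contDiff_const.mul contDiff_id)).pow 2).inv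
    fun x => pow_ne_zero 2 (Real.cosh_pos _).ne'

end Soliton

/-! ### Uniqueness for the KdV ordinary differential equation -/

section Uniqueness

/-- Grönwall for the first order system (D, D1) in the maximum norm, with constant max(1, sup |c|)
on [0, x]. -/
lemma eq_zero_of_linear_ode {D D1 c : ℝ → ℝ} (h1 : ∀ x, HasDerivAt D (D1 x) x)
    (h2 : ∀ x, HasDerivAt D1 (c x * D x) x) (hc : Continuous c) (h0 : D 0 = 0) (h10 : D1 0 = 0)
    {x : ℝ} (hx : 0 ≤ x) : D x = 0 := by
  obtain ⟨K, hK⟩ := (isCompact_Icc (a := (0 : ℝ)) (b := x)).exists_bound_of_continuousOn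
    hc.continuousOn
  have key := eq_zero_of_abs_deriv_le_mul_abs_self_of_eq_zero_right (a := 0) (b := x)
    (K := max 1 K) (f := fun y => (D y, D1 y)) (f' := fun y => (D1 y, c y * D y))
    (fun y _ => ((h1 y).prodMk (h2 y)).continuousAt.continuousWithinAt)
    (fun y _ => ((h1 y).prodMk (h2 y)).hasDerivWithinAt) (by simp [h0, h10]) (by
      intro y hy
      have h3 := hK y ⟨hy.1, hy.2.le⟩
      have h4 : 0 ≤ max 1 K := zero_le_one.trans (le_max_left _ _)
      rw [Prod.norm_def, Prod.norm_def]
      refine max_le ?_ ?_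
      · calc ‖D1 y‖ ≤ 1 * max ‖D y‖ ‖D1 y‖ := by rw [one_mul]; exact le_max_right _ _
          _ ≤ _ := by gcongr; exact le_max_left _ _
      · rw [norm_mul]
        exact mul_le_mul (h3.trans (le_max_right _ _)) (le_max_left _ _) (norm_nonneg _) h4)
  exact congrArg Prod.fst (key x ⟨hx, le_rfl⟩)

lemma tendsto_integral_unit_interval {f : ℝ → ℝ} (hf : Integrable f) :
    Tendsto (fun x => ∫ t in x..(x + 1), f t) atTop (𝓝 0) := by
  have h1 := intervalIntegral_tendsto_integral_Ioi (l := atTop) (b := fun x : ℝ => x) 0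
    hf.integrableOn tendsto_id
  have h2 := intervalIntegral_tendsto_integral_Ioi (l := atTop) (b := fun x : ℝ => x + 1) 0
    hf.integrableOn (tendsto_atTop_add_const_right _ _ tendsto_id)
  have h3 := h2.sub h1
  rw [sub_self] at h3
  refine h3.congr fun x => ?_
  exact intervalIntegral.integral_interval_sub_left hf.intervalIntegrable hf.intervalIntegrable

/-- The variance of f on an interval of length one is nonnegative. -/
lemma sq_integral_unit_le {f : ℝ → ℝ} (hf : Continuous f) (x : ℝ) :
    (∫ t in x..(x + 1), f t) ^ 2 ≤ ∫ t in x..(x + 1), f t ^ 2 := by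
  set G := ∫ t in x..(x + 1), f t with hG
  have h1 : 0 ≤ ∫ t in x..(x + 1), (f t - G) ^ 2 :=
    intervalIntegral.integral_nonneg (by linarith) fun t _ => sq_nonneg _
  have h2 : ∫ t in x..(x + 1), (f t - G) ^ 2 = (∫ t in x..(x + 1), f t ^ 2) - G ^ 2 := by
    have e : ∀ t, (f t - G) ^ 2 = (f t ^ 2 - 2 * G * f t) + G ^ 2 := fun t => by ring
    simp_rw [e]
    have i1 : Continuous fun t => f t ^ 2 - 2 * G * f t := by fun_prop
    have i2 : Continuous fun t => f t ^ 2 := by fun_prop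
    have i3 : Continuous fun t => 2 * G * f t := by fun_prop
    rw [intervalIntegral.integral_add (i1.intervalIntegrable _ _) (by simp),
      intervalIntegral.integral_sub (i2.intervalIntegrable _ _) (i3.intervalIntegrable _ _),
      intervalIntegral.integral_const_mul, ← hG]
    simp
    ring
  linarith

variable {V V1 : ℝ → ℝ} {d1 d2 : ℝ}

/-- Square integrability alone gives decay: the means F and G of V² and |V| over [x, x + 1] tend to
0, and by the equation so does the oscillation of V1 there, bounded by e. Then V1(x), and next V(x),
are recovered from means of V up to these quantities. -/
lemma tendsto_zero_of_ode (h1 : ∀ x, HasDerivAt V (V1 x) x)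
    (h2 : ∀ x, HasDerivAt V1 (d1 * V x - d2 * V x ^ 2) x) (hV : MemLp V 2 volume) :
    Tendsto V atTop (𝓝 0) ∧ Tendsto V1 atTop (𝓝 0) := by
  have hc : Continuous V := continuous_iff_continuousAt.2 fun x => (h1 x).continuousAt
  have hF := tendsto_integral_unit_interval hV.integrable_sq
  set F : ℝ → ℝ := fun x => ∫ t in x..(x + 1), V t ^ 2 with hFdef
  set G : ℝ → ℝ := fun x => ∫ t in x..(x + 1), |V t| with hGdef
  have hGF : ∀ x, G x ≤ √(F x) := by
    intro x
    refine Real.le_sqrt_of_sq_le ?_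
    have := sq_integral_unit_le hc.abs x
    simpa only [sq_abs] using this
  have hG0 : ∀ x, 0 ≤ G x := fun x =>
    intervalIntegral.integral_nonneg (by linarith) fun t _ => abs_nonneg _
  have hG : Tendsto G atTop (𝓝 0) := by
    refine squeeze_zero hG0 hGF ?_
    simpa [Function.comp_def] using (Real.continuous_sqrt.tendsto 0).comp hF
  set e : ℝ → ℝ := fun x => |d1| * G x + |d2| * F x with hedef
  have he : Tendsto e atTop (𝓝 0) := by
    simpa using (hG.const_mul |d1|).add (hF.const_mul |d2|)
  have hd : ∀ x y, x ≤ y → y ≤ x + 1 → |V1 y - V1 x| ≤ e x := by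
    intro x y hxy hyx
    have hcc : Continuous fun t => d1 * V t - d2 * V t ^ 2 := by fun_prop
    have hcb : Continuous fun t => |d1| * |V t| + |d2| * V t ^ 2 := by fun_prop
    rw [← intervalIntegral.integral_eq_sub_of_hasDerivAt (fun t _ => h2 t)
      (hcc.intervalIntegrable _ _)]
    calc |∫ t in x..y, (d1 * V t - d2 * V t ^ 2)| ≤ ∫ t in x..y, (|d1| * |V t| + |d2| * V t ^ 2) := by
          rw [← Real.norm_eq_abs]
          refine intervalIntegral.norm_integral_le_of_norm_le hxy
            (Eventually.of_forall fun t _ => ?_) (hcb.intervalIntegrable _ _)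
          rw [Real.norm_eq_abs, ← abs_mul]
          refine (abs_sub _ _).trans (le_of_eq ?_)
          rw [abs_mul d2, abs_of_nonneg (sq_nonneg (V t))]
      _ ≤ ∫ t in x..(x + 1), (|d1| * |V t| + |d2| * V t ^ 2) :=
          intervalIntegral.integral_mono_interval le_rfl hxy hyx
            (Eventually.of_forall fun t => by positivity) (hcb.intervalIntegrable _ _)
      _ = e x := by
          have i1 : Continuous fun t => |d1| * |V t| := by fun_prop
          have i2 : Continuous fun t => |d2| * V t ^ 2 := by fun_prop
          rw [intervalIntegral.integral_add (i1.intervalIntegrable _ _) (i2.intervalIntegrable _ _),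
            intervalIntegral.integral_const_mul, intervalIntegral.integral_const_mul]
  have hlin : ∀ x y z, x ≤ y → y ≤ z → z ≤ x + 1 →
      |V z - V y - (z - y) * V1 x| ≤ e x * (z - y) := by
    intro x y z hxy hyz hzx
    have := norm_image_sub_le_of_norm_deriv_le_segment' (f := fun t => V t - t * V1 x)
      (f' := fun t => V1 t - V1 x) (a := y) (b := z) (C := e x)
      (fun t _ => ((h1 t).sub (by simpa using (hasDerivAt_id t).mul_const (V1 x))).hasDerivWithinAt)
      (fun t ht => hd x t (hxy.trans ht.1) (by linarith [ht.2])) z ⟨hyz, le_rfl⟩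
    rw [Real.norm_eq_abs] at this
    convert this using 2
    ring
  -- The increments V(t + 1/2) - V(t), integrated over [x, x + 1/2], are at most G in modulus, while
  -- each of them is V1(x)/2 up to e/2.
  have hV1 : ∀ x, |V1 x| ≤ 4 * G x + 2 * e x := by
    intro x
    have i1 : Continuous fun t => V (t + 1 / 2) := by fun_prop
    have i2 : Continuous fun t => V (t + 1 / 2) - V t := by fun_prop
    have a1 : |∫ t in x..(x + 1 / 2), (V (t + 1 / 2) - V t)| ≤ G x := by
      rw [intervalIntegral.integral_sub (i1.intervalIntegrable _ _) (hc.intervalIntegrable _ _),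
        intervalIntegral.integral_comp_add_right]
      have b1 : |∫ t in (x + 1 / 2)..(x + 1 / 2 + 1 / 2), V t| ≤
          ∫ t in (x + 1 / 2)..(x + 1 / 2 + 1 / 2), |V t| :=
        intervalIntegral.abs_integral_le_integral_abs (by linarith)
      have b2 : |∫ t in x..(x + 1 / 2), V t| ≤ ∫ t in x..(x + 1 / 2), |V t| :=
        intervalIntegral.abs_integral_le_integral_abs (by linarith)
      have b3 := intervalIntegral.integral_add_adjacent_intervals
        (hc.abs.intervalIntegrable (μ := volume) x (x + 1 / 2))
        (hc.abs.intervalIntegrable (μ := volume) (x + 1 / 2) (x + 1 / 2 + 1 / 2))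
      have b4 : x + 1 / 2 + 1 / 2 = x + 1 := by ring
      rw [b4] at b1 b3 ⊢
      have b5 := abs_sub (∫ t in (x + 1 / 2)..(x + 1), V t) (∫ t in x..(x + 1 / 2), V t)
      simp only [hGdef]
      linarith
    have a2 : |∫ t in x..(x + 1 / 2), (V (t + 1 / 2) - V t - 1 / 2 * V1 x)| ≤ e x / 2 * (1 / 2) := by
      have := intervalIntegral.norm_integral_le_of_norm_le_const (a := x) (b := x + 1 / 2)
        (f := fun t => V (t + 1 / 2) - V t - 1 / 2 * V1 x) (C := e x / 2) (by
          intro t ht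
          rw [Set.uIoc_of_le (by linarith)] at ht
          have := hlin x t (t + 1 / 2) ht.1.le (by linarith) (by linarith [ht.2])
          rw [add_sub_cancel_left] at this
          rw [Real.norm_eq_abs]
          linarith)
      rwa [add_sub_cancel_left, abs_of_pos (by norm_num : (0 : ℝ) < 1 / 2)] at this
    rw [intervalIntegral.integral_sub (i2.intervalIntegrable _ _) (by simp),
      intervalIntegral.integral_const, add_sub_cancel_left, smul_eq_mul] at a2
    have a3 := abs_le.1 a1
    have a4 := abs_le.1 a2
    rw [abs_le]
    constructor <;> linarith [a3.1, a3.2, a4.1, a4.2]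
  have hV0 : ∀ x, |V x| ≤ G x + (|V1 x| + e x) := by
    intro x
    have a1 : |∫ t in x..(x + 1), V t| ≤ G x :=
      intervalIntegral.abs_integral_le_integral_abs (by linarith)
    have a2 : |∫ t in x..(x + 1), (V t - V x)| ≤ |V1 x| + e x := by
      have := intervalIntegral.norm_integral_le_of_norm_le_const (a := x) (b := x + 1)
        (f := fun t => V t - V x) (C := |V1 x| + e x) (by
          intro t ht
          rw [Set.uIoc_of_le (by linarith)] at ht
          have b1 := hlin x x t le_rfl ht.1.le ht.2
          have b0 : 0 ≤ e x := (abs_nonneg _).trans (hd x x le_rfl (by linarith))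
          have b2 : |(t - x) * V1 x| ≤ |V1 x| := by
            rw [abs_mul, abs_of_nonneg (by linarith [ht.1] : 0 ≤ t - x)]
            exact mul_le_of_le_one_left (abs_nonneg _) (by linarith [ht.2])
          have b3 : e x * (t - x) ≤ e x := mul_le_of_le_one_right b0 (by linarith [ht.2])
          have b4 := abs_sub_abs_le_abs_sub (V t - V x) ((t - x) * V1 x)
          rw [Real.norm_eq_abs]
          linarith)
      simpa using this
    rw [intervalIntegral.integral_sub (hc.intervalIntegrable _ _) (by simp),
      intervalIntegral.integral_const, add_sub_cancel_left, one_smul] at a2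
    have a3 := abs_sub_abs_le_abs_sub (V x) (∫ t in x..(x + 1), V t)
    rw [abs_sub_comm] at a3
    linarith
  have t1 : Tendsto (fun x => |V1 x|) atTop (𝓝 0) := by
    refine squeeze_zero (fun x => abs_nonneg _) hV1 ?_
    simpa using (hG.const_mul 4).add (he.const_mul 2)
  have t2 : Tendsto (fun x => |V x|) atTop (𝓝 0) := by
    refine squeeze_zero (fun x => abs_nonneg _) hV0 ?_
    simpa using hG.add (t1.add he)
  exact ⟨(tendsto_zero_iff_abs_tendsto_zero _).2 t2, (tendsto_zero_iff_abs_tendsto_zero _).2 t1⟩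

/-- An even square integrable solution of `V'' = d₁ V - d₂ V²` vanishes or has the height of
the solitary wave. -/
lemma apply_zero_of_ode (hd2 : 0 < d2) (h1 : ∀ x, HasDerivAt V (V1 x) x)
    (h2 : ∀ x, HasDerivAt V1 (d1 * V x - d2 * V x ^ 2) x) (hV : MemLp V 2 volume)
    (h10 : V1 0 = 0) : V 0 = 0 ∨ V 0 = 3 * d1 / (2 * d2) := by
  obtain ⟨t0, t1⟩ := tendsto_zero_of_ode h1 h2 hV
  -- The first integral of the equation. It vanishes at infinity, hence at 0, where V1 = 0 leaves a
  -- cubic equation for V(0).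
  set E : ℝ → ℝ := fun x => V1 x ^ 2 - d1 * V x ^ 2 + 2 / 3 * d2 * V x ^ 3 with hE
  have hE' : ∀ x, HasDerivAt E 0 x := by
    intro x
    refine ((((h2 x).pow 2).sub (((h1 x).pow 2).const_mul d1)).add
      (((h1 x).pow 3).const_mul (2 / 3 * d2))).congr_deriv ?_
    simp
    ring
  have hconst : ∀ x, E x = E 0 := fun x =>
    is_const_of_deriv_eq_zero (fun y => (hE' y).differentiableAt) (fun y => (hE' y).deriv) x 0
  have hlim : Tendsto E atTop (𝓝 0) := by
    simpa using ((t1.pow 2).sub ((t0.pow 2).const_mul d1)).add ((t0.pow 3).const_mul (2 / 3 * d2))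
  have h0 : E 0 = 0 :=
    tendsto_nhds_unique (tendsto_const_nhds.congr fun x => (hconst x).symm) hlim
  simp only [hE, h10] at h0
  have h3 : V 0 ^ 2 * (2 * d2 * V 0 - 3 * d1) = 0 := by linear_combination 3 * h0
  rcases mul_eq_zero.1 h3 with h | h
  · exact Or.inl (pow_eq_zero_iff two_ne_zero |>.1 h)
  · right
    rw [eq_div_iff (by positivity)]
    linarith

end Uniqueness

end AtomicChain

/-! ### Green function of the linearised KdV operator -/

namespace AtomicChain

open scoped RealInnerProductSpace
open Filter Topology

section Green

/-- The decaying odd solution of `u'' = 4κ² (1 - 3 sech²(κx)) u`. -/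
noncomputable def decaySol (κ x : ℝ) : ℝ := Real.sinh (κ * x) / Real.cosh (κ * x) ^ 3

noncomputable def decaySolDeriv (κ x : ℝ) : ℝ :=
  κ * (3 / Real.cosh (κ * x) ^ 4 - 2 / Real.cosh (κ * x) ^ 2)

/-- The primitive of `1 + cosh² + cosh⁴` (in the variable `κ x`). -/
noncomputable def growthFactor (κ x : ℝ) : ℝ :=
  15 / 8 * (κ * x) + 7 / 8 * (Real.sinh (κ * x) * Real.cosh (κ * x)) +
    1 / 4 * (Real.sinh (κ * x) * Real.cosh (κ * x) ^ 3)

/-- The growing even solution of `u'' = 4κ² (1 - 3 sech²(κx)) u`. -/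
noncomputable def growSol (κ x : ℝ) : ℝ :=
  -(1 / Real.cosh (κ * x) ^ 2) + decaySol κ x * growthFactor κ x

noncomputable def growSolDeriv (κ x : ℝ) : ℝ :=
  2 * κ * decaySol κ x + (decaySolDeriv κ x * growthFactor κ x +
    decaySol κ x * (κ * (1 + Real.cosh (κ * x) ^ 2 + Real.cosh (κ * x) ^ 4)))

variable {κ : ℝ}

lemma hasDerivAt_decaySol (κ x : ℝ) : HasDerivAt (decaySol κ) (decaySolDeriv κ x) x := by
  have hc := (Real.cosh_pos (κ * x)).ne'
  refine ((hasDerivAt_sinh_mul κ x).div ((hasDerivAt_cosh_mul κ x).pow 3)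
    (pow_ne_zero 3 hc)).congr_deriv ?_
  rw [decaySolDeriv]
  have h' : Real.sinh (κ * x) ^ 2 = Real.cosh (κ * x) ^ 2 - 1 := by
    linarith [Real.cosh_sq (κ * x)]
  simp only [Pi.pow_apply]
  field_simp
  simp only [h']
  ring

/-- Up to a factor, sinh/cosh³ is the derivative of sech², that is, the translation mode. It is odd,
which is why the problem is solved among even functions. -/
lemma hasDerivAt_decaySolDeriv (κ x : ℝ) : HasDerivAt (decaySolDeriv κ)
    (4 * κ ^ 2 * (decaySol κ x - 3 * sechSq κ x * decaySol κ x)) x := by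
  have hc := (Real.cosh_pos (κ * x)).ne'
  refine ((((hasDerivAt_const x (3 : ℝ)).div ((hasDerivAt_cosh_mul κ x).pow 4)
    (pow_ne_zero 4 hc)).sub ((hasDerivAt_const x (2 : ℝ)).div ((hasDerivAt_cosh_mul κ x).pow 2)
    (pow_ne_zero 2 hc))).const_mul κ).congr_deriv ?_
  rw [decaySol, sechSq]
  simp only [Pi.pow_apply]
  field_simp
  norm_num
  ring

lemma hasDerivAt_growthFactor (κ x : ℝ) : HasDerivAt (growthFactor κ)
    (κ * (1 + Real.cosh (κ * x) ^ 2 + Real.cosh (κ * x) ^ 4)) x := by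
  have hs := hasDerivAt_sinh_mul κ x
  have hc := hasDerivAt_cosh_mul κ x
  refine (((((hasDerivAt_id x).const_mul κ).const_mul (15 / 8)).add
    ((hs.mul hc).const_mul (7 / 8))).add ((hs.mul (hc.pow 3)).const_mul (1 / 4))).congr_deriv ?_
  have h' : Real.sinh (κ * x) ^ 2 = Real.cosh (κ * x) ^ 2 - 1 := by
    linarith [Real.cosh_sq (κ * x)]
  simp only [Pi.pow_apply]
  ring_nf
  simp only [h']
  ring

lemma hasDerivAt_growSol (κ x : ℝ) : HasDerivAt (growSol κ) (growSolDeriv κ x) x := by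
  have h := (hasDerivAt_sechSq κ x).neg.add
    ((hasDerivAt_decaySol κ x).mul (hasDerivAt_growthFactor κ x))
  have e : growSol κ = -sechSq κ + decaySol κ * growthFactor κ := by
    funext x
    simp [growSol, sechSq]
  rw [e]
  refine h.congr_deriv ?_
  rw [growSolDeriv, sechSqDeriv, sechSq, decaySol]
  have hc := (Real.cosh_pos (κ * x)).ne'
  field_simp
  try ring

/-- Reduction of order with φ = sinh/cosh³: in the variable y = κx one has 1/φ² = 1 + cosh² + cosh⁴
+ 1/sinh². The primitive of the polynomial part is `growthFactor`, and -coth, the primitive of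
1/sinh², times φ is the term -1/cosh². -/
lemma hasDerivAt_growSolDeriv (κ x : ℝ) : HasDerivAt (growSolDeriv κ)
    (4 * κ ^ 2 * (growSol κ x - 3 * sechSq κ x * growSol κ x)) x := by
  have hc := (Real.cosh_pos (κ * x)).ne'
  have hcd := hasDerivAt_cosh_mul κ x
  have h := ((hasDerivAt_decaySol κ x).const_mul (2 * κ)).add
    (((hasDerivAt_decaySolDeriv κ x).mul (hasDerivAt_growthFactor κ x)).add
      ((hasDerivAt_decaySol κ x).mul
        ((((hcd.pow 2).const_add 1).add (hcd.pow 4)).const_mul κ)))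
  refine h.congr_deriv ?_
  have h' : Real.sinh (κ * x) ^ 2 = Real.cosh (κ * x) ^ 2 - 1 := by
    linarith [Real.cosh_sq (κ * x)]
  simp only [growSol, decaySol, decaySolDeriv, sechSq]
  generalize growthFactor κ x = G
  simp only [Pi.pow_apply, Pi.add_apply]
  field_simp
  norm_num
  ring_nf
  simp only [h']
  ring

lemma wronskian (κ x : ℝ) :
    decaySol κ x * growSolDeriv κ x - decaySolDeriv κ x * growSol κ x = κ := by
  have hc := (Real.cosh_pos (κ * x)).ne'
  have h' : Real.sinh (κ * x) ^ 2 = Real.cosh (κ * x) ^ 2 - 1 := by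
    linarith [Real.cosh_sq (κ * x)]
  simp only [growSol, decaySol, decaySolDeriv, growSolDeriv]
  generalize growthFactor κ x = G
  field_simp
  ring_nf
  simp only [h']
  ring

lemma abs_sinh_le_cosh (y : ℝ) : |Real.sinh y| ≤ Real.cosh y := by
  rw [Real.abs_sinh, ← Real.cosh_abs]
  exact (Real.sinh_lt_cosh _).le

lemma abs_decaySol_le (κ x : ℝ) : |decaySol κ x| ≤ sechSq κ x := by
  have hc := Real.cosh_pos (κ * x)
  rw [decaySol, sechSq, abs_div, abs_of_pos (pow_pos hc 3), div_le_iff₀ (pow_pos hc 3)]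
  refine (abs_sinh_le_cosh _).trans (le_of_eq ?_)
  field_simp

/-- The factor is O(cosh⁴), so its product with a function of size sech² is O(cosh²); this is the
growth rate of `growSol` and its derivative. -/
lemma abs_growthFactor_mul_le (κ x : ℝ) :
    sechSq κ x * |growthFactor κ x| ≤ 3 * Real.cosh (κ * x) ^ 2 := by
  have hc := Real.cosh_pos (κ * x)
  have hc1 := Real.one_le_cosh (κ * x)
  have hs := abs_sinh_le_cosh (κ * x)
  have hy : |κ * x| ≤ Real.cosh (κ * x) := by
    refine le_trans ?_ hs
    rw [Real.abs_sinh]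
    exact Real.self_le_sinh_iff.2 (abs_nonneg _)
  have h1 : |growthFactor κ x| ≤ 15 / 8 * Real.cosh (κ * x) + 7 / 8 * Real.cosh (κ * x) ^ 2 +
      1 / 4 * Real.cosh (κ * x) ^ 4 := by
    rw [growthFactor]
    refine (abs_add_three _ _ _).trans ?_
    simp only [abs_mul, abs_pow, abs_of_pos hc]
    rw [abs_mul] at hy
    have e1 : |Real.sinh (κ * x)| * Real.cosh (κ * x) ≤ Real.cosh (κ * x) ^ 2 := by
      rw [sq]
      gcongr
    have e2 : |Real.sinh (κ * x)| * Real.cosh (κ * x) ^ 3 ≤ Real.cosh (κ * x) ^ 4 := by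
      calc _ ≤ Real.cosh (κ * x) * Real.cosh (κ * x) ^ 3 := by gcongr
        _ = _ := by ring
    norm_num [abs_of_pos]
    linarith
  rw [sechSq, inv_mul_le_iff₀ (pow_pos hc 2)]
  refine h1.trans ?_
  have h2 : Real.cosh (κ * x) ≤ Real.cosh (κ * x) ^ 4 := le_self_pow₀ hc1 (by norm_num)
  have h3 : Real.cosh (κ * x) ^ 2 ≤ Real.cosh (κ * x) ^ 4 := pow_le_pow_right₀ hc1 (by norm_num)
  nlinarith

lemma abs_decaySolDeriv_le (hκ : 0 < κ) (x : ℝ) : |decaySolDeriv κ x| ≤ 5 * κ * sechSq κ x := by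
  have hc := Real.cosh_pos (κ * x)
  have hc1 := Real.one_le_cosh (κ * x)
  have h1 : 3 / Real.cosh (κ * x) ^ 4 ≤ 3 / Real.cosh (κ * x) ^ 2 := by
    gcongr 3 / ?_
    exact pow_le_pow_right₀ hc1 (by norm_num)
  have h2 : 0 < 3 / Real.cosh (κ * x) ^ 4 := by positivity
  have h3 : 0 < 2 / Real.cosh (κ * x) ^ 2 := by positivity
  have h4 : |3 / Real.cosh (κ * x) ^ 4 - 2 / Real.cosh (κ * x) ^ 2| ≤
      3 / Real.cosh (κ * x) ^ 2 + 2 / Real.cosh (κ * x) ^ 2 := by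
    rw [abs_le]
    constructor <;> linarith
  rw [decaySolDeriv, abs_mul, abs_of_pos hκ, sechSq]
  calc _ ≤ κ * (3 / Real.cosh (κ * x) ^ 2 + 2 / Real.cosh (κ * x) ^ 2) := by gcongr
    _ = _ := by ring

lemma abs_growSol_le (κ x : ℝ) : |growSol κ x| ≤ 4 * Real.cosh (κ * x) ^ 2 := by
  have hc1 := Real.one_le_cosh (κ * x)
  have h1 : |decaySol κ x * growthFactor κ x| ≤ 3 * Real.cosh (κ * x) ^ 2 := by
    rw [abs_mul]
    refine le_trans ?_ (abs_growthFactor_mul_le κ x)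
    gcongr
    exact abs_decaySol_le κ x
  have h2 := sechSq_le_one κ x
  have h3 := (sechSq_pos κ x).le
  rw [growSol, one_div]
  change |-(sechSq κ x) + _| ≤ _
  refine (abs_add_le _ _).trans ?_
  rw [abs_neg, abs_of_nonneg h3]
  nlinarith

lemma abs_growSolDeriv_le (hκ : 0 < κ) (x : ℝ) :
    |growSolDeriv κ x| ≤ 20 * κ * Real.cosh (κ * x) ^ 2 := by
  have hc := Real.cosh_pos (κ * x)
  have hc1 := Real.one_le_cosh (κ * x)
  have hS := (sechSq_pos κ x).le
  have h0 := abs_decaySol_le κ x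
  have h1 : |decaySolDeriv κ x * growthFactor κ x| ≤ 15 * κ * Real.cosh (κ * x) ^ 2 := by
    rw [abs_mul]
    calc _ ≤ 5 * κ * sechSq κ x * |growthFactor κ x| := by
          gcongr
          exact abs_decaySolDeriv_le hκ x
      _ = 5 * κ * (sechSq κ x * |growthFactor κ x|) := by ring
      _ ≤ 5 * κ * (3 * Real.cosh (κ * x) ^ 2) :=
          mul_le_mul_of_nonneg_left (abs_growthFactor_mul_le κ x) (by positivity)
      _ = _ := by ring
  have h2 : |decaySol κ x * (κ * (1 + Real.cosh (κ * x) ^ 2 + Real.cosh (κ * x) ^ 4))| ≤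
      κ * (3 * Real.cosh (κ * x) ^ 2) := by
    rw [abs_mul, abs_of_pos (by positivity :
      0 < κ * (1 + Real.cosh (κ * x) ^ 2 + Real.cosh (κ * x) ^ 4))]
    calc _ ≤ sechSq κ x * (κ * (3 * Real.cosh (κ * x) ^ 4)) := by
          gcongr
          have h3 : Real.cosh (κ * x) ^ 2 ≤ Real.cosh (κ * x) ^ 4 :=
            pow_le_pow_right₀ hc1 (by norm_num)
          have h4 : 1 ≤ Real.cosh (κ * x) ^ 4 := one_le_pow₀ hc1
          linarith
      _ = _ := by
          rw [sechSq]
          field_simp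
  have h3 : |2 * κ * decaySol κ x| ≤ 2 * κ * Real.cosh (κ * x) ^ 2 := by
    rw [abs_mul, abs_of_pos (by positivity : 0 < 2 * κ)]
    have := sechSq_le_one κ x
    gcongr
    nlinarith
  rw [growSolDeriv]
  refine (abs_add_le _ _).trans ?_
  have h4 := abs_add_le (decaySolDeriv κ x * growthFactor κ x)
    (decaySol κ x * (κ * (1 + Real.cosh (κ * x) ^ 2 + Real.cosh (κ * x) ^ 4)))
  linarith

/-- Decay at the outer point against growth at the inner one: this turns the Green function into a
convolution kernel. -/
lemma sechSq_mul_cosh_sq_le (hκ : 0 < κ) {x y : ℝ} (hy : 0 ≤ y) (hyx : y ≤ x) :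
    sechSq κ x * Real.cosh (κ * y) ^ 2 ≤ 4 * Real.exp (-(2 * κ) * (x - y)) := by
  have h1 : Real.cosh (κ * y) ≤ Real.exp (κ * y) := by
    rw [Real.cosh_eq]
    have : Real.exp (-(κ * y)) ≤ Real.exp (κ * y) := Real.exp_le_exp.2 (by nlinarith)
    linarith
  have h2 := sechSq_le_exp hκ x
  rw [abs_of_nonneg (hy.trans hyx)] at h2
  calc sechSq κ x * Real.cosh (κ * y) ^ 2
      ≤ (4 * Real.exp (-(2 * κ) * x)) * Real.exp (κ * y) ^ 2 := by
        have := Real.cosh_pos (κ * y)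
        gcongr
    _ = 4 * Real.exp (-(2 * κ) * (x - y)) := by
        rw [← Real.exp_nat_mul, mul_assoc, ← Real.exp_add]
        congr 2
        push_cast
        ring

/-- The exponential kernel dominating the Green function. -/
lemma abs_green_le (hκ : 0 < κ) {g p r : ℝ → ℝ} {P : ℝ} (hg : Continuous g)
    (hgs : HasCompactSupport g) (hp : ∀ x, |p x| ≤ P * sechSq κ x)
    (hr : ∀ x, |r x| ≤ P * Real.cosh (κ * x) ^ 2) {x : ℝ} (hx : 0 ≤ x) :
    |p x * (∫ y in (0)..x, growSol κ y * g y) + r x * ∫ y in Set.Ioi x, decaySol κ y * g y| ≤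
      16 * P * ∫ t, Real.exp (-(2 * κ) * |t|) * |g (x + t)| := by
  have hP : 0 ≤ P := by
    have h1 := (abs_nonneg _).trans (hp x)
    exact nonneg_of_mul_nonneg_left h1 (sechSq_pos κ x)
  set E : ℝ → ℝ := fun y => Real.exp (-(2 * κ) * |y - x|) * |g y| with hE
  have hEi : Integrable E := by
    refine Continuous.integrable_of_hasCompactSupport (by fun_prop) ?_
    exact hgs.abs.mul_left
  have hE0 : ∀ y, 0 ≤ E y := fun y => by positivity
  have h1 : |p x * (∫ y in (0)..x, growSol κ y * g y)| ≤ ∫ y in Set.Ioc 0 x, 16 * P * E y := by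
    rw [← intervalIntegral.integral_const_mul, ← intervalIntegral.integral_of_le hx,
      ← Real.norm_eq_abs]
    refine intervalIntegral.norm_integral_le_of_norm_le hx (Eventually.of_forall fun y hy => ?_)
      ((hEi.const_mul _).intervalIntegrable)
    have h2 := sechSq_mul_cosh_sq_le hκ hy.1.le hy.2
    rw [Real.norm_eq_abs, abs_mul, abs_mul, ← mul_assoc]
    simp only [hE]
    rw [abs_sub_comm, abs_of_nonneg (sub_nonneg.2 hy.2), ← mul_assoc]
    refine mul_le_mul_of_nonneg_right ?_ (abs_nonneg _)
    calc |p x| * |growSol κ y| ≤ (P * sechSq κ x) * (4 * Real.cosh (κ * y) ^ 2) :=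
          mul_le_mul (hp x) (abs_growSol_le κ y) (abs_nonneg _) ((abs_nonneg _).trans (hp x))
      _ = 4 * P * (sechSq κ x * Real.cosh (κ * y) ^ 2) := by ring
      _ ≤ 4 * P * (4 * Real.exp (-(2 * κ) * (x - y))) := by gcongr
      _ = _ := by ring
  have h3 : |r x * ∫ y in Set.Ioi x, decaySol κ y * g y| ≤ ∫ y in Set.Ioi x, 16 * P * E y := by
    rw [← integral_const_mul, ← Real.norm_eq_abs]
    refine norm_integral_le_of_norm_le ((hEi.const_mul _).integrableOn) ?_
    refine (ae_restrict_iff' measurableSet_Ioi).2 (Eventually.of_forall fun y hy => ?_)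
    have hy' : x ≤ y := le_of_lt hy
    have h2 := sechSq_mul_cosh_sq_le hκ hx hy'
    rw [Real.norm_eq_abs, abs_mul, abs_mul, ← mul_assoc]
    simp only [hE]
    rw [abs_of_nonneg (sub_nonneg.2 hy'), ← mul_assoc]
    refine mul_le_mul_of_nonneg_right ?_ (abs_nonneg _)
    calc |r x| * |decaySol κ y| ≤ (P * Real.cosh (κ * x) ^ 2) * sechSq κ y :=
          mul_le_mul (hr x) (abs_decaySol_le κ y) (abs_nonneg _) ((abs_nonneg _).trans (hr x))
      _ = P * (sechSq κ y * Real.cosh (κ * x) ^ 2) := by ring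
      _ ≤ P * (4 * Real.exp (-(2 * κ) * (y - x))) := by gcongr
      _ ≤ _ := by
        have : 0 ≤ P * Real.exp (-(2 * κ) * (y - x)) := by positivity
        nlinarith
  have h4 : (∫ y in Set.Ioc 0 x, 16 * P * E y) + ∫ y in Set.Ioi x, 16 * P * E y =
      ∫ y in Set.Ioi 0, 16 * P * E y := by
    rw [← Set.Ioc_union_Ioi_eq_Ioi hx, setIntegral_union Set.Ioc_disjoint_Ioi_same
      measurableSet_Ioi (hEi.const_mul _).integrableOn (hEi.const_mul _).integrableOn]
  have h5 : ∫ y in Set.Ioi 0, 16 * P * E y ≤ ∫ y, 16 * P * E y :=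
    setIntegral_le_integral (hEi.const_mul _)
      (Eventually.of_forall fun y => mul_nonneg (by positivity) (hE0 y))
  have h6 : ∫ t, Real.exp (-(2 * κ) * |t|) * |g (x + t)| = ∫ y, E y := by
    rw [← integral_add_left_eq_self E x]
    simp [hE]
  have h7 : ∫ y, 16 * P * E y = 16 * P * ∫ y, E y := integral_const_mul _ _
  rw [h6]
  refine (abs_add_le _ _).trans ?_
  linarith

lemma integral_zero_neg_of_even {f : ℝ → ℝ} (hf : ∀ x, f (-x) = f x) (x : ℝ) :
    ∫ y in (0)..(-x), f y = -∫ y in (0)..x, f y := by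
  have h := intervalIntegral.integral_comp_neg (a := 0) (b := x) f
  simp only [hf, neg_zero] at h
  rw [h, intervalIntegral.integral_symm]

lemma integral_zero_neg_of_odd {f : ℝ → ℝ} (hf : ∀ x, f (-x) = -f x) (x : ℝ) :
    ∫ y in (0)..(-x), f y = ∫ y in (0)..x, f y := by
  have h := intervalIntegral.integral_comp_neg (a := 0) (b := x) f
  simp only [hf, neg_zero, intervalIntegral.integral_neg] at h
  rw [intervalIntegral.integral_symm, ← h, neg_neg]

lemma decaySol_neg (κ x : ℝ) : decaySol κ (-x) = -decaySol κ x := by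
  simp [decaySol, neg_div]

lemma growSol_neg (κ x : ℝ) : growSol κ (-x) = growSol κ x := by
  simp only [growSol, decaySol, growthFactor, mul_neg, Real.cosh_neg, Real.sinh_neg]
  ring

lemma decaySolDeriv_neg (κ x : ℝ) : decaySolDeriv κ (-x) = decaySolDeriv κ x := by
  simp [decaySolDeriv]

lemma growSolDeriv_neg (κ x : ℝ) : growSolDeriv κ (-x) = -growSolDeriv κ x := by
  simp only [growSolDeriv, decaySol, decaySolDeriv, growthFactor, mul_neg, Real.cosh_neg,
    Real.sinh_neg]
  ring

/-- Solvability of the linearised solitary wave equation for even right-hand sides. -/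
lemma exists_green_solution (hκ : 0 < κ) : ∃ C : ℝ, 0 < C ∧ ∀ g : ℝ → ℝ, Continuous g →
    HasCompactSupport g → (∀ x, g (-x) = g x) → ∃ v v₁ : ℝ → ℝ,
      (∀ x, HasDerivAt v (v₁ x) x) ∧
      (∀ x, HasDerivAt v₁ (4 * κ ^ 2 * (v x - 3 * sechSq κ x * v x - g x)) x) ∧
      (∀ x, |v x| ≤ C * ∫ t, Real.exp (-(2 * κ) * |t|) * |g (x + t)|) ∧
      (∀ x, |v₁ x| ≤ C * ∫ t, Real.exp (-(2 * κ) * |t|) * |g (x + t)|) := by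
  refine ⟨4 * κ * (16 * (4 + 20 * κ)), by positivity, fun g hg hgs hge => ?_⟩
  have hφc : Continuous (decaySol κ) :=
    continuous_iff_continuousAt.2 fun x => (hasDerivAt_decaySol κ x).continuousAt
  have hψc : Continuous (growSol κ) :=
    continuous_iff_continuousAt.2 fun x => (hasDerivAt_growSol κ x).continuousAt
  have hφg : Continuous fun y => decaySol κ y * g y := hφc.mul hg
  have hψg : Continuous fun y => growSol κ y * g y := hψc.mul hg
  have hφi : Integrable fun y => decaySol κ y * g y :=
    hφg.integrable_of_hasCompactSupport hgs.mul_left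
  set I := ∫ y in Set.Ioi 0, decaySol κ y * g y with hI
  have htail : ∀ x, I - ∫ y in (0)..x, decaySol κ y * g y = ∫ y in Set.Ioi x, decaySol κ y * g y := by
    intro x
    rw [← intervalIntegral.integral_Ioi_sub_Ioi' hφi.integrableOn hφi.integrableOn]
    ring
  have hd1 : ∀ x, HasDerivAt (fun x => ∫ y in (0)..x, growSol κ y * g y) (growSol κ x * g x) x :=
    fun x => (hψg.integral_hasStrictDerivAt 0 x).hasDerivAt
  have hd2 : ∀ x, HasDerivAt (fun x => I - ∫ y in (0)..x, decaySol κ y * g y)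
      (-(decaySol κ x * g x)) x :=
    fun x => ((hφg.integral_hasStrictDerivAt 0 x).hasDerivAt).const_sub I
  -- Variation of constants; 4κ is 4κ² divided by the Wronskian κ. The tail integral over (x, ∞) is
  -- written as I minus an integral from 0 so that it can be differentiated. For even g both
  -- summands are even, so bounds for x ≥ 0 carry over to x ≤ 0.
  set v : ℝ → ℝ := fun x => 4 * κ * (decaySol κ x * (∫ y in (0)..x, growSol κ y * g y) +
    growSol κ x * (I - ∫ y in (0)..x, decaySol κ y * g y)) with hv
  set v₁ : ℝ → ℝ := fun x => 4 * κ * (decaySolDeriv κ x * (∫ y in (0)..x, growSol κ y * g y) +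
    growSolDeriv κ x * (I - ∫ y in (0)..x, decaySol κ y * g y)) with hv₁
  have even1 : ∀ x, ∫ y in (0)..(-x), growSol κ y * g y = -∫ y in (0)..x, growSol κ y * g y :=
    fun x => integral_zero_neg_of_even (fun y => by rw [growSol_neg, hge]) x
  have even2 : ∀ x, ∫ y in (0)..(-x), decaySol κ y * g y = ∫ y in (0)..x, decaySol κ y * g y :=
    fun x => integral_zero_neg_of_odd (fun y => by rw [decaySol_neg, hge, neg_mul]) x
  have hve : ∀ x, v (-x) = v x := fun x => by
    simp only [hv, even1, even2, decaySol_neg, growSol_neg, neg_mul_neg]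
  have hv₁e : ∀ x, |v₁ (-x)| = |v₁ x| := fun x => by
    simp only [hv₁, even1, even2, decaySolDeriv_neg, growSolDeriv_neg]
    rw [← abs_neg]
    congr 1
    ring
  have hJe : ∀ x, ∫ t, Real.exp (-(2 * κ) * |t|) * |g (-x + t)| =
      ∫ t, Real.exp (-(2 * κ) * |t|) * |g (x + t)| := by
    intro x
    rw [← integral_neg_eq_self]
    refine integral_congr_ae (Eventually.of_forall fun t => ?_)
    simp only
    rw [abs_neg, ← neg_add, hge]
  have hext : ∀ w : ℝ → ℝ, (∀ x, |w (-x)| = |w x|) →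
      (∀ x, 0 ≤ x → |w x| ≤ 4 * κ * (16 * (4 + 20 * κ)) *
        ∫ t, Real.exp (-(2 * κ) * |t|) * |g (x + t)|) →
      ∀ x, |w x| ≤ 4 * κ * (16 * (4 + 20 * κ)) *
        ∫ t, Real.exp (-(2 * κ) * |t|) * |g (x + t)| := by
    intro w hw hpos x
    rcases le_total 0 x with h | h
    · exact hpos x h
    · rw [← hw, ← hJe]
      exact hpos (-x) (by linarith)
  refine ⟨v, v₁, fun x => ?_, fun x => ?_, hext v (fun x => by rw [hve]) fun x hx => ?_,
    hext v₁ hv₁e fun x hx => ?_⟩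
  · refine ((((hasDerivAt_decaySol κ x).mul (hd1 x)).add
      ((hasDerivAt_growSol κ x).mul (hd2 x))).const_mul (4 * κ)).congr_deriv ?_
    simp only [hv₁]
    ring
  · refine ((((hasDerivAt_decaySolDeriv κ x).mul (hd1 x)).add
      ((hasDerivAt_growSolDeriv κ x).mul (hd2 x))).const_mul (4 * κ)).congr_deriv ?_
    simp only [hv]
    linear_combination (-(4 * κ * g x)) * wronskian κ x
  · have h := abs_green_le hκ (P := 4 + 20 * κ) hg hgs
      (fun x => (abs_decaySol_le κ x).trans (le_mul_of_one_le_left (sechSq_pos κ x).le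
        (by linarith)))
      (fun x => (abs_growSol_le κ x).trans (by gcongr; linarith)) hx
    simp only [hv, htail]
    rw [abs_mul, abs_of_pos (by positivity : 0 < 4 * κ), mul_assoc (4 * κ)]
    exact mul_le_mul_of_nonneg_left h (by positivity)
  · have h := abs_green_le hκ (P := 4 + 20 * κ) hg hgs
      (fun x => (abs_decaySolDeriv_le hκ x).trans
        (mul_le_mul_of_nonneg_right (by linarith) (sechSq_pos κ x).le))
      (fun x => (abs_growSolDeriv_le hκ x).trans (by gcongr; linarith)) hx
    simp only [hv₁, htail]
    rw [abs_mul, abs_of_pos (by positivity : 0 < 4 * κ), mul_assoc (4 * κ)]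
    exact mul_le_mul_of_nonneg_left h (by positivity)

end Green

end AtomicChain

/-! ### Multiplication operators and the Green solution in L² -/

namespace AtomicChain

open scoped RealInnerProductSpace
open Filter Topology

section MulOp

lemma memLp_bounded_mul {b : ℝ → ℝ} (hb : Continuous b) {B : ℝ} (h : ∀ x, |b x| ≤ B) (u : L2) :
    MemLp (fun x => b x * u x) 2 volume := by
  have h1 : MemLp (fun x => B * u x) 2 volume := (Lp.memLp u).const_mul B
  refine h1.mono (hb.aestronglyMeasurable.mul (Lp.aestronglyMeasurable u))
    (Eventually.of_forall fun x => ?_)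
  rw [norm_mul, norm_mul, Real.norm_eq_abs, Real.norm_eq_abs]
  gcongr
  exact (h x).trans (le_abs_self B)

lemma norm_le_mul_norm_of_ae_le {u v : L2} {c : ℝ}
    (h : ∀ᵐ x, |u x| ≤ c * |v x|) : ‖u‖ ≤ c * ‖v‖ :=
  Lp.norm_le_mul_norm_of_ae_le_mul h

open Classical in
/-- Multiplication by a bounded continuous function on `L²(ℝ)`. -/
noncomputable def mulOp (b : ℝ → ℝ) : L2 →L[ℝ] L2 :=
  if h : Continuous b ∧ ∃ B, ∀ x, |b x| ≤ B then
    LinearMap.mkContinuousOfExistsBound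
      { toFun := fun u => (memLp_bounded_mul h.1 h.2.choose_spec u).toLp _
        map_add' := fun u v => by
          apply Lp.ext
          filter_upwards [(memLp_bounded_mul h.1 h.2.choose_spec (u + v)).coeFn_toLp,
            (memLp_bounded_mul h.1 h.2.choose_spec u).coeFn_toLp,
            (memLp_bounded_mul h.1 h.2.choose_spec v).coeFn_toLp,
            Lp.coeFn_add ((memLp_bounded_mul h.1 h.2.choose_spec u).toLp _)
              ((memLp_bounded_mul h.1 h.2.choose_spec v).toLp _), Lp.coeFn_add u v]
            with x h1 h2 h3 h4 h5
          rw [h1, h4, Pi.add_apply, h2, h3, h5, Pi.add_apply, mul_add]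
        map_smul' := fun c u => by
          apply Lp.ext
          filter_upwards [(memLp_bounded_mul h.1 h.2.choose_spec (c • u)).coeFn_toLp,
            (memLp_bounded_mul h.1 h.2.choose_spec u).coeFn_toLp,
            Lp.coeFn_smul c ((memLp_bounded_mul h.1 h.2.choose_spec u).toLp _), Lp.coeFn_smul c u]
            with x h1 h2 h3 h4
          rw [h1, RingHom.id_apply, h3, Pi.smul_apply, h2, h4, Pi.smul_apply, smul_eq_mul,
            smul_eq_mul]
          ring }
      ⟨|h.2.choose|, fun u => by
        refine norm_le_mul_norm_of_ae_le ?_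
        filter_upwards [(memLp_bounded_mul h.1 h.2.choose_spec u).coeFn_toLp] with x h1
        simp only [LinearMap.coe_mk, AddHom.coe_mk]
        rw [h1, abs_mul]
        exact mul_le_mul_of_nonneg_right ((h.2.choose_spec x).trans (le_abs_self _))
          (abs_nonneg _)⟩
  else 0

variable {b : ℝ → ℝ} {B : ℝ}

lemma coeFn_mulOp (hb : Continuous b) (h : ∀ x, |b x| ≤ B) (u : L2) :
    mulOp b u =ᵐ[volume] fun x => b x * u x := by
  have hh : Continuous b ∧ ∃ B, ∀ x, |b x| ≤ B := ⟨hb, B, h⟩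
  rw [mulOp, dif_pos hh]
  exact (memLp_bounded_mul hh.1 hh.2.choose_spec u).coeFn_toLp

lemma norm_mulOp_le (hb : Continuous b) (h : ∀ x, |b x| ≤ B) (u : L2) : ‖mulOp b u‖ ≤ B * ‖u‖ := by
  refine norm_le_mul_norm_of_ae_le ?_
  filter_upwards [coeFn_mulOp hb h u] with x hx
  rw [hx, abs_mul]
  gcongr
  exact h x

lemma inner_mulOp_left (hb : Continuous b) (h : ∀ x, |b x| ≤ B) (u v : L2) :
    ⟪mulOp b u, v⟫ = ⟪u, mulOp b v⟫ := by
  rw [L2.inner_def, L2.inner_def]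
  refine integral_congr_ae ?_
  filter_upwards [coeFn_mulOp hb h u, coeFn_mulOp hb h v] with x h1 h2
  simp only [h1, h2, RCLike.inner_apply, conj_trivial]
  ring

lemma reflect_mulOp (hb : Continuous b) (h : ∀ x, |b x| ≤ B) (he : ∀ x, b (-x) = b x) (u : L2) :
    reflect (mulOp b u) = mulOp b (reflect u) := by
  apply Lp.ext
  filter_upwards [coeFn_reflect (mulOp b u), ae_comp_neg (coeFn_mulOp hb h u),
    coeFn_mulOp hb h (reflect u), coeFn_reflect u] with x h1 h2 h3 h4
  rw [h1, h2, h3, h4, he]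

lemma norm_mulOp_sub_le {b' : ℝ → ℝ} {B' δ : ℝ} (hb : Continuous b) (h : ∀ x, |b x| ≤ B)
    (hb' : Continuous b') (h' : ∀ x, |b' x| ≤ B') (hδ : ∀ x, |b x - b' x| ≤ δ) (u : L2) :
    ‖mulOp b u - mulOp b' u‖ ≤ δ * ‖u‖ := by
  refine norm_le_mul_norm_of_ae_le ?_
  filter_upwards [coeFn_mulOp hb h u, coeFn_mulOp hb' h' u,
    Lp.coeFn_sub (mulOp b u) (mulOp b' u)] with x h1 h2 h3
  rw [h3, Pi.sub_apply, h1, h2, ← sub_mul, abs_mul]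
  gcongr
  exact hδ x

end MulOp

/-- `L²` version of the solvability of the linearised solitary wave equation. -/
lemma exists_green_solution_L2 {κ : ℝ} (hκ : 0 < κ) : ∃ C : ℝ, 0 < C ∧ ∀ (g : ℝ → ℝ)
    (_ : Continuous g) (_ : HasCompactSupport g) (_ : ∀ x, g (-x) = g x) (hm : MemLp g 2 volume),
    ∃ v v₁ : L2,
      HasL2Derivs v v₁ ((4 * κ ^ 2) • (v - (3 : ℝ) • mulOp (sechSq κ) v - hm.toLp g)) ∧
      ‖v‖ ≤ C * ‖hm.toLp g‖ := by
  obtain ⟨C, hC, hsol⟩ := exists_green_solution hκ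
  set k : ℝ → ℝ := fun t => Real.exp (-(2 * κ) * |t|) with hk
  have hki : Integrable k := integrable_exp_neg_mul_abs (by positivity)
  have hk0 : 0 ≤ ∫ t, k t := integral_nonneg fun t => (Real.exp_pos _).le
  have hS : Continuous (sechSq κ) := (contDiff_sechSq κ (n := 0)).continuous
  have hS1 : ∀ x, |sechSq κ x| ≤ 1 := fun x => by
    rw [abs_of_pos (sechSq_pos κ x)]
    exact sechSq_le_one κ x
  refine ⟨C * (∫ t, k t) + 1, by positivity, fun g hg hgs hge hm => ?_⟩
  obtain ⟨v, v₁, hv, hv₁, hb, hb₁⟩ := hsol g hg hgs hge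
  have hma : MemLp (fun x => |g x|) 2 volume := hm.abs
  -- Young's inequality in disguise: the convolution of |g| with the exponential kernel is a
  -- superposition of translates, so its norm is at most ∫ k times that of g, and it dominates v and
  -- v₁ pointwise.
  set U : L2 := ∫ t, k t • shift t (hma.toLp _) with hU
  have hUle : ‖U‖ ≤ (∫ t, k t) * ‖hm.toLp g‖ := by
    refine (norm_integral_le_integral_norm _).trans ?_
    rw [← integral_mul_const]
    refine le_of_eq (integral_congr_ae (Eventually.of_forall fun t => ?_))
    simp only
    rw [norm_smul, (shift t).norm_map, Real.norm_of_nonneg (Real.exp_pos _).le, Lp.norm_toLp,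
      Lp.norm_toLp]
    congr 2
    exact eLpNorm_norm g
  have hUc : U =ᵐ[volume] fun x => ∫ t, k t * |g (x + t)| := by
    filter_upwards [coeFn_integral_smul_shift hki (hma.toLp _)] with x hx
    rw [hx]
    refine integral_congr_ae ?_
    filter_upwards [ae_comp_add hma.coeFn_toLp x] with t ht
    rw [add_comm x t, ht]
  have hCU : MemLp (fun x => C * U x) 2 volume := (Lp.memLp U).const_mul C
  have hvc : Continuous v := continuous_iff_continuousAt.2 fun x => (hv x).continuousAt
  have hvc₁ : Continuous v₁ := continuous_iff_continuousAt.2 fun x => (hv₁ x).continuousAt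
  have hdom : ∀ {w : ℝ → ℝ}, (∀ x, |w x| ≤ C * ∫ t, k t * |g (x + t)|) →
      ∀ᵐ x, ‖w x‖ ≤ ‖C * U x‖ := fun hw => by
    filter_upwards [hUc] with x hx
    rw [hx]
    exact (hw x).trans (le_abs_self _)
  have hvm : MemLp v 2 volume := hCU.mono hvc.aestronglyMeasurable (hdom hb)
  have hvm₁ : MemLp v₁ 2 volume := hCU.mono hvc₁.aestronglyMeasurable (hdom hb₁)
  set V : L2 := (4 * κ ^ 2) • (hvm.toLp v - (3 : ℝ) • mulOp (sechSq κ) (hvm.toLp v) - hm.toLp g)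
    with hV
  have hVae : V =ᵐ[volume] fun x => 4 * κ ^ 2 * (v x - 3 * sechSq κ x * v x - g x) := by
    filter_upwards [Lp.coeFn_smul (4 * κ ^ 2)
      (hvm.toLp v - (3 : ℝ) • mulOp (sechSq κ) (hvm.toLp v) - hm.toLp g),
      Lp.coeFn_sub (hvm.toLp v - (3 : ℝ) • mulOp (sechSq κ) (hvm.toLp v)) (hm.toLp g),
      Lp.coeFn_sub (hvm.toLp v) ((3 : ℝ) • mulOp (sechSq κ) (hvm.toLp v)),
      Lp.coeFn_smul (3 : ℝ) (mulOp (sechSq κ) (hvm.toLp v)),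
      coeFn_mulOp hS hS1 (hvm.toLp v), hvm.coeFn_toLp, hm.coeFn_toLp] with x h1 h2 h3 h4 h5 h6 h7
    rw [h1, Pi.smul_apply, h2, Pi.sub_apply, h3, Pi.sub_apply, h4, Pi.smul_apply, h5, h6, h7,
      smul_eq_mul, smul_eq_mul]
    ring
  have hvm₂ : MemLp (fun x => 4 * κ ^ 2 * (v x - 3 * sechSq κ x * v x - g x)) 2 volume :=
    (memLp_congr_ae hVae).1 (Lp.memLp V)
  refine ⟨hvm.toLp v, hvm₁.toLp v₁, ?_, ?_⟩
  · have h := hasL2Derivs_toLp hv hv₁ (by fun_prop) hvm hvm₁ hvm₂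
    have e : hvm₂.toLp _ = V := Lp.ext (hvm₂.coeFn_toLp.trans hVae.symm)
    rwa [e] at h
  · have h1 : ‖hvm.toLp v‖ ≤ C * ‖U‖ := by
      refine norm_le_mul_norm_of_ae_le ?_
      filter_upwards [hvm.coeFn_toLp, hdom hb] with x h2 h3
      rw [h2]
      rwa [norm_mul, Real.norm_of_nonneg hC.le] at h3
    calc _ ≤ C * ((∫ t, k t) * ‖hm.toLp g‖) := h1.trans (by gcongr)
      _ ≤ _ := by
        have := norm_nonneg (hm.toLp g)
        nlinarith

end AtomicChain

/-! ### The dispersive operator B_ε and the linearised quadratic part Q_ε -/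

namespace AtomicChain

open scoped RealInnerProductSpace
open Filter Topology

section Abstract

variable {H : Type*} [NormedAddCommGroup H] [InnerProductSpace ℝ H] [CompleteSpace H]

/-- A symmetric bounded operator that is bounded below is onto. -/
lemma surjective_of_symmetric_of_bounded_below (T : H →L[ℝ] H) (hs : ∀ u v, ⟪T u, v⟫ = ⟪u, T v⟫)
    {c : ℝ} (h : ∀ u, ‖u‖ ≤ c * ‖T u‖) : Function.Surjective T := by
  have hanti : AntilipschitzWith c.toNNReal T := by
    refine AddMonoidHomClass.antilipschitz_of_bound T fun u => (h u).trans ?_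
    gcongr
    exact Real.le_coe_toNNReal c
  have hclosed : IsClosed (Set.range T) := hanti.isClosed_range T.uniformContinuous
  have hcomplete : IsComplete (LinearMap.range (T : H →ₗ[ℝ] H) : Set H) := by
    rw [LinearMap.coe_range]
    exact hclosed.isComplete
  have : CompleteSpace (LinearMap.range (T : H →ₗ[ℝ] H)) := hcomplete.completeSpace_coe
  have htop : LinearMap.range (T : H →ₗ[ℝ] H) = ⊤ := by
    rw [← Submodule.orthogonal_eq_bot_iff, Submodule.eq_bot_iff]
    intro v hv
    have h1 : T v = 0 := by
      rw [← inner_self_eq_zero (𝕜 := ℝ), ← hs, real_inner_comm]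
      exact (Submodule.mem_orthogonal' _ _).1 hv _ ⟨T v, rfl⟩
    have h2 := h v
    rw [h1, norm_zero, mul_zero] at h2
    exact norm_le_zero_iff.1 h2
  intro v
  have hv : v ∈ LinearMap.range (T : H →ₗ[ℝ] H) := htop ▸ Submodule.mem_top
  exact hv

end Abstract

lemma norm_mean_sub_le_of_shift {η δ : ℝ} (hη : 0 < η) {z : L2}
    (hz : ∀ s, |s| ≤ η → ‖shift s z - z‖ ≤ δ) : ‖mean η z - z‖ ≤ δ := by
  have e : mean η z - z = (1 / η) • ∫ t in (-(η / 2))..(η / 2), (shift t z - z) := by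
    rw [intervalIntegral.integral_sub (intervalIntegrable_shift z _ _) (by simp), smul_sub,
      ← mean_apply, intervalIntegral.integral_const, smul_smul]
    congr 1
    rw [show 1 / η * (η / 2 - -(η / 2)) = 1 by field_simp; ring, one_smul]
  have h1 := intervalIntegral.norm_integral_le_of_norm_le_const (a := -(η / 2)) (b := η / 2)
    (f := fun t => shift t z - z) (C := δ) (fun t ht => by
      rw [Set.uIoc_of_le (by linarith)] at ht
      exact hz t (abs_le.2 ⟨by linarith [ht.1], by linarith [ht.2]⟩))
  rw [show η / 2 - -(η / 2) = η by ring, abs_of_pos hη] at h1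
  rw [e, norm_smul, Real.norm_of_nonneg (by positivity : 0 ≤ 1 / η)]
  calc _ ≤ 1 / η * (δ * η) := by gcongr
    _ = δ := by field_simp

/-- The operator `B_ε = 1 + ∑ α_m m² (1 - A_{mε}²) / ε²`. -/
noncomputable def dispOp (M : ℕ) (α : ℕ → ℝ) (ε : ℝ) : L2 →L[ℝ] L2 :=
  ContinuousLinearMap.id ℝ L2 + ∑ m ∈ Finset.Icc 1 M, (α m * (m : ℝ) ^ 2 / ε ^ 2) •
    (ContinuousLinearMap.id ℝ L2 - (mean (m * ε)).comp (mean (m * ε)))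

/-- The linearisation of the quadratic nonlinearity at the profile `W`. -/
noncomputable def quadOp (M : ℕ) (β : ℕ → ℝ) (W : ℝ → ℝ) (ε : ℝ) : L2 →L[ℝ] L2 :=
  ∑ m ∈ Finset.Icc 1 M, (2 * β m * (m : ℝ) ^ 3) •
    (mean (m * ε)).comp ((mulOp (avg (m * ε) W)).comp (mean (m * ε)))

section Operators

variable {M : ℕ} {α β : ℕ → ℝ} {ε : ℝ}

lemma dispOp_apply (u : L2) : dispOp M α ε u = u + ∑ m ∈ Finset.Icc 1 M,
    (α m * (m : ℝ) ^ 2 / ε ^ 2) • (u - mean (m * ε) (mean (m * ε) u)) := by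
  simp [dispOp]

lemma quadOp_apply (W : ℝ → ℝ) (u : L2) : quadOp M β W ε u = ∑ m ∈ Finset.Icc 1 M,
    (2 * β m * (m : ℝ) ^ 3) • mean (m * ε) (mulOp (avg (m * ε) W) (mean (m * ε) u)) := by
  simp [quadOp]

lemma inner_dispOp_left (u v : L2) : ⟪dispOp M α ε u, v⟫ = ⟪u, dispOp M α ε v⟫ := by
  simp only [dispOp_apply, inner_add_left, inner_add_right, sum_inner, inner_sum,
    real_inner_smul_left, real_inner_smul_right, inner_sub_left, inner_sub_right, inner_mean_left]

lemma reflect_dispOp (u : L2) : reflect (dispOp M α ε u) = dispOp M α ε (reflect u) := by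
  simp only [dispOp_apply, map_add, map_sum, map_smul, map_sub, reflect_mean]

lemma inner_dispOp_self (u : L2) : ⟪dispOp M α ε u, u⟫ = ‖u‖ ^ 2 + ∑ m ∈ Finset.Icc 1 M,
    α m * (m : ℝ) ^ 2 / ε ^ 2 * (‖u‖ ^ 2 - ‖mean (m * ε) u‖ ^ 2) := by
  simp only [dispOp_apply, inner_add_left, sum_inner, real_inner_smul_left, inner_sub_left,
    inner_mean_left, real_inner_self_eq_norm_sq]

lemma norm_sq_sub_norm_mean_sq_nonneg (η : ℝ) (u : L2) : 0 ≤ ‖u‖ ^ 2 - ‖mean η u‖ ^ 2 := by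
  have h := norm_mean_le η u
  have h0 := norm_nonneg (mean η u)
  nlinarith

lemma norm_sq_le_inner_dispOp (hα : ∀ m ∈ Finset.Icc 1 M, 0 < α m) (u : L2) :
    ‖u‖ ^ 2 ≤ ⟪dispOp M α ε u, u⟫ := by
  rw [inner_dispOp_self]
  refine le_add_of_nonneg_right (Finset.sum_nonneg fun m hm => ?_)
  have := hα m hm
  exact mul_nonneg (by positivity) (norm_sq_sub_norm_mean_sq_nonneg _ u)

lemma norm_le_norm_dispOp (hα : ∀ m ∈ Finset.Icc 1 M, 0 < α m) (u : L2) :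
    ‖u‖ ≤ ‖dispOp M α ε u‖ := by
  have h1 := norm_sq_le_inner_dispOp (ε := ε) hα u
  have h2 := real_inner_le_norm (dispOp M α ε u) u
  by_contra! h
  have h3 := norm_nonneg (dispOp M α ε u)
  nlinarith

lemma dispOp_surjective (hα : ∀ m ∈ Finset.Icc 1 M, 0 < α m) :
    Function.Surjective (dispOp M α ε) :=
  surjective_of_symmetric_of_bounded_below _ inner_dispOp_left (c := 1)
    (by simpa using norm_le_norm_dispOp hα)

/-- Resolvent estimate for differences of translates. -/
lemma norm_shift_sub_le_dispOp (hM : 1 ≤ M) (hα : ∀ m ∈ Finset.Icc 1 M, 0 < α m) (hε : 0 < ε)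
    (z : L2) {s : ℝ} (hs : |s| ≤ M * ε) :
    ‖shift s z - z‖ ≤ √(32 / (α M * (M : ℝ) ^ 2)) * ε * ‖dispOp M α ε z‖ := by
  have hMm : M ∈ Finset.Icc 1 M := Finset.mem_Icc.2 ⟨hM, le_rfl⟩
  have hαM := hα M hMm
  have hM0 : (0 : ℝ) < M := by exact_mod_cast hM
  have h1 := norm_shift_sub_sq_le (by positivity : 0 < M * ε) hs z
  -- All terms of the quadratic form are nonnegative. Only m = M is kept, because the longest window
  -- controls translates up to Mε and hence those needed for every m.
  have h2 : α M * (M : ℝ) ^ 2 / ε ^ 2 * (‖z‖ ^ 2 - ‖mean (M * ε) z‖ ^ 2) ≤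
      ∑ m ∈ Finset.Icc 1 M, α m * (m : ℝ) ^ 2 / ε ^ 2 * (‖z‖ ^ 2 - ‖mean (m * ε) z‖ ^ 2) := by
    refine Finset.single_le_sum (f := fun m : ℕ => α m * (m : ℝ) ^ 2 / ε ^ 2 *
      (‖z‖ ^ 2 - ‖mean (m * ε) z‖ ^ 2)) (fun m hm => ?_) hMm
    have := hα m hm
    exact mul_nonneg (by positivity) (norm_sq_sub_norm_mean_sq_nonneg _ z)
  have h3 := inner_dispOp_self (M := M) (α := α) (ε := ε) z
  have h4 := real_inner_le_norm (dispOp M α ε z) z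
  have h5 := norm_le_norm_dispOp (ε := ε) hα z
  have h6 : α M * (M : ℝ) ^ 2 / ε ^ 2 * (‖z‖ ^ 2 - ‖mean (M * ε) z‖ ^ 2) ≤
      ‖dispOp M α ε z‖ ^ 2 := by
    have := norm_nonneg (dispOp M α ε z)
    nlinarith [sq_nonneg ‖z‖]
  rw [div_mul_eq_mul_div, div_le_iff₀ (by positivity)] at h6
  refine abs_le_of_sq_le_sq' ?_ (by positivity) |>.2
  rw [mul_pow, mul_pow, Real.sq_sqrt (by positivity)]
  refine h1.trans ?_
  rw [div_mul_eq_mul_div, div_mul_eq_mul_div, le_div_iff₀ (by positivity)]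
  linarith

variable {W : ℝ → ℝ} {B : ℝ}

lemma inner_quadOp_left (hε : 0 < ε) (hW : Continuous W) (hB : ∀ x, |W x| ≤ B) (u v : L2) :
    ⟪quadOp M β W ε u, v⟫ = ⟪u, quadOp M β W ε v⟫ := by
  simp only [quadOp_apply, sum_inner, inner_sum, real_inner_smul_left, real_inner_smul_right]
  refine Finset.sum_congr rfl fun m hm => ?_
  have hm0 : (0 : ℝ) < m := by exact_mod_cast (Finset.mem_Icc.1 hm).1
  rw [inner_mean_left, inner_mulOp_left (continuous_avg fun a b => hW.intervalIntegrable a b)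
    (abs_avg_le_of_abs_le (by positivity) (Eventually.of_forall hB)), inner_mean_left]

lemma reflect_quadOp (hε : 0 < ε) (hW : Continuous W) (hB : ∀ x, |W x| ≤ B)
    (he : ∀ x, W (-x) = W x) (u : L2) :
    reflect (quadOp M β W ε u) = quadOp M β W ε (reflect u) := by
  simp only [quadOp_apply, map_sum, map_smul]
  refine Finset.sum_congr rfl fun m hm => ?_
  have hm0 : (0 : ℝ) < m := by exact_mod_cast (Finset.mem_Icc.1 hm).1
  rw [reflect_mean, reflect_mulOp (continuous_avg fun a b => hW.intervalIntegrable a b)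
    (abs_avg_le_of_abs_le (by positivity) (Eventually.of_forall hB)), reflect_mean]
  intro x
  rw [← avg_comp_neg]
  simp only [he]

lemma norm_quadOp_le (hβ : ∀ m ∈ Finset.Icc 1 M, 0 < β m) (hε : 0 < ε) (hW : Continuous W)
    (hB : ∀ x, |W x| ≤ B) (u : L2) :
    ‖quadOp M β W ε u‖ ≤ (∑ m ∈ Finset.Icc 1 M, 2 * β m * (m : ℝ) ^ 3 * B) * ‖u‖ := by
  have hB0 : 0 ≤ B := (abs_nonneg _).trans (hB 0)
  rw [quadOp_apply, Finset.sum_mul]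
  refine norm_sum_le_of_le _ fun m hm => ?_
  have hm0 : (0 : ℝ) < m := by exact_mod_cast (Finset.mem_Icc.1 hm).1
  have hβm := hβ m hm
  rw [norm_smul, Real.norm_of_nonneg (by positivity), mul_assoc _ B]
  refine mul_le_mul_of_nonneg_left ?_ (by positivity)
  refine (norm_mean_le _ _).trans ((norm_mulOp_le
    (continuous_avg fun a b => hW.intervalIntegrable a b)
    (abs_avg_le_of_abs_le (by positivity) (Eventually.of_forall hB)) _).trans ?_)
  gcongr
  exact norm_mean_le _ _

/-- Consistency of the dispersive part, tested against functions with small translates. -/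
lemma abs_inner_mean_mean_sub_le {v v₁ v₂ z : L2} (h : HasL2Derivs v v₁ v₂) {η δ : ℝ} (hη : 0 < η)
    (hz : ∀ s, |s| ≤ η → ‖shift s z - z‖ ≤ δ) :
    |⟪z, mean η (mean η v) - v⟫ - η ^ 2 / 12 * ⟪z, v₂⟫| ≤ η ^ 2 * (6 * δ * ‖v₂‖) := by
  -- This is A² - 1 = 2(A - 1) + (A - 1)², with one factor of the square moved onto z.
  have e : ⟪z, mean η (mean η v) - v⟫ - η ^ 2 / 12 * ⟪z, v₂⟫ =
      2 * (⟪z, mean η v - v⟫ - η ^ 2 / 24 * ⟪z, v₂⟫) + ⟪mean η z - z, mean η v - v⟫ := by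
    simp only [inner_sub_right, inner_sub_left, inner_mean_left]
    ring
  have h1 := h.abs_inner_mean_sub_le hη z hz
  have h2 := abs_real_inner_le_norm (mean η z - z) (mean η v - v)
  have h3 := norm_mean_sub_le_of_shift hη hz
  have h4 := h.norm_mean_sub_le hη
  have h5 : ‖mean η z - z‖ * ‖mean η v - v‖ ≤ δ * (η ^ 2 * (2 * ‖v₂‖)) :=
    mul_le_mul h3 h4 (norm_nonneg _) ((norm_nonneg _).trans h3)
  rw [e]
  refine (abs_add_le _ _).trans ?_
  rw [abs_mul, abs_of_pos (by norm_num : (0 : ℝ) < 2)]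
  linarith

/-- Consistency of the quadratic part, tested against functions with small translates. -/
lemma abs_inner_mulOp_sub_le {v v₁ v₂ z : L2} (h : HasL2Derivs v v₁ v₂) {η δ D : ℝ} (hη : 0 < η)
    (hz : ∀ s, |s| ≤ η → ‖shift s z - z‖ ≤ δ) (hW : Continuous W) (hB : ∀ x, |W x| ≤ B)
    (hD : ∀ x, |W x - avg η W x| ≤ D) :
    |⟪z, mulOp W v⟫ - ⟪z, mean η (mulOp (avg η W) (mean η v))⟫| ≤
      δ * (B * ‖v‖) + ‖z‖ * (D * ‖v‖ + B * (η ^ 2 * (2 * ‖v₂‖))) := by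
  have hB0 : 0 ≤ B := (abs_nonneg _).trans (hB 0)
  have hbc : Continuous (avg η W) := continuous_avg fun a b => hW.intervalIntegrable a b
  have hbB : ∀ x, |avg η W x| ≤ B := abs_avg_le_of_abs_le hη (Eventually.of_forall hB)
  have e : ⟪z, mulOp W v⟫ - ⟪z, mean η (mulOp (avg η W) (mean η v))⟫ =
      -⟪mean η z - z, mulOp (avg η W) (mean η v)⟫ +
        ⟪z, (mulOp W v - mulOp (avg η W) v) - mulOp (avg η W) (mean η v - v)⟫ := by
    simp only [map_sub, inner_sub_right, inner_sub_left, inner_mean_left]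
    ring
  have h1 := abs_real_inner_le_norm (mean η z - z) (mulOp (avg η W) (mean η v))
  have h2 : ‖mean η z - z‖ * ‖mulOp (avg η W) (mean η v)‖ ≤ δ * (B * ‖v‖) := by
    have h3 := norm_mean_sub_le_of_shift hη hz
    refine mul_le_mul h3 ((norm_mulOp_le hbc hbB _).trans ?_) (norm_nonneg _)
      ((norm_nonneg _).trans h3)
    gcongr
    exact norm_mean_le _ _
  have h4 := abs_real_inner_le_norm z
    ((mulOp W v - mulOp (avg η W) v) - mulOp (avg η W) (mean η v - v))
  have h5 : ‖(mulOp W v - mulOp (avg η W) v) - mulOp (avg η W) (mean η v - v)‖ ≤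
      D * ‖v‖ + B * (η ^ 2 * (2 * ‖v₂‖)) := by
    refine (norm_sub_le _ _).trans (add_le_add (norm_mulOp_sub_le hW hB hbc hbB hD v)
      ((norm_mulOp_le hbc hbB _).trans ?_))
    gcongr
    exact h.norm_mean_sub_le hη
  rw [e]
  refine (abs_add_le _ _).trans (add_le_add ?_ (h4.trans ?_))
  · rw [abs_neg]
    exact h1.trans h2
  · gcongr

end Operators

end AtomicChain

/-! ### Uniform invertibility of the linearisation on even functions -/

namespace AtomicChain

open scoped RealInnerProductSpace
open Filter Topology

/-- The explicit solitary wave of the leading order equation. -/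
noncomputable def kdvWave (M : ℕ) (α β : ℕ → ℝ) (x : ℝ) : ℝ :=
  3 * dOne M α / (2 * dTwo M α β) * sechSq (√(dOne M α) / 2) x

/-- Duality by density: z is approximated by continuous compactly supported functions, and
symmetrising them does not increase the distance because z is even. The Green solution is available
only for such g. -/
lemma norm_le_of_forall_even_inner_le {z : L2} (hz : reflect z = z) {K : ℝ} (hK : 0 ≤ K)
    (h : ∀ (g : ℝ → ℝ) (_ : Continuous g) (_ : HasCompactSupport g) (_ : ∀ x, g (-x) = g x)
      (hm : MemLp g 2 volume), |⟪z, hm.toLp g⟫| ≤ K * ‖hm.toLp g‖) : ‖z‖ ≤ K := by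
  have key : ∀ δ : ℝ, 0 < δ → ‖z‖ ^ 2 ≤ K * ‖z‖ + (K + ‖z‖) * δ := by
    intro δ hδ
    obtain ⟨g, hgs, hgz, hgc, hgm⟩ := (Lp.memLp z).exists_hasCompactSupport_eLpNorm_sub_le
      (by norm_num) (ε := ENNReal.ofReal δ) (by simpa using hδ)
    have hgn : MemLp (fun x => g (-x)) 2 volume :=
      hgm.comp_measurePreserving (Measure.measurePreserving_neg volume)
    set ge : ℝ → ℝ := fun x => 1 / 2 * (g x + g (-x)) with hge
    have hm : MemLp ge 2 volume := (hgm.add hgn).const_mul _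
    have hd : ‖z - hgm.toLp g‖ ≤ δ := by
      rw [Lp.norm_def, ← ENNReal.ofReal_le_ofReal_iff hδ.le,
        ENNReal.ofReal_toReal (Lp.eLpNorm_ne_top _)]
      refine le_trans (le_of_eq (eLpNorm_congr_ae ?_)) hgz
      filter_upwards [Lp.coeFn_sub z (hgm.toLp g), hgm.coeFn_toLp] with x h1 h2
      rw [h1, Pi.sub_apply, h2, Pi.sub_apply]
    have he : hm.toLp ge = (1 / 2 : ℝ) • (hgm.toLp g + reflect (hgm.toLp g)) := by
      apply Lp.ext
      filter_upwards [hm.coeFn_toLp, Lp.coeFn_smul (1 / 2 : ℝ) (hgm.toLp g + reflect (hgm.toLp g)),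
        Lp.coeFn_add (hgm.toLp g) (reflect (hgm.toLp g)), coeFn_reflect (hgm.toLp g),
        hgm.coeFn_toLp, ae_comp_neg hgm.coeFn_toLp] with x h1 h2 h3 h4 h5 h6
      rw [h1, h2, Pi.smul_apply, h3, Pi.add_apply, h4, h5, h6, smul_eq_mul]
    have hze : z - hm.toLp ge =
        (1 / 2 : ℝ) • ((z - hgm.toLp g) + reflect (z - hgm.toLp g)) := by
      rw [he, map_sub, hz]
      module
    have hd' : ‖z - hm.toLp ge‖ ≤ δ := by
      rw [hze, norm_smul, Real.norm_of_nonneg (by norm_num)]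
      have := norm_add_le (z - hgm.toLp g) (reflect (z - hgm.toLp g))
      rw [reflect.norm_map] at this
      linarith
    have hges : HasCompactSupport ge :=
      (hgs.add (hgs.comp_homeomorph (Homeomorph.neg ℝ))).mul_left
    have h1 := h ge (by fun_prop) hges (fun x => by simp only [hge, neg_neg]; ring) hm
    have h2 : ‖hm.toLp ge‖ ≤ ‖z‖ + δ := by
      have := norm_sub_le z (z - hm.toLp ge)
      rw [sub_sub_cancel] at this
      linarith
    have h3 := real_inner_le_norm z (z - hm.toLp ge)
    have h4 : ‖z‖ ^ 2 = ⟪z, hm.toLp ge⟫ + ⟪z, z - hm.toLp ge⟫ := by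
      rw [← inner_add_right, add_sub_cancel, real_inner_self_eq_norm_sq]
    have h5 := le_abs_self ⟪z, hm.toLp ge⟫
    have h6 : ‖z‖ * ‖z - hm.toLp ge‖ ≤ ‖z‖ * δ := by gcongr
    have h7 : K * ‖hm.toLp ge‖ ≤ K * (‖z‖ + δ) := by gcongr
    linarith
  by_contra! hlt
  have hz0 : 0 < ‖z‖ := hK.trans_lt hlt
  -- This δ makes the error term half of ‖z‖(‖z‖ - K), which contradicts `key` if ‖z‖ > K.
  have h1 := key (‖z‖ * (‖z‖ - K) / (2 * (K + ‖z‖))) (by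
    have : 0 < ‖z‖ - K := by linarith
    positivity)
  have h2 : (K + ‖z‖) * (‖z‖ * (‖z‖ - K) / (2 * (K + ‖z‖))) = ‖z‖ * (‖z‖ - K) / 2 := by
    have : K + ‖z‖ ≠ 0 := by positivity
    field_simp
  rw [h2] at h1
  nlinarith

lemma mulOp_const_mul {b : ℝ → ℝ} {B : ℝ} (hb : Continuous b) (h : ∀ x, |b x| ≤ B) (c : ℝ)
    (u : L2) : mulOp (fun x => c * b x) u = c • mulOp b u := by
  have hcb : ∀ x, |c * b x| ≤ |c| * B := fun x => by
    rw [abs_mul]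
    exact mul_le_mul_of_nonneg_left (h x) (abs_nonneg c)
  have hcc : Continuous fun x => c * b x := continuous_const.mul hb
  apply Lp.ext
  filter_upwards [coeFn_mulOp hcc hcb u, coeFn_mulOp hb h u,
    Lp.coeFn_smul c (mulOp b u)] with x h1 h2 h3
  rw [h1, h3, Pi.smul_apply, h2, smul_eq_mul, mul_assoc]

section Wave

variable {M : ℕ} {α β : ℕ → ℝ}

lemma sum_pos_of_forall_pos (hM : 1 ≤ M) {f : ℕ → ℝ} (hf : ∀ m ∈ Finset.Icc 1 M, 0 < f m) (k : ℕ) :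
    0 < ∑ m ∈ Finset.Icc 1 M, f m * (m : ℝ) ^ k :=
  Finset.sum_pos (fun m hm => by
    have hm0 : (0 : ℝ) < m := by exact_mod_cast (Finset.mem_Icc.1 hm).1
    have := hf m hm
    positivity) ⟨1, Finset.mem_Icc.2 ⟨le_rfl, hM⟩⟩

lemma dOne_pos (hM : 1 ≤ M) (hα : ∀ m ∈ Finset.Icc 1 M, 0 < α m) : 0 < dOne M α :=
  div_pos (by norm_num) (sum_pos_of_forall_pos hM hα 4)

lemma dTwo_pos (hM : 1 ≤ M) (hα : ∀ m ∈ Finset.Icc 1 M, 0 < α m)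
    (hβ : ∀ m ∈ Finset.Icc 1 M, 0 < β m) : 0 < dTwo M α β :=
  div_pos (mul_pos (by norm_num) (sum_pos_of_forall_pos hM hβ 3)) (sum_pos_of_forall_pos hM hα 4)

lemma sum_mul_pow_four (hM : 1 ≤ M) (hα : ∀ m ∈ Finset.Icc 1 M, 0 < α m) :
    ∑ m ∈ Finset.Icc 1 M, α m * (m : ℝ) ^ 4 = 12 / dOne M α := by
  rw [dOne]
  have := (sum_pos_of_forall_pos hM hα 4).ne'
  field_simp

lemma sum_mul_pow_three (hM : 1 ≤ M) (hα : ∀ m ∈ Finset.Icc 1 M, 0 < α m) :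
    ∑ m ∈ Finset.Icc 1 M, β m * (m : ℝ) ^ 3 = dTwo M α β / dOne M α := by
  rw [dOne, dTwo]
  have := (sum_pos_of_forall_pos hM hα 4).ne'
  field_simp

/-- The first derivative of the solitary wave. -/
noncomputable def kdvWaveDeriv (M : ℕ) (α β : ℕ → ℝ) (x : ℝ) : ℝ :=
  3 * dOne M α / (2 * dTwo M α β) * sechSqDeriv (√(dOne M α) / 2) x

lemma continuous_kdvWave (M : ℕ) (α β : ℕ → ℝ) : Continuous (kdvWave M α β) :=
  continuous_const.mul (contDiff_sechSq _ (n := 0)).continuous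

lemma kdvWave_neg (M : ℕ) (α β : ℕ → ℝ) (x : ℝ) : kdvWave M α β (-x) = kdvWave M α β x := by
  rw [kdvWave, sechSq_neg, kdvWave]

lemma hasDerivAt_kdvWave (M : ℕ) (α β : ℕ → ℝ) (x : ℝ) :
    HasDerivAt (kdvWave M α β) (kdvWaveDeriv M α β x) x :=
  (hasDerivAt_sechSq _ x).const_mul _

lemma hasDerivAt_kdvWaveDeriv (hM : 1 ≤ M) (hα : ∀ m ∈ Finset.Icc 1 M, 0 < α m)
    (hβ : ∀ m ∈ Finset.Icc 1 M, 0 < β m) (x : ℝ) : HasDerivAt (kdvWaveDeriv M α β)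
      (dOne M α * kdvWave M α β x - dTwo M α β * kdvWave M α β x ^ 2) x := by
  have h1 := dOne_pos hM hα
  have h2 := dTwo_pos hM hα hβ
  refine ((hasDerivAt_sechSqDeriv _ x).const_mul _).congr_deriv ?_
  rw [kdvWave, div_pow, Real.sq_sqrt h1.le]
  field_simp
  ring

lemma kdvWave_nonneg (hM : 1 ≤ M) (hα : ∀ m ∈ Finset.Icc 1 M, 0 < α m)
    (hβ : ∀ m ∈ Finset.Icc 1 M, 0 < β m) (x : ℝ) : 0 ≤ kdvWave M α β x := by
  have h1 := dOne_pos hM hα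
  have h2 := dTwo_pos hM hα hβ
  have := sechSq_pos (√(dOne M α) / 2) x
  rw [kdvWave]
  positivity

lemma abs_kdvWave_le (hM : 1 ≤ M) (hα : ∀ m ∈ Finset.Icc 1 M, 0 < α m)
    (hβ : ∀ m ∈ Finset.Icc 1 M, 0 < β m) (x : ℝ) :
    |kdvWave M α β x| ≤ 3 * dOne M α / (2 * dTwo M α β) := by
  have h1 := dOne_pos hM hα
  have h2 := dTwo_pos hM hα hβ
  rw [abs_of_nonneg (kdvWave_nonneg hM hα hβ x), kdvWave]
  exact mul_le_of_le_one_right (by positivity) (sechSq_le_one _ x)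

lemma exists_second_deriv_bound (hM : 1 ≤ M) (hα : ∀ m ∈ Finset.Icc 1 M, 0 < α m)
    (hβ : ∀ m ∈ Finset.Icc 1 M, 0 < β m) : ∃ D : ℝ, 0 < D ∧ ∀ η : ℝ, 0 < η → ∀ x,
      |avg η (kdvWave M α β) x - kdvWave M α β x| ≤ η ^ 2 * D := by
  have h1 := dOne_pos hM hα
  have h2 := dTwo_pos hM hα hβ
  set B := 3 * dOne M α / (2 * dTwo M α β) with hB
  have hB0 : 0 < B := by positivity
  refine ⟨2 * (dOne M α * B + dTwo M α β * B ^ 2), by positivity, fun η hη x => ?_⟩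
  refine abs_avg_sub_le hη (hasDerivAt_kdvWave M α β) (hasDerivAt_kdvWaveDeriv hM hα hβ)
    (fun y => ?_) x
  have hy := abs_kdvWave_le hM hα hβ y
  refine (abs_sub _ _).trans ?_
  rw [abs_mul, abs_mul, abs_pow, abs_of_pos h1, abs_of_pos h2]
  gcongr

lemma abs_sum_dispersion_le (hα : ∀ m ∈ Finset.Icc 1 M, 0 < α m) {ε δ : ℝ} (hε : 0 < ε)
    {v v₁ v₂ z : L2} (hv : HasL2Derivs v v₁ v₂)
    (hz : ∀ m ∈ Finset.Icc 1 M, ∀ s : ℝ, |s| ≤ m * ε → ‖shift s z - z‖ ≤ δ) :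
    |∑ m ∈ Finset.Icc 1 M, α m * (m : ℝ) ^ 2 / ε ^ 2 *
      (⟪z, mean (m * ε) (mean (m * ε) v) - v⟫ - (m * ε) ^ 2 / 12 * ⟪z, v₂⟫)| ≤
      (∑ m ∈ Finset.Icc 1 M, α m * (m : ℝ) ^ 4) * (6 * δ * ‖v₂‖) := by
  refine (Finset.abs_sum_le_sum_abs _ _).trans ?_
  rw [Finset.sum_mul]
  refine Finset.sum_le_sum fun m hm => ?_
  have hm0 : (0 : ℝ) < m := by exact_mod_cast (Finset.mem_Icc.1 hm).1
  have hαm := hα m hm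
  rw [abs_mul, abs_of_nonneg (by positivity)]
  refine (mul_le_mul_of_nonneg_left (abs_inner_mean_mean_sub_le hv (by positivity)
    (hz m hm)) (by positivity)).trans (le_of_eq ?_)
  field_simp

lemma abs_sum_quadratic_le (hβ : ∀ m ∈ Finset.Icc 1 M, 0 < β m) {ε δ B D : ℝ} (hε : 0 < ε)
    {v v₁ v₂ z : L2} (hv : HasL2Derivs v v₁ v₂)
    (hz : ∀ m ∈ Finset.Icc 1 M, ∀ s : ℝ, |s| ≤ m * ε → ‖shift s z - z‖ ≤ δ)
    {W : ℝ → ℝ} (hW : Continuous W) (hB : ∀ x, |W x| ≤ B)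
    (hD : ∀ η : ℝ, 0 < η → ∀ x, |avg η W x - W x| ≤ η ^ 2 * D) :
    |∑ m ∈ Finset.Icc 1 M, 2 * β m * (m : ℝ) ^ 3 * (⟪z, mulOp W v⟫ -
      ⟪z, mean (m * ε) (mulOp (avg (m * ε) W) (mean (m * ε) v))⟫)| ≤
      ∑ m ∈ Finset.Icc 1 M, 2 * β m * (m : ℝ) ^ 3 * (δ * (B * ‖v‖) +
        ‖z‖ * ((m * ε) ^ 2 * D * ‖v‖ + B * ((m * ε) ^ 2 * (2 * ‖v₂‖)))) := by
  refine (Finset.abs_sum_le_sum_abs _ _).trans (Finset.sum_le_sum fun m hm => ?_)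
  have hm0 : (0 : ℝ) < m := by exact_mod_cast (Finset.mem_Icc.1 hm).1
  have hβm := hβ m hm
  rw [abs_mul, abs_of_nonneg (by positivity)]
  refine mul_le_mul_of_nonneg_left ?_ (by positivity)
  refine abs_inner_mulOp_sub_le hv (by positivity) (hz m hm) hW hB (fun x => ?_)
  rw [abs_sub_comm]
  exact hD _ (by positivity) x

lemma sum_quadratic_bound_le (hβ : ∀ m ∈ Finset.Icc 1 M, 0 < β m) {ε B D K a b : ℝ}
    (hε : 0 < ε) (hε1 : ε ≤ 1) (hB : 0 ≤ B) (hD : 0 ≤ D) {v v₂ : L2} (ha : 0 ≤ a) (hab : a ≤ b) :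
    ∑ m ∈ Finset.Icc 1 M, 2 * β m * (m : ℝ) ^ 3 * (K * ε * b * (B * ‖v‖) +
        a * ((m * ε) ^ 2 * D * ‖v‖ + B * ((m * ε) ^ 2 * (2 * ‖v₂‖)))) ≤
      (∑ m ∈ Finset.Icc 1 M, 2 * β m * (m : ℝ) ^ 3 * (K * B + (m : ℝ) ^ 2 * D)) *
          (ε * b * ‖v‖) +
        (∑ m ∈ Finset.Icc 1 M, 2 * β m * (m : ℝ) ^ 3 * ((m : ℝ) ^ 2 * (2 * B))) *
          (ε * b * ‖v₂‖) := by
  rw [Finset.sum_mul, Finset.sum_mul, ← Finset.sum_add_distrib]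
  refine Finset.sum_le_sum fun m hm => ?_
  have hm0 : (0 : ℝ) < m := by exact_mod_cast (Finset.mem_Icc.1 hm).1
  have hβm := hβ m hm
  rw [mul_assoc _ (K * B + _), mul_assoc _ (_ * (2 * B)), ← mul_add]
  refine mul_le_mul_of_nonneg_left ?_ (by positivity)
  have hεε : ε ^ 2 ≤ ε := by nlinarith
  have hX : 0 ≤ (m : ℝ) ^ 2 * D * ‖v‖ + (m : ℝ) ^ 2 * (2 * B) * ‖v₂‖ := by positivity
  calc _ = K * B * (ε * b * ‖v‖) +
        ε ^ 2 * (a * ((m : ℝ) ^ 2 * D * ‖v‖ + (m : ℝ) ^ 2 * (2 * B) * ‖v₂‖)) := by ring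
    _ ≤ K * B * (ε * b * ‖v‖) +
        ε * (b * ((m : ℝ) ^ 2 * D * ‖v‖ + (m : ℝ) ^ 2 * (2 * B) * ‖v₂‖)) := by
      gcongr
    _ = _ := by ring

set_option maxHeartbeats 1000000 in
/-- Uniform lower bound for the linearised travelling wave operator on even functions. -/
theorem exists_norm_le_linearization (hM : 1 ≤ M) (hα : ∀ m ∈ Finset.Icc 1 M, 0 < α m)
    (hβ : ∀ m ∈ Finset.Icc 1 M, 0 < β m) : ∃ C ε₁ : ℝ, 0 < C ∧ 0 < ε₁ ∧ ∀ ε : ℝ, 0 < ε → ε ≤ ε₁ →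
      ∀ u : L2, reflect u = u →
        ‖u‖ ≤ C * ‖dispOp M α ε u - quadOp M β (kdvWave M α β) ε u‖ := by
  have hd1 := dOne_pos hM hα
  have hd2 := dTwo_pos hM hα hβ
  set W := kdvWave M α β with hW
  set B := 3 * dOne M α / (2 * dTwo M α β) with hBdef
  have hB0 : 0 < B := by positivity
  have hWc : Continuous W := continuous_kdvWave M α β
  have hWB : ∀ x, |W x| ≤ B := abs_kdvWave_le hM hα hβ
  obtain ⟨D, hD0, hD⟩ := exists_second_deriv_bound hM hα hβ
  set κ := √(dOne M α) / 2 with hκ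
  have hκ0 : 0 < κ := by positivity
  have hκ2 : 4 * κ ^ 2 = dOne M α := by
    rw [hκ, div_pow, Real.sq_sqrt hd1.le]
    ring
  obtain ⟨CG, hCG, hgreen⟩ := exists_green_solution_L2 hκ0
  have hSc : Continuous (sechSq κ) := (contDiff_sechSq κ (n := 0)).continuous
  have hS1 : ∀ x, |sechSq κ x| ≤ 1 := fun x => by
    rw [abs_of_pos (sechSq_pos κ x)]
    exact sechSq_le_one κ x
  set KE := √(32 / (α M * (M : ℝ) ^ 2)) with hKE
  have hKE0 : 0 ≤ KE := Real.sqrt_nonneg _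
  set Cq := ∑ m ∈ Finset.Icc 1 M, 2 * β m * (m : ℝ) ^ 3 * B with hCq
  have hCq0 : 0 ≤ Cq := Finset.sum_nonneg fun m hm => by
    have := hβ m hm
    positivity
  set T1 := ∑ m ∈ Finset.Icc 1 M, α m * (m : ℝ) ^ 4 * (6 * KE) with hT1
  set T2 := ∑ m ∈ Finset.Icc 1 M, 2 * β m * (m : ℝ) ^ 3 * (KE * B + (m : ℝ) ^ 2 * D) with hT2
  set T3 := ∑ m ∈ Finset.Icc 1 M, 2 * β m * (m : ℝ) ^ 3 * ((m : ℝ) ^ 2 * (2 * B)) with hT3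
  have hT10 : 0 ≤ T1 := Finset.sum_nonneg fun m hm => by
    have := hα m hm
    positivity
  have hT20 : 0 ≤ T2 := Finset.sum_nonneg fun m hm => by
    have := hβ m hm
    positivity
  have hT30 : 0 ≤ T3 := Finset.sum_nonneg fun m hm => by
    have := hβ m hm
    positivity
  set C2 := Cq * (T2 * CG + (T1 + T3) * (dOne M α * (4 * CG + 1))) with hC2
  have hC20 : 0 ≤ C2 := by positivity
  -- The bound on ε makes C2 ε ≤ 1/2, so the term C2 ε ‖u‖ is absorbed on the left; hence the factor
  -- 2.
  refine ⟨2 * (1 + Cq * CG), min 1 (1 / (2 * (C2 + 1))), by positivity, by positivity,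
    fun ε hε hεle u hu => ?_⟩
  have hε1 : ε ≤ 1 := hεle.trans (min_le_left _ _)
  have hε2 : C2 * ε ≤ 1 / 2 := by
    have h1 := hεle.trans (min_le_right _ _)
    rw [le_div_iff₀ (by positivity)] at h1
    nlinarith
  set w := quadOp M β W ε u with hw
  have hwle : ‖w‖ ≤ Cq * ‖u‖ := norm_quadOp_le hβ hε hWc hWB u
  -- The splitting u = f + z: z is regular on the scale ε because B_ε z = w is bounded in terms of
  -- u, and f is controlled directly by the right-hand side.
  obtain ⟨z, hz⟩ := dispOp_surjective (ε := ε) hα w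
  have hinj : Function.Injective (dispOp M α ε) := by
    rw [injective_iff_map_eq_zero]
    intro y hy
    have := norm_le_norm_dispOp (ε := ε) hα y
    rw [hy, norm_zero] at this
    exact norm_le_zero_iff.1 this
  have hzr : reflect z = z := by
    apply hinj
    rw [← reflect_dispOp, hz, hw, reflect_quadOp hε hWc hWB (kdvWave_neg M α β), hu]
  have hzw : ‖z‖ ≤ ‖w‖ := by
    rw [← hz]
    exact norm_le_norm_dispOp hα z
  have hzs : ∀ s, |s| ≤ M * ε → ‖shift s z - z‖ ≤ KE * ε * ‖w‖ := fun s hs => by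
    have := norm_shift_sub_le_dispOp hM hα hε z hs
    rwa [hz] at this
  set f := u - z with hf
  have hBf : dispOp M α ε f = dispOp M α ε u - quadOp M β W ε u := by
    rw [hf, map_sub, hz]
  have hLz : dispOp M α ε z - quadOp M β W ε z = quadOp M β W ε f := by
    rw [hz, hf, map_sub]
  have hfle : ‖f‖ ≤ ‖dispOp M α ε u - quadOp M β W ε u‖ := by
    rw [← hBf]
    exact norm_le_norm_dispOp hα f
  have hzle : ‖z‖ ≤ Cq * CG * ‖f‖ + C2 * ε * ‖u‖ := by
    -- The test function is written as g = v - v''/d₁ - 3 sech² v. Replacing this limit operator by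
    -- B_ε - Q_ε and moving the latter onto z leaves the scalar product of Q_ε f with v.
    refine norm_le_of_forall_even_inner_le hzr (by positivity) fun g hg hgs hge hm => ?_
    obtain ⟨v, v₁, hv, hvle⟩ := hgreen g hg hgs hge hm
    set G := hm.toLp g with hG
    set v₂ := (4 * κ ^ 2) • (v - (3 : ℝ) • mulOp (sechSq κ) v - G) with hv₂
    have hv₂le : ‖v₂‖ ≤ dOne M α * ((4 * CG + 1) * ‖G‖) := by
      rw [hv₂, hκ2, norm_smul, Real.norm_of_nonneg hd1.le]
      have h1 := norm_sub_le (v - (3 : ℝ) • mulOp (sechSq κ) v) G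
      have h2 := norm_sub_le v ((3 : ℝ) • mulOp (sechSq κ) v)
      have h3 := norm_mulOp_le hSc hS1 v
      rw [norm_smul, Real.norm_of_nonneg (by norm_num : (0 : ℝ) ≤ 3)] at h2
      refine mul_le_mul_of_nonneg_left ?_ hd1.le
      linarith
    have hGeq : G = v - (1 / dOne M α) • v₂ - (3 : ℝ) • mulOp (sechSq κ) v := by
      rw [hv₂, hκ2, smul_smul, one_div_mul_cancel hd1.ne', one_smul]
      abel
    have hsymm : ⟪z, dispOp M α ε v - quadOp M β W ε v⟫ = ⟪quadOp M β W ε f, v⟫ := by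
      rw [← hLz, inner_sub_left, inner_sub_right, inner_dispOp_left,
        inner_quadOp_left hε hWc hWB]
    -- The normalisations match: 2 ∑ β_m m³ = 2d₂/d₁, times the wave height 3d₁/(2d₂), is 3.
    have hWS : ∑ m ∈ Finset.Icc 1 M, 2 * β m * (m : ℝ) ^ 3 * ⟪z, mulOp W v⟫ =
        3 * ⟪z, mulOp (sechSq κ) v⟫ := by
      have e1 : mulOp W v = B • mulOp (sechSq κ) v := mulOp_const_mul hSc hS1 B v
      have e2 : ∑ m ∈ Finset.Icc 1 M, 2 * β m * (m : ℝ) ^ 3 = 2 * (dTwo M α β / dOne M α) := by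
        rw [← sum_mul_pow_three hM hα, Finset.mul_sum]
        exact Finset.sum_congr rfl fun m _ => by ring
      rw [← Finset.sum_mul, e2, e1, real_inner_smul_right, hBdef]
      field_simp
    have hA4 : (1 / dOne M α) * ⟪z, v₂⟫ = ∑ m ∈ Finset.Icc 1 M,
        α m * (m : ℝ) ^ 2 / ε ^ 2 * ((m * ε) ^ 2 / 12 * ⟪z, v₂⟫) := by
      have e1 := sum_mul_pow_four hM hα
      have e2 : 1 / dOne M α = (∑ m ∈ Finset.Icc 1 M, α m * (m : ℝ) ^ 4) / 12 := by
        rw [e1]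
        field_simp
      rw [e2, Finset.sum_div, Finset.sum_mul]
      refine Finset.sum_congr rfl fun m _ => ?_
      field_simp
    -- An exact formula for the consistency error, sorted into the dispersive and the quadratic
    -- defects; each is O(ε) since translates of z are.
    have hdiff : ⟪z, G⟫ - ⟪z, dispOp M α ε v - quadOp M β W ε v⟫ =
        (∑ m ∈ Finset.Icc 1 M, α m * (m : ℝ) ^ 2 / ε ^ 2 *
          (⟪z, mean (m * ε) (mean (m * ε) v) - v⟫ - (m * ε) ^ 2 / 12 * ⟪z, v₂⟫)) -
        ∑ m ∈ Finset.Icc 1 M, 2 * β m * (m : ℝ) ^ 3 * (⟪z, mulOp W v⟫ -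
          ⟪z, mean (m * ε) (mulOp (avg (m * ε) W) (mean (m * ε) v))⟫) := by
      simp only [mul_sub, Finset.sum_sub_distrib]
      rw [hWS, ← hA4, hGeq, dispOp_apply, quadOp_apply]
      simp only [inner_sub_right, inner_add_right, inner_sum, real_inner_smul_right, mul_sub,
        Finset.sum_sub_distrib]
      ring
    have hηle : ∀ m ∈ Finset.Icc 1 M, ∀ s : ℝ, |s| ≤ m * ε → ‖shift s z - z‖ ≤ KE * ε * ‖w‖ := by
      intro m hm s hs
      refine hzs s (hs.trans ?_)
      gcongr
      exact (Finset.mem_Icc.1 hm).2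
    have hη0 : ∀ m ∈ Finset.Icc 1 M, (0 : ℝ) < m := fun m hm => by
      exact_mod_cast (Finset.mem_Icc.1 hm).1
    have hb1 := (abs_sum_dispersion_le hα hε hv hηle).trans (le_of_eq (by
      rw [hT1, Finset.sum_mul, Finset.sum_mul]
      exact Finset.sum_congr rfl fun m _ => by ring) :
        _ ≤ T1 * (ε * ‖w‖ * ‖v₂‖))
    have hb2 := (abs_sum_quadratic_le hβ hε hv hηle hWc hWB hD).trans
      (sum_quadratic_bound_le hβ hε hε1 hB0.le hD0.le (norm_nonneg z) hzw :
        _ ≤ T2 * (ε * ‖w‖ * ‖v‖) + T3 * (ε * ‖w‖ * ‖v₂‖))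
    have hb3 : |⟪z, dispOp M α ε v - quadOp M β W ε v⟫| ≤ Cq * CG * ‖f‖ * ‖G‖ := by
      rw [hsymm]
      refine (abs_real_inner_le_norm _ _).trans ?_
      calc _ ≤ (Cq * ‖f‖) * (CG * ‖G‖) := by
            gcongr
            exact norm_quadOp_le hβ hε hWc hWB f
        _ = _ := by ring
    have hb4 : |⟪z, G⟫ - ⟪z, dispOp M α ε v - quadOp M β W ε v⟫| ≤ C2 * ε * ‖u‖ * ‖G‖ := by
      rw [hdiff]
      refine (abs_sub _ _).trans ((add_le_add hb1 hb2).trans ?_)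
      calc _ = T2 * (ε * ‖w‖ * ‖v‖) + (T1 + T3) * (ε * ‖w‖ * ‖v₂‖) := by ring
        _ ≤ T2 * (ε * (Cq * ‖u‖) * (CG * ‖G‖)) +
            (T1 + T3) * (ε * (Cq * ‖u‖) * (dOne M α * ((4 * CG + 1) * ‖G‖))) := by gcongr
        _ = _ := by rw [hC2]; ring
    have hb5 := abs_sub_abs_le_abs_sub ⟪z, G⟫ ⟪z, dispOp M α ε v - quadOp M β W ε v⟫
    linarith
  have hu' : ‖u‖ ≤ ‖f‖ + ‖z‖ := by
    have := norm_add_le f z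
    rwa [hf, sub_add_cancel] at this
  have h1 : C2 * ε * ‖u‖ ≤ 1 / 2 * ‖u‖ := by gcongr
  have h2 : ‖u‖ ≤ 2 * (1 + Cq * CG) * ‖f‖ := by linarith
  exact h2.trans (by gcongr)

end Wave

end AtomicChain

/-! ### L² derivatives of the solitary wave -/

namespace AtomicChain

open scoped RealInnerProductSpace
open Filter Topology

section WaveDerivs

variable {M : ℕ} {α β : ℕ → ℝ}

lemma memLp_of_abs_le_sechSq {κ C : ℝ} (hκ : 0 < κ) (hC : 0 ≤ C) {f : ℝ → ℝ} (hf : Continuous f)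
    (h : ∀ x, |f x| ≤ C * sechSq κ x) : MemLp f 2 volume := by
  refine memLp_two_of_abs_le_exp hf (b := 2 * κ) (C := C * 4) (by positivity) fun x => ?_
  refine (h x).trans ?_
  rw [mul_assoc]
  exact mul_le_mul_of_nonneg_left (sechSq_le_exp hκ x) hC

/-- The solitary wave and its first four derivatives in `L²(ℝ)`. -/
lemma exists_hasL2Derivs_kdvWave (hM : 1 ≤ M) (hα : ∀ m ∈ Finset.Icc 1 M, 0 < α m)
    (hβ : ∀ m ∈ Finset.Icc 1 M, 0 < β m) :
    ∃ (hm : MemLp (kdvWave M α β) 2 volume) (w₁ w₂ w₃ w₄ : L2),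
      HasL2Derivs (hm.toLp _) w₁ w₂ ∧ HasL2Derivs w₂ w₃ w₄ ∧
      w₂ = dOne M α • hm.toLp _ - dTwo M α β • mulOp (kdvWave M α β) (hm.toLp _) := by
  have h1 := dOne_pos hM hα
  have h2 := dTwo_pos hM hα hβ
  set W := kdvWave M α β with hW
  set W1 := kdvWaveDeriv M α β with hW1
  set d₁ := dOne M α with hd₁
  set d₂ := dTwo M α β with hd₂
  set κ := √d₁ / 2 with hκ
  have hκ0 : 0 < κ := by positivity
  set B := 3 * d₁ / (2 * d₂) with hB
  have hB0 : 0 < B := by positivity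
  have hWc : Continuous W := continuous_kdvWave M α β
  have hWd : ∀ x, HasDerivAt W (W1 x) x := hasDerivAt_kdvWave M α β
  set W2 : ℝ → ℝ := fun x => d₁ * W x - d₂ * W x ^ 2 with hW2
  have hW1d : ∀ x, HasDerivAt W1 (W2 x) x := hasDerivAt_kdvWaveDeriv hM hα hβ
  have hW1c : Continuous W1 := continuous_iff_continuousAt.2 fun x => (hW1d x).continuousAt
  set W3 : ℝ → ℝ := fun x => d₁ * W1 x - d₂ * (2 * W x * W1 x) with hW3
  set W4 : ℝ → ℝ := fun x => d₁ * W2 x - d₂ * (2 * (W1 x * W1 x + W x * W2 x)) with hW4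
  have hW2d : ∀ x, HasDerivAt W2 (W3 x) x := fun x => by
    refine (((hWd x).const_mul d₁).sub (((hWd x).pow 2).const_mul d₂)).congr_deriv ?_
    simp [hW3]
  have hW3d : ∀ x, HasDerivAt W3 (W4 x) x := fun x => by
    have := ((hW1d x).const_mul d₁).sub ((((hWd x).const_mul 2).mul (hW1d x)).const_mul d₂)
    refine this.congr_deriv ?_
    simp only [hW4]
    ring
  have hW2c : Continuous W2 := by fun_prop
  have hW3c : Continuous W3 := by fun_prop
  have hW4c : Continuous W4 := by fun_prop
  have hWB : ∀ x, |W x| ≤ B := abs_kdvWave_le hM hα hβ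
  have hWS : ∀ x, |W x| ≤ B * sechSq κ x := fun x => by
    rw [hW, kdvWave, abs_of_nonneg (mul_nonneg hB0.le (sechSq_pos _ x).le)]
  have hW1S : ∀ x, |W1 x| ≤ (B * (2 * κ)) * sechSq κ x := fun x => by
    rw [hW1, kdvWaveDeriv, abs_mul, abs_of_pos hB0, mul_assoc B]
    exact mul_le_mul_of_nonneg_left (abs_sechSqDeriv_le hκ0 x) hB0.le
  have hW1B : ∀ x, |W1 x| ≤ B * (2 * κ) := fun x =>
    (hW1S x).trans (mul_le_of_le_one_right (by positivity) (sechSq_le_one κ x))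
  -- The equation writes all higher derivatives as polynomials in W and W1, so bounds by multiples
  -- of sech² propagate through products and sums.
  have hmulB : ∀ {p q : ℝ → ℝ} {P Q : ℝ}, (∀ x, |p x| ≤ P) → (∀ x, |q x| ≤ Q * sechSq κ x) →
      ∀ x, |p x * q x| ≤ (P * Q) * sechSq κ x := fun {p q P Q} hp hq x => by
    rw [abs_mul, mul_assoc]
    exact mul_le_mul (hp x) (hq x) (abs_nonneg _) ((abs_nonneg _).trans (hp x))
  have hcS : ∀ {q : ℝ → ℝ} {Q : ℝ} (c : ℝ), (∀ x, |q x| ≤ Q * sechSq κ x) →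
      ∀ x, |c * q x| ≤ (|c| * Q) * sechSq κ x := fun c hq x => hmulB (p := fun _ => c)
        (fun _ => le_rfl) hq x
  have haddS : ∀ {p q : ℝ → ℝ} {P Q : ℝ}, (∀ x, |p x| ≤ P * sechSq κ x) →
      (∀ x, |q x| ≤ Q * sechSq κ x) → ∀ x, |p x + q x| ≤ (P + Q) * sechSq κ x :=
    fun hp hq x => (abs_add_le _ _).trans (by linarith [hp x, hq x])
  have hsubS : ∀ {p q : ℝ → ℝ} {P Q : ℝ}, (∀ x, |p x| ≤ P * sechSq κ x) →
      (∀ x, |q x| ≤ Q * sechSq κ x) → ∀ x, |p x - q x| ≤ (P + Q) * sechSq κ x :=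
    fun hp hq x => (abs_sub _ _).trans (by linarith [hp x, hq x])
  have hnn : ∀ {p : ℝ → ℝ} {P : ℝ}, (∀ x, |p x| ≤ P * sechSq κ x) → 0 ≤ P := fun hp =>
    nonneg_of_mul_nonneg_left ((abs_nonneg _).trans (hp 0)) (sechSq_pos κ 0)
  have hW2S := hsubS (hcS d₁ hWS) (hcS d₂ (hmulB hWB hWS))
  have hW2S' : ∀ x, |W2 x| ≤ (|d₁| * B + |d₂| * (B * B)) * sechSq κ x := fun x => by
    simpa only [hW2, sq] using hW2S x
  have hW3S := hsubS (hcS d₁ hW1S) (hcS d₂ (hcS 2 (hmulB hWB hW1S)))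
  have hW3S' : ∀ x, |W3 x| ≤ _ * sechSq κ x := fun x => by
    simpa only [hW3, mul_assoc] using hW3S x
  have hW4S : ∀ x, |W4 x| ≤ _ * sechSq κ x :=
    hsubS (hcS d₁ hW2S') (hcS d₂ (hcS 2 (haddS (hmulB hW1B hW1S) (hmulB hWB hW2S'))))
  have m0 : MemLp W 2 volume := memLp_of_abs_le_sechSq hκ0 (hnn hWS) hWc hWS
  have m1 : MemLp W1 2 volume := memLp_of_abs_le_sechSq hκ0 (hnn hW1S) hW1c hW1S
  have m2 : MemLp W2 2 volume := memLp_of_abs_le_sechSq hκ0 (hnn hW2S') hW2c hW2S'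
  have m3 : MemLp W3 2 volume := memLp_of_abs_le_sechSq hκ0 (hnn hW3S') hW3c hW3S'
  have m4 : MemLp W4 2 volume := memLp_of_abs_le_sechSq hκ0 (hnn hW4S) hW4c hW4S
  refine ⟨m0, m1.toLp W1, m2.toLp W2, m3.toLp W3, m4.toLp W4,
    hasL2Derivs_toLp hWd hW1d hW2c m0 m1 m2, hasL2Derivs_toLp hW2d hW3d hW4c m2 m3 m4, ?_⟩
  apply Lp.ext
  filter_upwards [m2.coeFn_toLp, Lp.coeFn_sub (d₁ • m0.toLp W) (d₂ • mulOp W (m0.toLp W)),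
    Lp.coeFn_smul d₁ (m0.toLp W), Lp.coeFn_smul d₂ (mulOp W (m0.toLp W)),
    coeFn_mulOp hWc hWB (m0.toLp W), m0.coeFn_toLp] with x e1 e2 e3 e4 e5 e6
  rw [e1, e2, Pi.sub_apply, e3, e4, Pi.smul_apply, Pi.smul_apply, e5, e6, smul_eq_mul, smul_eq_mul]
  ring

end WaveDerivs

/-! ### Superposition operators and the rescaled force -/

section Nemytskii

open Classical in
/-- The superposition operator `u ↦ g ∘ u`. -/
noncomputable def nem (g : ℝ → ℝ) (u : L2) : L2 :=
  if h : MemLp (fun x => g (u x)) 2 volume then h.toLp _ else 0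

lemma coeFn_nem {g : ℝ → ℝ} (hg : Continuous g) {K : ℝ} {u : L2}
    (h : ∀ᵐ x, |g (u x)| ≤ K * |u x|) : nem g u =ᵐ[volume] fun x => g (u x) := by
  have hm : MemLp (fun x => g (u x)) 2 volume := by
    refine ((Lp.memLp u).const_mul K).mono
      (hg.comp_aestronglyMeasurable (Lp.aestronglyMeasurable u)) ?_
    filter_upwards [h] with x hx
    rw [norm_mul, Real.norm_eq_abs, Real.norm_eq_abs, Real.norm_eq_abs]
    exact hx.trans (mul_le_mul_of_nonneg_right (le_abs_self K) (abs_nonneg _))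
  rw [nem, dif_pos hm]
  exact hm.coeFn_toLp

lemma reflect_nem {g : ℝ → ℝ} (hg : Continuous g) {K : ℝ} {u : L2}
    (h : ∀ᵐ x, |g (u x)| ≤ K * |u x|) (hu : reflect u = u) : reflect (nem g u) = nem g u := by
  apply Lp.ext
  have h0 : ∀ᵐ x, u x = u (-x) := by
    have := coeFn_reflect u
    rwa [hu] at this
  filter_upwards [coeFn_reflect (nem g u), coeFn_nem hg h, ae_comp_neg (coeFn_nem hg h), h0]
    with x h1 h2 h3 h4
  rw [h1, h2, h3, h4]

/-- The rescaled nonlinearity `y ↦ β m³ y² + ε⁻⁴ m Ψ'(m ε² y)`. -/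
noncomputable def scaledForce (β : ℕ → ℝ) (Ψ : ℕ → ℝ → ℝ) (ε : ℝ) (m : ℕ) (y : ℝ) : ℝ :=
  β m * (m : ℝ) ^ 3 * y ^ 2 + (ε ^ 4)⁻¹ * (m * deriv (Ψ m) (m * ε ^ 2 * y))

variable {β γ : ℕ → ℝ} {Ψ : ℕ → ℝ → ℝ} {ε : ℝ} {m : ℕ}

lemma scaledForce_zero (h0 : deriv (Ψ m) 0 = 0) : scaledForce β Ψ ε m 0 = 0 := by
  simp [scaledForce, h0]

lemma continuous_scaledForce (hΨ : ContDiff ℝ 2 (Ψ m)) : Continuous (scaledForce β Ψ ε m) := by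
  have : Continuous (deriv (Ψ m)) := hΨ.continuous_deriv (by norm_num)
  unfold scaledForce
  fun_prop

lemma abs_deriv_sub_deriv_le (hΨ : ContDiff ℝ 2 (Ψ m))
    (hγ : ∀ r : ℝ, |r| ≤ 1 → |deriv (deriv (Ψ m)) r| ≤ γ m * r ^ 2) (hγ0 : 0 ≤ γ m) {ρ r s : ℝ}
    (hρ : ρ ≤ 1) (hr : |r| ≤ ρ) (hs : |s| ≤ ρ) :
    |deriv (Ψ m) r - deriv (Ψ m) s| ≤ γ m * ρ ^ 2 * |r - s| := by
  have hd : ContDiff ℝ 1 (deriv (Ψ m)) := by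
    have h2 : ContDiff ℝ (1 + 1) (Ψ m) := by simpa [one_add_one_eq_two] using hΨ
    exact (contDiff_succ_iff_deriv.1 h2).2.2
  have := (convex_Icc (-ρ) ρ).norm_image_sub_le_of_norm_hasDerivWithin_le
    (f := deriv (Ψ m)) (f' := deriv (deriv (Ψ m))) (C := γ m * ρ ^ 2)
    (fun x _ => ((hd.differentiable one_ne_zero) x).hasDerivAt.hasDerivWithinAt)
    (fun x hx => ?_) (abs_le.1 hs) (abs_le.1 hr)
  · exact this
  · have hx' : |x| ≤ ρ := abs_le.2 hx
    refine (hγ x (hx'.trans hρ)).trans ?_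
    rw [← sq_abs x]
    gcongr

/-- Counting powers: the bound on Ψ'' at arguments of size mε²ρ gives ε⁴, the difference of
arguments gives ε², and the prefactor is ε⁻⁴. So Ψ is a perturbation of order ε². -/
lemma abs_scaledForce_sub_le (hε : 0 < ε) (hΨ : ContDiff ℝ 2 (Ψ m))
    (hγ : ∀ r : ℝ, |r| ≤ 1 → |deriv (deriv (Ψ m)) r| ≤ γ m * r ^ 2) (hγ0 : 0 ≤ γ m) {ρ a b : ℝ}
    (hρ : m * ε ^ 2 * ρ ≤ 1) (ha : |a| ≤ ρ) (hb : |b| ≤ ρ) :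
    |scaledForce β Ψ ε m a - scaledForce β Ψ ε m b - β m * (m : ℝ) ^ 3 * (a ^ 2 - b ^ 2)| ≤
      γ m * (m : ℝ) ^ 4 * ρ ^ 2 * ε ^ 2 * |a - b| := by
  have h := abs_deriv_sub_deriv_le hΨ hγ hγ0 (ρ := m * ε ^ 2 * ρ) (r := m * ε ^ 2 * a)
    (s := m * ε ^ 2 * b) hρ
    (by rw [abs_mul, abs_of_nonneg (by positivity : 0 ≤ m * ε ^ 2)]; gcongr)
    (by rw [abs_mul, abs_of_nonneg (by positivity : 0 ≤ m * ε ^ 2)]; gcongr)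
  rw [← mul_sub, abs_mul (m * ε ^ 2), abs_of_nonneg (by positivity : 0 ≤ m * ε ^ 2)] at h
  have e : scaledForce β Ψ ε m a - scaledForce β Ψ ε m b - β m * (m : ℝ) ^ 3 * (a ^ 2 - b ^ 2) =
      (ε ^ 4)⁻¹ * m * (deriv (Ψ m) (m * ε ^ 2 * a) - deriv (Ψ m) (m * ε ^ 2 * b)) := by
    simp only [scaledForce]
    ring
  rw [e, abs_mul, abs_of_nonneg (by positivity : 0 ≤ (ε ^ 4)⁻¹ * m)]
  refine (mul_le_mul_of_nonneg_left h (by positivity)).trans (le_of_eq ?_)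
  field_simp

lemma abs_scaledForce_le (hε : 0 < ε) (hΨ : ContDiff ℝ 2 (Ψ m)) (h0 : deriv (Ψ m) 0 = 0)
    (hγ : ∀ r : ℝ, |r| ≤ 1 → |deriv (deriv (Ψ m)) r| ≤ γ m * r ^ 2) (hγ0 : 0 ≤ γ m) {ρ a : ℝ}
    (hρ : m * ε ^ 2 * ρ ≤ 1) (ha : |a| ≤ ρ) :
    |scaledForce β Ψ ε m a - β m * (m : ℝ) ^ 3 * a ^ 2| ≤
      γ m * (m : ℝ) ^ 4 * ρ ^ 2 * ε ^ 2 * |a| := by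
  have h := abs_scaledForce_sub_le (β := β) hε hΨ hγ hγ0 (b := 0) hρ ha
    (by rw [abs_zero]; exact (abs_nonneg a).trans ha)
  rw [scaledForce_zero h0] at h
  simpa using h

lemma abs_scaledForce_le' (hε : 0 < ε) (hΨ : ContDiff ℝ 2 (Ψ m)) (h0 : deriv (Ψ m) 0 = 0)
    (hγ : ∀ r : ℝ, |r| ≤ 1 → |deriv (deriv (Ψ m)) r| ≤ γ m * r ^ 2) (hγ0 : 0 ≤ γ m) (hβ : 0 < β m)
    {ρ a : ℝ} (hρ : m * ε ^ 2 * ρ ≤ 1) (ha : |a| ≤ ρ) :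
    |scaledForce β Ψ ε m a| ≤
      (β m * (m : ℝ) ^ 3 * ρ + γ m * (m : ℝ) ^ 4 * ρ ^ 2 * ε ^ 2) * |a| := by
  have h := abs_scaledForce_le (β := β) hε hΨ h0 hγ hγ0 hρ ha
  have h1 := abs_sub_abs_le_abs_sub (scaledForce β Ψ ε m a) (β m * (m : ℝ) ^ 3 * a ^ 2)
  have h2 : |β m * (m : ℝ) ^ 3 * a ^ 2| ≤ β m * (m : ℝ) ^ 3 * ρ * |a| := by
    rw [abs_of_nonneg (by positivity), ← sq_abs a, sq, ← mul_assoc]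
    gcongr
  linarith

/-- Taking ρ = |a| in the estimate makes the contribution of Ψ cubic in a with a factor ε², so the
positive quadratic term dominates, also near a = 0. -/
lemma scaledForce_nonneg (hε : 0 < ε) (hΨ : ContDiff ℝ 2 (Ψ m)) (h0 : deriv (Ψ m) 0 = 0)
    (hγ : ∀ r : ℝ, |r| ≤ 1 → |deriv (deriv (Ψ m)) r| ≤ γ m * r ^ 2) (hγ0 : 0 ≤ γ m)
    {ρ a : ℝ} (hρ : m * ε ^ 2 * ρ ≤ 1) (ha : |a| ≤ ρ) (hβγ : γ m * m * ρ * ε ^ 2 ≤ β m) :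
    0 ≤ scaledForce β Ψ ε m a := by
  have h := abs_scaledForce_le (β := β) hε hΨ h0 hγ hγ0 (ρ := |a|)
    (le_trans (by gcongr) hρ) le_rfl
  have h1 := (abs_le.1 h).1
  have h2 : γ m * (m : ℝ) ^ 4 * |a| ^ 2 * ε ^ 2 * |a| ≤ β m * (m : ℝ) ^ 3 * a ^ 2 := by
    calc γ m * (m : ℝ) ^ 4 * |a| ^ 2 * ε ^ 2 * |a| =
          (γ m * m * |a| * ε ^ 2) * ((m : ℝ) ^ 3 * |a| ^ 2) := by ring
      _ ≤ β m * ((m : ℝ) ^ 3 * |a| ^ 2) := by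
          gcongr
          refine le_trans ?_ hβγ
          gcongr
      _ = _ := by rw [sq_abs]; ring
  linarith

end Nemytskii

end AtomicChain

/-! ### Nonlinear estimates and consistency of the solitary wave -/

namespace AtomicChain

open scoped RealInnerProductSpace
open Filter Topology

/-- The standing assumptions on the interaction potentials. -/
structure Admissible (M : ℕ) (α β γ : ℕ → ℝ) (Ψ : ℕ → ℝ → ℝ) : Prop where
  one_le : 1 ≤ M
  alpha_pos : ∀ m ∈ Finset.Icc 1 M, 0 < α m
  beta_pos : ∀ m ∈ Finset.Icc 1 M, 0 < β m
  contDiff : ∀ m ∈ Finset.Icc 1 M, ContDiff ℝ 2 (Ψ m)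
  deriv_zero : ∀ m ∈ Finset.Icc 1 M, deriv (Ψ m) 0 = 0
  bound : ∀ m ∈ Finset.Icc 1 M, ∀ r : ℝ, |r| ≤ 1 → |deriv (deriv (Ψ m)) r| ≤ γ m * r ^ 2

/-- The height of the solitary wave. -/
noncomputable def waveHeight (M : ℕ) (α β : ℕ → ℝ) : ℝ := 3 * dOne M α / (2 * dTwo M α β)

/-- The nonlinear operator `u ↦ ∑ A_{mε} f_m(A_{mε} u)`. -/
noncomputable def forceOp (M : ℕ) (β : ℕ → ℝ) (Ψ : ℕ → ℝ → ℝ) (ε : ℝ) (u : L2) : L2 :=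
  ∑ m ∈ Finset.Icc 1 M, mean (m * ε) (nem (scaledForce β Ψ ε m) (mean (m * ε) u))

variable {M : ℕ} {α β γ : ℕ → ℝ} {Ψ : ℕ → ℝ → ℝ} {ε τ : ℝ}

namespace Admissible

variable (h : Admissible M α β γ Ψ)

include h

lemma gamma_nonneg {m : ℕ} (hm : m ∈ Finset.Icc 1 M) : 0 ≤ γ m := by
  have := (abs_nonneg _).trans (h.bound m hm 1 (by simp))
  simpa using this

lemma waveHeight_pos : 0 < waveHeight M α β := by
  have h1 := dOne_pos h.one_le h.alpha_pos
  have h2 := dTwo_pos h.one_le h.alpha_pos h.beta_pos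
  rw [waveHeight]
  positivity

lemma abs_kdvWave_le_waveHeight (x : ℝ) : |kdvWave M α β x| ≤ waveHeight M α β :=
  abs_kdvWave_le h.one_le h.alpha_pos h.beta_pos x

lemma memLp_kdvWave : MemLp (kdvWave M α β) 2 volume :=
  (exists_hasL2Derivs_kdvWave h.one_le h.alpha_pos h.beta_pos).choose

end Admissible

lemma pos_of_mem_Icc {m : ℕ} (hm : m ∈ Finset.Icc 1 M) : (0 : ℝ) < m := by
  exact_mod_cast (Finset.mem_Icc.1 hm).1

lemma mul_sq_mul_le_one {m : ℕ} (hm : m ∈ Finset.Icc 1 M) {Λ : ℝ} (hΛ : 0 ≤ Λ)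
    (h : M * ε ^ 2 * Λ ≤ 1) : m * ε ^ 2 * Λ ≤ 1 := by
  refine le_trans ?_ h
  have : (m : ℝ) ≤ M := by exact_mod_cast (Finset.mem_Icc.1 hm).2
  gcongr

/-- The factor √ε in the radius pays for the loss of `abs_avg_coeFn_le`, since mε ≥ ε: smallness in
L² at this scale gives smallness of averages in the sup norm. -/
lemma ae_abs_mean_sub_avg_le {W : ℝ → ℝ} (hW : MemLp W 2 volume) (hε : 0 < ε) {m : ℕ} (hm : 1 ≤ m)
    {u : L2} (hu : ‖u - hW.toLp W‖ ≤ τ * √ε) :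
    ∀ᵐ x, |mean (m * ε) u x - avg (m * ε) W x| ≤ τ := by
  have hm1 : (1 : ℝ) ≤ m := by exact_mod_cast hm
  have hη : 0 < m * ε := by positivity
  filter_upwards [coeFn_mean hη u] with x hx
  have e : avg (m * ε) u x - avg (m * ε) W x = avg (m * ε) (u - hW.toLp W : L2) x := by
    rw [← avg_sub (intervalIntegrable_coeFn u) hW.intervalIntegrable_two]
    refine congrFun (avg_congr_ae ?_) x
    filter_upwards [Lp.coeFn_sub u (hW.toLp W), hW.coeFn_toLp] with y h1 h2
    rw [h1, Pi.sub_apply, h2]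
  rw [hx, e]
  refine (abs_avg_coeFn_le hη _ x).trans ?_
  rw [div_le_iff₀ (by positivity)]
  have hτ : 0 ≤ τ := by
    have := (norm_nonneg _).trans hu
    exact nonneg_of_mul_nonneg_left this (by positivity)
  refine hu.trans ?_
  gcongr
  exact le_mul_of_one_le_left hε.le hm1

section Estimates

variable (h : Admissible M α β γ Ψ)

include h

/-- Averages stay within 1 of the solitary wave. Under Mε²(height + 1) ≤ 1 the arguments of Ψ_m'
then lie in [-1, 1], where the hypothesis on Ψ_m'' applies. -/
lemma Admissible.ae_abs_mean_le (hε : 0 < ε) (hτ : τ ≤ 1) {m : ℕ} (hm : m ∈ Finset.Icc 1 M) {u : L2}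
    (hu : ‖u - h.memLp_kdvWave.toLp _‖ ≤ τ * √ε) :
    ∀ᵐ x, |mean (m * ε) u x| ≤ waveHeight M α β + 1 := by
  have hm0 := pos_of_mem_Icc hm
  filter_upwards [ae_abs_mean_sub_avg_le h.memLp_kdvWave hε (Finset.mem_Icc.1 hm).1 hu] with x hx
  have h1 := abs_avg_le_of_abs_le (η := m * ε) (by positivity)
    (Eventually.of_forall h.abs_kdvWave_le_waveHeight) x
  have h2 := abs_sub_abs_le_abs_sub (mean (m * ε) u x) (avg (m * ε) (kdvWave M α β) x)
  linarith

lemma Admissible.coeFn_nem_scaledForce (hε : 0 < ε) (hεM : M * ε ^ 2 * (waveHeight M α β + 1) ≤ 1)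
    (hτ : τ ≤ 1) {m : ℕ} (hm : m ∈ Finset.Icc 1 M) {u : L2}
    (hu : ‖u - h.memLp_kdvWave.toLp _‖ ≤ τ * √ε) :
    nem (scaledForce β Ψ ε m) (mean (m * ε) u) =ᵐ[volume]
      fun x => scaledForce β Ψ ε m (mean (m * ε) u x) := by
  have hΛ : 0 ≤ waveHeight M α β + 1 := by linarith [h.waveHeight_pos]
  refine coeFn_nem (continuous_scaledForce (h.contDiff m hm)) (K := β m * (m : ℝ) ^ 3 *
    (waveHeight M α β + 1) + γ m * (m : ℝ) ^ 4 * (waveHeight M α β + 1) ^ 2 * ε ^ 2) ?_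
  filter_upwards [h.ae_abs_mean_le hε hτ hm hu] with x hx
  exact abs_scaledForce_le' hε (h.contDiff m hm) (h.deriv_zero m hm) (h.bound m hm)
    (h.gamma_nonneg hm) (h.beta_pos m hm) (mul_sq_mul_le_one hm hΛ hεM) hx

lemma Admissible.reflect_forceOp (hε : 0 < ε) (hεM : M * ε ^ 2 * (waveHeight M α β + 1) ≤ 1)
    (hτ : τ ≤ 1) {u : L2} (hu : ‖u - h.memLp_kdvWave.toLp _‖ ≤ τ * √ε) (hr : reflect u = u) :
    reflect (forceOp M β Ψ ε u) = forceOp M β Ψ ε u := by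
  have hΛ : 0 ≤ waveHeight M α β + 1 := by linarith [h.waveHeight_pos]
  rw [forceOp, map_sum]
  refine Finset.sum_congr rfl fun m hm => ?_
  rw [reflect_mean]
  congr 1
  refine reflect_nem (continuous_scaledForce (h.contDiff m hm)) (K := β m * (m : ℝ) ^ 3 *
    (waveHeight M α β + 1) + γ m * (m : ℝ) ^ 4 * (waveHeight M α β + 1) ^ 2 * ε ^ 2) ?_
    (by rw [reflect_mean, hr])
  filter_upwards [h.ae_abs_mean_le hε hτ hm hu] with x hx
  exact abs_scaledForce_le' hε (h.contDiff m hm) (h.deriv_zero m hm) (h.bound m hm)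
    (h.gamma_nonneg hm) (h.beta_pos m hm) (mul_sq_mul_le_one hm hΛ hεM) hx

/-- In a² - c² = (a - c)(a + c) the sum a + c is within 2τ of twice the averaged solitary wave,
whence the term 2τ; the ε² term comes from Ψ. -/
lemma Admissible.norm_nem_sub_sub_le (hε : 0 < ε) (hεM : M * ε ^ 2 * (waveHeight M α β + 1) ≤ 1)
    (hτ : τ ≤ 1) {m : ℕ} (hm : m ∈ Finset.Icc 1 M) {u v : L2}
    (hu : ‖u - h.memLp_kdvWave.toLp _‖ ≤ τ * √ε) (hv : ‖v - h.memLp_kdvWave.toLp _‖ ≤ τ * √ε) :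
    ‖nem (scaledForce β Ψ ε m) (mean (m * ε) u) - nem (scaledForce β Ψ ε m) (mean (m * ε) v) -
      (2 * β m * (m : ℝ) ^ 3) • mulOp (avg (m * ε) (kdvWave M α β)) (mean (m * ε) (u - v))‖ ≤
      (β m * (m : ℝ) ^ 3 * (2 * τ) +
        γ m * (m : ℝ) ^ 4 * (waveHeight M α β + 1) ^ 2 * ε ^ 2) * ‖u - v‖ := by
  have hm0 := pos_of_mem_Icc hm
  have hβm := h.beta_pos m hm
  have hγm := h.gamma_nonneg hm
  have hΛ : 0 ≤ waveHeight M α β + 1 := by linarith [h.waveHeight_pos]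
  have hτ0 : 0 ≤ τ :=
    nonneg_of_mul_nonneg_left ((norm_nonneg _).trans hu) (by positivity)
  have hbc : Continuous (avg (m * ε) (kdvWave M α β)) :=
    continuous_avg h.memLp_kdvWave.intervalIntegrable_two
  have hbB : ∀ x, |avg (m * ε) (kdvWave M α β) x| ≤ waveHeight M α β :=
    abs_avg_le_of_abs_le (by positivity) (Eventually.of_forall h.abs_kdvWave_le_waveHeight)
  set p := nem (scaledForce β Ψ ε m) (mean (m * ε) u) with hp
  set q := nem (scaledForce β Ψ ε m) (mean (m * ε) v) with hq
  set b := avg (m * ε) (kdvWave M α β) with hb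
  refine (norm_le_mul_norm_of_ae_le (v := mean (m * ε) (u - v)) (c := β m * (m : ℝ) ^ 3 * (2 * τ) +
    γ m * (m : ℝ) ^ 4 * (waveHeight M α β + 1) ^ 2 * ε ^ 2) ?_).trans ?_
  · filter_upwards [h.coeFn_nem_scaledForce hε hεM hτ hm hu,
      h.coeFn_nem_scaledForce hε hεM hτ hm hv, h.ae_abs_mean_le hε hτ hm hu,
      h.ae_abs_mean_le hε hτ hm hv,
      ae_abs_mean_sub_avg_le h.memLp_kdvWave hε (Finset.mem_Icc.1 hm).1 hu,
      ae_abs_mean_sub_avg_le h.memLp_kdvWave hε (Finset.mem_Icc.1 hm).1 hv,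
      Lp.coeFn_sub (p - q) ((2 * β m * (m : ℝ) ^ 3) • mulOp b (mean (m * ε) (u - v))),
      Lp.coeFn_sub p q, Lp.coeFn_smul (2 * β m * (m : ℝ) ^ 3) (mulOp b (mean (m * ε) (u - v))),
      coeFn_mulOp hbc hbB (mean (m * ε) (u - v)),
      Lp.coeFn_sub (mean (m * ε) u) (mean (m * ε) v)]
      with x e1 e2 e3 e4 e5 e6 e7 e8 e9 e10 e11
    rw [e7, Pi.sub_apply, e8, Pi.sub_apply, e9, Pi.smul_apply, e10, e1, e2, map_sub, e11,
      Pi.sub_apply, smul_eq_mul]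
    set a := mean (m * ε) u x
    set c := mean (m * ε) v x
    have h1 := abs_scaledForce_sub_le (β := β) hε (h.contDiff m hm) (h.bound m hm) hγm
      (mul_sq_mul_le_one hm hΛ hεM) e3 e4
    have h2 : |β m * (m : ℝ) ^ 3 * ((a - c) * ((a - b x) + (c - b x)))| ≤
        β m * (m : ℝ) ^ 3 * (2 * τ) * |a - c| := by
      have h3 : |(a - b x) + (c - b x)| ≤ 2 * τ := (abs_add_le _ _).trans (by linarith)
      rw [abs_mul, abs_of_nonneg (by positivity : 0 ≤ β m * (m : ℝ) ^ 3), abs_mul]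
      calc _ ≤ β m * (m : ℝ) ^ 3 * (|a - c| * (2 * τ)) := by gcongr
        _ = _ := by ring
    have e : scaledForce β Ψ ε m a - scaledForce β Ψ ε m c -
        2 * β m * (m : ℝ) ^ 3 * (b x * (a - c)) =
        (scaledForce β Ψ ε m a - scaledForce β Ψ ε m c - β m * (m : ℝ) ^ 3 * (a ^ 2 - c ^ 2)) +
          β m * (m : ℝ) ^ 3 * ((a - c) * ((a - b x) + (c - b x))) := by ring
    rw [e]
    refine (abs_add_le _ _).trans ?_
    linarith
  · gcongr
    exact norm_mean_le _ _

/-- The nonlinearity is close to its linearisation at the solitary wave. -/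
lemma Admissible.norm_forceOp_sub_sub_le (hε : 0 < ε) (hεM : M * ε ^ 2 * (waveHeight M α β + 1) ≤ 1)
    (hτ : τ ≤ 1) {u v : L2}
    (hu : ‖u - h.memLp_kdvWave.toLp _‖ ≤ τ * √ε) (hv : ‖v - h.memLp_kdvWave.toLp _‖ ≤ τ * √ε) :
    ‖forceOp M β Ψ ε u - forceOp M β Ψ ε v - quadOp M β (kdvWave M α β) ε (u - v)‖ ≤
      ((∑ m ∈ Finset.Icc 1 M, β m * (m : ℝ) ^ 3) * (2 * τ) +
        (∑ m ∈ Finset.Icc 1 M, γ m * (m : ℝ) ^ 4) * (waveHeight M α β + 1) ^ 2 * ε ^ 2) *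
        ‖u - v‖ := by
  rw [forceOp, forceOp, quadOp_apply, ← Finset.sum_sub_distrib, ← Finset.sum_sub_distrib,
    Finset.sum_mul, Finset.sum_mul, Finset.sum_mul, ← Finset.sum_add_distrib, Finset.sum_mul]
  refine norm_sum_le_of_le _ fun m hm => ?_
  rw [← map_sub, ← map_smul, ← map_sub]
  exact (norm_mean_le _ _).trans (h.norm_nem_sub_sub_le hε hεM hτ hm hu hv)

omit h in
lemma HasL2Derivs.norm_mean_mean_sub_le {w w₁ w₂ w₃ w₄ : L2} (hw : HasL2Derivs w w₁ w₂)
    (hw' : HasL2Derivs w₂ w₃ w₄) {η : ℝ} (hη : 0 < η) :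
    ‖w - mean η (mean η w) + (η ^ 2 / 12) • w₂‖ ≤ η ^ 4 * (9 * ‖w₄‖) := by
  set e := mean η w - w - (η ^ 2 / 24) • w₂ with he
  have h1 : ‖e‖ ≤ η ^ 4 * (2 * ‖w₄‖) := hw.norm_mean_sub_sub_le hw' hη
  have h2 : ‖mean η w₂ - w₂‖ ≤ η ^ 2 * (2 * ‖w₄‖) := hw'.norm_mean_sub_le hη
  have e1 : w - mean η (mean η w) + (η ^ 2 / 12) • w₂ =
      -(e + mean η e + (η ^ 2 / 24) • (mean η w₂ - w₂)) := by
    simp only [he, map_sub, map_smul]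
    module
  rw [e1, norm_neg]
  refine (norm_add₃_le ..).trans ?_
  have h3 := norm_mean_le η e
  rw [norm_smul, Real.norm_of_nonneg (by positivity : 0 ≤ η ^ 2 / 24)]
  have h4 : η ^ 2 / 24 * ‖mean η w₂ - w₂‖ ≤ η ^ 2 / 24 * (η ^ 2 * (2 * ‖w₄‖)) := by gcongr
  have h5 : 0 ≤ η ^ 4 * ‖w₄‖ := by positivity
  have h6 : η ^ 2 / 24 * (η ^ 2 * (2 * ‖w₄‖)) = η ^ 4 * ‖w₄‖ / 12 := by ring
  linarith

omit h in
lemma norm_mean_mulOp_mean_sub_le {W : ℝ → ℝ} {B D η : ℝ} (hη : 0 < η) (hW : Continuous W)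
    (hB : ∀ x, |W x| ≤ B) (hD : ∀ x, |avg η W x - W x| ≤ η ^ 2 * D) {w w₁ w₂ : L2}
    (hw : HasL2Derivs w w₁ w₂) {E : ℝ}
    (hE : ‖mean η (mulOp W w) - mulOp W w‖ ≤ η ^ 2 * E) :
    ‖mean η (mulOp (avg η W) (mean η w)) - mulOp W w‖ ≤
      η ^ 2 * (D * ‖w‖ + B * (2 * ‖w₂‖) + E) := by
  have hB0 : 0 ≤ B := (abs_nonneg _).trans (hB 0)
  have hbc : Continuous (avg η W) := continuous_avg fun a b => hW.intervalIntegrable a b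
  have hbB : ∀ x, |avg η W x| ≤ B := abs_avg_le_of_abs_le hη (Eventually.of_forall hB)
  have hD0 : 0 ≤ η ^ 2 * D := (abs_nonneg _).trans (hD 0)
  have e : mean η (mulOp (avg η W) (mean η w)) - mulOp W w =
      mean η (mulOp (avg η W) (mean η w) - mulOp W (mean η w)) +
        mean η (mulOp W (mean η w - w)) + (mean η (mulOp W w) - mulOp W w) := by
    simp only [map_sub]
    abel
  rw [e]
  refine (norm_add₃_le ..).trans ?_
  have h1 : ‖mean η (mulOp (avg η W) (mean η w) - mulOp W (mean η w))‖ ≤ η ^ 2 * D * ‖w‖ := by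
    refine (norm_mean_le _ _).trans ((norm_mulOp_sub_le hbc hbB hW hB hD _).trans ?_)
    gcongr
    exact norm_mean_le _ _
  have h2 : ‖mean η (mulOp W (mean η w - w))‖ ≤ B * (η ^ 2 * (2 * ‖w₂‖)) := by
    refine (norm_mean_le _ _).trans ((norm_mulOp_le hW hB _).trans ?_)
    gcongr
    exact hw.norm_mean_sub_le hη
  linarith

/-- Consistency: the solitary wave solves the rescaled equation up to `O(ε²)` in `L²(ℝ)`. -/
lemma Admissible.exists_norm_residual_le : ∃ C : ℝ, 0 < C ∧ ∀ ε : ℝ, 0 < ε →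
    M * ε ^ 2 * (waveHeight M α β + 1) ≤ 1 →
      ‖forceOp M β Ψ ε (h.memLp_kdvWave.toLp _) - dispOp M α ε (h.memLp_kdvWave.toLp _)‖ ≤
        C * ε ^ 2 := by
  have hd1 := dOne_pos h.one_le h.alpha_pos
  have hd2 := dTwo_pos h.one_le h.alpha_pos h.beta_pos
  obtain ⟨hm0, w₁, w₂, w₃, w₄, hw, hw', hw₂⟩ :=
    exists_hasL2Derivs_kdvWave h.one_le h.alpha_pos h.beta_pos
  obtain ⟨D, hD0, hD⟩ := exists_second_deriv_bound h.one_le h.alpha_pos h.beta_pos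
  set W := kdvWave M α β with hW
  set w := hm0.toLp W with hwdef
  set B := waveHeight M α β with hB
  have hB0 : 0 < B := h.waveHeight_pos
  have hWc : Continuous W := continuous_kdvWave M α β
  have hWB : ∀ x, |W x| ≤ B := h.abs_kdvWave_le_waveHeight
  set d₁ := dOne M α
  set d₂ := dTwo M α β
  set E := 1 / d₂ * (d₁ * (2 * ‖w₂‖) + 2 * ‖w₄‖) with hE
  have hE0 : 0 ≤ E := by positivity
  set F := D * ‖w‖ + B * (2 * ‖w₂‖) + E with hF
  have hF0 : 0 ≤ F := by positivity
  -- The equation expresses W² through W and W'', so the averaging error of the product is estimated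
  -- without differentiating it.
  have hmw : mulOp W w = (1 / d₂) • (d₁ • w - w₂) := by
    rw [hw₂, sub_sub_cancel, smul_smul, one_div_mul_cancel hd2.ne', one_smul]
  have hEb : ∀ η : ℝ, 0 < η → ‖mean η (mulOp W w) - mulOp W w‖ ≤ η ^ 2 * E := by
    intro η hη
    have e : mean η (mulOp W w) - mulOp W w =
        (1 / d₂) • (d₁ • (mean η w - w) - (mean η w₂ - w₂)) := by
      simp only [hmw, map_smul, map_sub]
      module
    have h1 := hw.norm_mean_sub_le hη
    have h2 := hw'.norm_mean_sub_le hη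
    have h3 := norm_sub_le (d₁ • (mean η w - w)) (mean η w₂ - w₂)
    rw [norm_smul, Real.norm_of_nonneg hd1.le] at h3
    rw [e, norm_smul, Real.norm_of_nonneg (by positivity : 0 ≤ 1 / d₂)]
    calc _ ≤ 1 / d₂ * (d₁ * (η ^ 2 * (2 * ‖w₂‖)) + η ^ 2 * (2 * ‖w₄‖)) := by
          gcongr
          refine h3.trans ?_
          gcongr
      _ = _ := by rw [hE]; ring
  set CF := ∑ m ∈ Finset.Icc 1 M, (γ m * (m : ℝ) ^ 4 * (B + 1) ^ 2 * ‖w‖ +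
    β m * (m : ℝ) ^ 3 * ((m : ℝ) ^ 2 * F)) with hCF
  set CD := ∑ m ∈ Finset.Icc 1 M, α m * (m : ℝ) ^ 2 * ((m : ℝ) ^ 4 * (9 * ‖w₄‖)) with hCD
  have hCF0 : 0 ≤ CF := Finset.sum_nonneg fun m hm => by
    have := h.beta_pos m hm
    have := h.gamma_nonneg hm
    positivity
  have hCD0 : 0 ≤ CD := Finset.sum_nonneg fun m hm => by
    have := h.alpha_pos m hm
    positivity
  refine ⟨CF + CD + 1, by positivity, fun ε hε hεM => ?_⟩
  have hforce : ‖forceOp M β Ψ ε w - ∑ m ∈ Finset.Icc 1 M, (β m * (m : ℝ) ^ 3) • mulOp W w‖ ≤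
      CF * ε ^ 2 := by
    rw [forceOp, ← Finset.sum_sub_distrib, hCF, Finset.sum_mul]
    refine norm_sum_le_of_le _ fun m hm => ?_
    have hm0 := pos_of_mem_Icc hm
    have hβm := h.beta_pos m hm
    have hγm := h.gamma_nonneg hm
    have hη : 0 < m * ε := by positivity
    have hbc : Continuous (avg (m * ε) W) := continuous_avg fun a b => hWc.intervalIntegrable a b
    have hbB : ∀ x, |avg (m * ε) W x| ≤ B := abs_avg_le_of_abs_le hη (Eventually.of_forall hWB)
    -- The case τ = 0 of the general estimates; it identifies the average of the class with that of
    -- the function almost everywhere.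
    have h0 : ‖w - h.memLp_kdvWave.toLp _‖ ≤ 0 * √ε := by simp [hwdef, hW]
    set p := nem (scaledForce β Ψ ε m) (mean (m * ε) w) with hp
    set q := mulOp (avg (m * ε) W) (mean (m * ε) w) with hq
    have h1 : ‖p - (β m * (m : ℝ) ^ 3) • q‖ ≤
        γ m * (m : ℝ) ^ 4 * (B + 1) ^ 2 * ε ^ 2 * ‖w‖ := by
      refine (norm_le_mul_norm_of_ae_le (v := mean (m * ε) w)
        (c := γ m * (m : ℝ) ^ 4 * (B + 1) ^ 2 * ε ^ 2) ?_).trans (by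
          gcongr
          exact norm_mean_le _ _)
      filter_upwards [h.coeFn_nem_scaledForce hε hεM zero_le_one hm h0,
        h.ae_abs_mean_le hε zero_le_one hm h0, ae_abs_mean_sub_avg_le h.memLp_kdvWave hε
          (Finset.mem_Icc.1 hm).1 h0, Lp.coeFn_sub p ((β m * (m : ℝ) ^ 3) • q),
        Lp.coeFn_smul (β m * (m : ℝ) ^ 3) q, coeFn_mulOp hbc hbB (mean (m * ε) w)]
        with x e1 e2 e3 e4 e5 e6
      have e7 : mean (m * ε) w x = avg (m * ε) W x := by
        have := abs_nonpos_iff.1 e3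
        linarith
      rw [e4, Pi.sub_apply, e1, e5, Pi.smul_apply, e6, ← e7, smul_eq_mul, ← sq]
      exact abs_scaledForce_le hε (h.contDiff m hm) (h.deriv_zero m hm) (h.bound m hm) hγm
        (mul_sq_mul_le_one hm (by positivity) hεM) e2
    have h2 := norm_mean_mulOp_mean_sub_le hη hWc hWB (hD _ hη) hw (hEb _ hη)
    have e : mean (m * ε) p - (β m * (m : ℝ) ^ 3) • mulOp W w =
        mean (m * ε) (p - (β m * (m : ℝ) ^ 3) • q) +
          (β m * (m : ℝ) ^ 3) • (mean (m * ε) q - mulOp W w) := by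
      simp only [map_sub, map_smul]
      module
    rw [e]
    refine (norm_add_le _ _).trans ?_
    rw [norm_smul, Real.norm_of_nonneg (by positivity : 0 ≤ β m * (m : ℝ) ^ 3), add_mul]
    refine add_le_add (((norm_mean_le _ _).trans h1).trans (le_of_eq (by ring))) ?_
    calc β m * (m : ℝ) ^ 3 * ‖mean (m * ε) q - mulOp W w‖ ≤
          β m * (m : ℝ) ^ 3 * ((m * ε) ^ 2 * F) := by gcongr
      _ = _ := by ring
  have hdisp : ‖dispOp M α ε w - (w - (1 / d₁) • w₂)‖ ≤ CD * ε ^ 2 := by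
    have e1 : (1 / d₁) • w₂ = ∑ m ∈ Finset.Icc 1 M,
        (α m * (m : ℝ) ^ 2 / ε ^ 2) • (((m * ε) ^ 2 / 12) • w₂) := by
      have e2 := sum_mul_pow_four h.one_le h.alpha_pos
      have e3 : 1 / d₁ = (∑ m ∈ Finset.Icc 1 M, α m * (m : ℝ) ^ 4) / 12 := by
        rw [e2]
        change 1 / d₁ = 12 / d₁ / 12
        field_simp
      rw [e3, Finset.sum_div, Finset.sum_smul]
      refine Finset.sum_congr rfl fun m _ => ?_
      rw [smul_smul]
      congr 1
      field_simp
    have e4 : dispOp M α ε w - (w - (1 / d₁) • w₂) = ∑ m ∈ Finset.Icc 1 M,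
        (α m * (m : ℝ) ^ 2 / ε ^ 2) •
          (w - mean (m * ε) (mean (m * ε) w) + ((m * ε) ^ 2 / 12) • w₂) := by
      rw [dispOp_apply, e1]
      simp only [smul_add, Finset.sum_add_distrib]
      abel
    rw [e4, hCD, Finset.sum_mul]
    refine norm_sum_le_of_le _ fun m hm => ?_
    have hm0 := pos_of_mem_Icc hm
    have hαm := h.alpha_pos m hm
    rw [norm_smul, Real.norm_of_nonneg (by positivity)]
    refine (mul_le_mul_of_nonneg_left (hw.norm_mean_mean_sub_le hw' (by positivity))
      (by positivity)).trans (le_of_eq ?_)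
    field_simp
  -- The KdV equation itself: the leading terms of both sides cancel and only O(ε²) remains.
  have hlead : w - (1 / d₁) • w₂ = ∑ m ∈ Finset.Icc 1 M, (β m * (m : ℝ) ^ 3) • mulOp W w := by
    rw [← Finset.sum_smul, sum_mul_pow_three h.one_le h.alpha_pos, hmw, smul_smul]
    have : d₂ / d₁ * (1 / d₂) = 1 / d₁ := by field_simp
    rw [this, smul_sub, smul_smul, one_div_mul_cancel hd1.ne', one_smul]
  have h3 := norm_sub_le (forceOp M β Ψ ε w - ∑ m ∈ Finset.Icc 1 M, (β m * (m : ℝ) ^ 3) • mulOp W w)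
    (dispOp M α ε w - (w - (1 / d₁) • w₂))
  rw [hlead, sub_sub_sub_cancel_right] at h3
  rw [hlead] at hdisp
  have h4 : 0 ≤ ε ^ 2 := by positivity
  change ‖forceOp M β Ψ ε w - dispOp M α ε w‖ ≤ _
  linarith

end Estimates

end AtomicChain

/-! ### Solving the nonlinear equation by contraction -/

namespace AtomicChain

open scoped RealInnerProductSpace
open Filter Topology

section Abstract

variable {T Q : L2 →L[ℝ] L2} {C : ℝ}

/-- Solvability of a linear equation among even functions. -/
lemma exists_even_solution_linear (hT : ∀ u v, ⟪T u, v⟫ = ⟪u, T v⟫)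
    (hQ : ∀ u v, ⟪Q u, v⟫ = ⟪u, Q v⟫) (hTr : ∀ u, reflect (T u) = T (reflect u))
    (hQr : ∀ u, reflect (Q u) = Q (reflect u)) (hT1 : ∀ u, ‖u‖ ≤ ‖T u‖) (hC : 0 ≤ C)
    (hTQ : ∀ u, reflect u = u → ‖u‖ ≤ C * ‖T u - Q u‖) {f : L2} (hf : reflect f = f) :
    ∃ u, reflect u = u ∧ T u - Q u = f := by
  set P : L2 →L[ℝ] L2 :=
    (1 / 2 : ℝ) • (ContinuousLinearMap.id ℝ L2 + reflect.toContinuousLinearMap) with hP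
  have hPa : ∀ u, P u = (1 / 2 : ℝ) • (u + reflect u) := fun u => by simp [hP]
  have hPs : ∀ u v, ⟪P u, v⟫ = ⟪u, P v⟫ := fun u v => by
    simp only [hPa, real_inner_smul_left, real_inner_smul_right, inner_add_left, inner_add_right,
      inner_reflect_left]
  have hPr : ∀ u, reflect (P u) = P u := fun u => by
    rw [hPa, map_smul, map_add, reflect_reflect, add_comm]
  have hPr' : ∀ u, P (reflect u) = P u := fun u => by
    rw [hPa, hPa, reflect_reflect, add_comm]
  have hPe : ∀ u, reflect u = u → P u = u := fun u hu => by
    rw [hPa, hu]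
    module
  have hQP : ∀ u, P (Q u) = Q (P u) := fun u => by simp only [hPa, map_smul, map_add, hQr]
  have hTP : ∀ u, P (T u) = T (P u) := fun u => by simp only [hPa, map_smul, map_add, hTr]
  have hPn : ∀ u, ‖P u‖ ≤ ‖u‖ := fun u => by
    rw [hPa, norm_smul, Real.norm_of_nonneg (by norm_num)]
    have := norm_add_le u (reflect u)
    rw [reflect.norm_map] at this
    linarith
  have hPn' : ∀ u, ‖u - P u‖ ≤ ‖u‖ := fun u => by
    have e : u - P u = (1 / 2 : ℝ) • (u - reflect u) := by
      rw [hPa]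
      module
    rw [e, norm_smul, Real.norm_of_nonneg (by norm_num)]
    have := norm_sub_le u (reflect u)
    rw [reflect.norm_map] at this
    linarith
  -- With P the projection onto even functions, S is T - Q on even and T on odd functions. It is
  -- therefore symmetric and bounded below on the whole space, and no operator on a subspace is
  -- needed.
  set S : L2 →L[ℝ] L2 := T - Q.comp P with hS
  have hSa : ∀ u, S u = T u - Q (P u) := fun u => by simp [hS]
  have hSs : ∀ u v, ⟪S u, v⟫ = ⟪u, S v⟫ := fun u v => by
    rw [hSa, hSa, inner_sub_left, inner_sub_right, hT, hQ, hPs, hQP]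
  have hPS : ∀ u, P (S u) = T (P u) - Q (P u) := fun u => by
    rw [hSa, map_sub, hTP, hPe (Q (P u)) (by rw [hQr, hPr])]
  have hSb : ∀ u, ‖u‖ ≤ (C + 1) * ‖S u‖ := fun u => by
    have h1 := hTQ (P u) (hPr u)
    rw [← hPS] at h1
    have h2 := hT1 (u - P u)
    have e : T (u - P u) = S u - P (S u) := by
      rw [hPS, hSa, map_sub]
      abel
    rw [e] at h2
    have h3 := hPn' (S u)
    have h4 : C * ‖P (S u)‖ ≤ C * ‖S u‖ := mul_le_mul_of_nonneg_left (hPn _) hC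
    have h5 := norm_add_le (P u) (u - P u)
    rw [add_sub_cancel] at h5
    linarith
  obtain ⟨u, hu⟩ := surjective_of_symmetric_of_bounded_below S hSs hSb f
  have hur : reflect u = u := by
    have e : S (reflect u - u) = 0 := by
      rw [map_sub, hSa (reflect u), hPr', ← hTr, ← hPr u, ← hQr, ← map_sub, ← hSa, hu, hf, sub_self]
    have := hSb (reflect u - u)
    rw [e, norm_zero, mul_zero] at this
    exact sub_eq_zero.1 (norm_le_zero_iff.1 this)
  refine ⟨u, hur, ?_⟩
  rw [← hu, hSa, hPe u hur]

/-- Applying T - Q to the difference of two solutions leaves only the remainder of N, which the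
inverse of T - Q turns into at most half of the difference. -/
lemma eq_of_even_solutions {N : L2 → L2} {θ : ℝ} (hC : 0 ≤ C)
    (hTQ : ∀ u, reflect u = u → ‖u‖ ≤ C * ‖T u - Q u‖) (hθ : C * θ ≤ 1 / 2) {u v : L2}
    (hu : reflect u = u) (hv : reflect v = v) (hN : ‖N u - N v - Q (u - v)‖ ≤ θ * ‖u - v‖)
    (hTu : T u = N u) (hTv : T v = N v) : u = v := by
  have h1 := hTQ (u - v) (by rw [map_sub, hu, hv])
  rw [map_sub T, hTu, hTv] at h1
  have h2 := mul_le_mul_of_nonneg_left hN hC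
  have h3 := mul_le_mul_of_nonneg_right hθ (norm_nonneg (u - v))
  have h4 : ‖u - v‖ ≤ 0 := by linarith
  exact sub_eq_zero.1 (norm_le_zero_iff.1 h4)

/-- Existence of an even solution near an approximate even solution. -/
lemma exists_even_solution (hT : ∀ u v, ⟪T u, v⟫ = ⟪u, T v⟫)
    (hQ : ∀ u v, ⟪Q u, v⟫ = ⟪u, Q v⟫) (hTr : ∀ u, reflect (T u) = T (reflect u))
    (hQr : ∀ u, reflect (Q u) = Q (reflect u)) (hT1 : ∀ u, ‖u‖ ≤ ‖T u‖) (hC : 0 ≤ C)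
    (hTQ : ∀ u, reflect u = u → ‖u‖ ≤ C * ‖T u - Q u‖) {N : L2 → L2} {θ r δ : ℝ} {w : L2}
    (hr : 0 ≤ r) (hw : reflect w = w)
    (hNr : ∀ u, ‖u - w‖ ≤ r → reflect u = u → reflect (N u) = N u)
    (hN : ∀ u v, ‖u - w‖ ≤ r → ‖v - w‖ ≤ r → ‖N u - N v - Q (u - v)‖ ≤ θ * ‖u - v‖)
    (hθ : C * θ ≤ 1 / 2) (hδ : ‖N w - T w‖ ≤ δ) (hCδ : C * δ ≤ r / 2) :
    ∃ u, reflect u = u ∧ ‖u - w‖ ≤ r ∧ T u = N u := by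
  have hex : ∀ f : L2, ∃ u, reflect f = f → reflect u = u ∧ T u - Q u = f := fun f => by
    by_cases hf : reflect f = f
    · obtain ⟨u, hu⟩ := exists_even_solution_linear hT hQ hTr hQr hT1 hC hTQ hf
      exact ⟨u, fun _ => hu⟩
    · exact ⟨0, fun h => absurd h hf⟩
  choose S hS using hex
  set s : Set L2 := {h | reflect h = h ∧ ‖h‖ ≤ r} with hs
  have hsc : IsClosed s :=
    (isClosed_eq reflect.continuous continuous_id).inter (isClosed_le continuous_norm
      continuous_const)
  -- A fixed point h of F satisfies Th - Qh = N(w + h) - Qh - Tw, that is, w + h solves the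
  -- equation.
  set g : L2 → L2 := fun h => N (w + h) - Q h - T w with hg
  set F : L2 → L2 := fun h => S (g h) with hF
  have hnear : ∀ h ∈ s, ‖w + h - w‖ ≤ r := fun h hh => by
    rw [add_sub_cancel_left]
    exact hh.2
  have hge : ∀ h ∈ s, reflect (g h) = g h := fun h hh => by
    simp only [hg, map_sub]
    rw [hNr _ (hnear h hh) (by rw [map_add, hw, hh.1]), hQr, hTr, hh.1, hw]
  have hL : ∀ h ∈ s, T (F h) - Q (F h) = g h := fun h hh => (hS _ (hge h hh)).2
  have hLip : ∀ h ∈ s, ∀ k ∈ s, ‖F h - F k‖ ≤ 1 / 2 * ‖h - k‖ := fun h hh k hk => by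
    have h1 := hTQ (F h - F k) (by rw [map_sub, (hS _ (hge h hh)).1, (hS _ (hge k hk)).1])
    have e : T (F h - F k) - Q (F h - F k) = N (w + h) - N (w + k) - Q (w + h - (w + k)) := by
      have e1 : T (F h - F k) - Q (F h - F k) = g h - g k := by
        rw [← hL h hh, ← hL k hk, map_sub, map_sub]
        abel
      rw [e1, add_sub_add_left_eq_sub, map_sub]
      simp only [hg]
      abel
    rw [e] at h1
    have h2 := mul_le_mul_of_nonneg_left (hN _ _ (hnear h hh) (hnear k hk)) hC
    rw [add_sub_add_left_eq_sub] at h1 h2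
    have h3 := mul_le_mul_of_nonneg_right hθ (norm_nonneg (h - k))
    linarith
  have h0 : (0 : L2) ∈ s := ⟨map_zero _, by simpa using hr⟩
  have hF0 : ‖F 0‖ ≤ r / 2 := by
    have h1 := hTQ (F 0) (hS _ (hge 0 h0)).1
    rw [hL 0 h0] at h1
    simp only [hg, add_zero, map_zero, sub_zero] at h1
    exact h1.trans ((mul_le_mul_of_nonneg_left hδ hC).trans hCδ)
  have hmaps : Set.MapsTo F s s := fun h hh => by
    refine ⟨(hS _ (hge h hh)).1, ?_⟩
    have h1 := hLip h hh 0 h0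
    have h2 := norm_add_le (F h - F 0) (F 0)
    rw [sub_add_cancel] at h2
    rw [sub_zero] at h1
    linarith [hh.2]
  have hcontr : ContractingWith (1 / 2) (hmaps.restrict F s s) := by
    refine ⟨by norm_num, LipschitzWith.of_dist_le_mul fun h k => ?_⟩
    have := hLip h h.2 k k.2
    rw [Subtype.dist_eq, Subtype.dist_eq, dist_eq_norm, dist_eq_norm]
    simpa using this
  obtain ⟨h, hh, hfix, -⟩ := hcontr.exists_fixedPoint' hsc.isComplete hmaps h0 (edist_ne_top _ _)
  refine ⟨w + h, by rw [map_add, hw, hh.1], hnear h hh, ?_⟩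
  have h1 := hL h hh
  rw [hfix] at h1
  simp only [hg] at h1
  rw [map_add]
  have h2 : T h - Q h + Q h + T w = N (w + h) := by
    rw [h1]
    abel
  rw [← h2]
  abel

end Abstract

lemma eventually_mul_sq_le (K : ℝ) {c : ℝ} (hc : 0 < c) : ∀ᶠ ε : ℝ in 𝓝[>] 0, K * ε ^ 2 ≤ c := by
  have h : Tendsto (fun ε : ℝ => K * ε ^ 2) (𝓝[>] 0) (𝓝 0) := by
    have : Continuous fun ε : ℝ => K * ε ^ 2 := by fun_prop
    simpa using (this.tendsto 0).mono_left nhdsWithin_le_nhds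
  exact h.eventually_le_const hc

lemma eventually_mul_sq_le_mul_sqrt (K : ℝ) {c : ℝ} (hc : 0 < c) :
    ∀ᶠ ε : ℝ in 𝓝[>] 0, K * ε ^ 2 ≤ c * √ε := by
  have h : Tendsto (fun ε : ℝ => K * (ε * √ε)) (𝓝[>] 0) (𝓝 0) := by
    have : Continuous fun ε : ℝ => K * (ε * √ε) := by fun_prop
    simpa using (this.tendsto 0).mono_left nhdsWithin_le_nhds
  filter_upwards [h.eventually_le_const hc, self_mem_nhdsWithin] with ε h1 h2
  have h3 := mul_le_mul_of_nonneg_right h1 (Real.sqrt_nonneg ε)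
  have h4 := Real.mul_self_sqrt (le_of_lt h2)
  calc K * ε ^ 2 = K * (ε * (√ε * √ε)) := by rw [h4]; ring
    _ = K * (ε * √ε) * √ε := by ring
    _ ≤ _ := h3

variable {M : ℕ} {α β γ : ℕ → ℝ} {Ψ : ℕ → ℝ → ℝ}

lemma Admissible.reflect_kdvWave (h : Admissible M α β γ Ψ) :
    reflect (h.memLp_kdvWave.toLp _) = h.memLp_kdvWave.toLp _ := by
  apply Lp.ext
  filter_upwards [coeFn_reflect (h.memLp_kdvWave.toLp _), h.memLp_kdvWave.coeFn_toLp,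
    ae_comp_neg h.memLp_kdvWave.coeFn_toLp] with x h1 h2 h3
  rw [h1, h3, h2, kdvWave_neg]

/-- Existence and local uniqueness in `L²(ℝ)`. -/
theorem Admissible.exists_unique_L2 (h : Admissible M α β γ Ψ) : ∃ τ C : ℝ, 0 < τ ∧ τ ≤ 1 ∧ 0 < C ∧
    ∀ᶠ ε : ℝ in 𝓝[>] 0,
      (∃ u : L2, reflect u = u ∧ ‖u - h.memLp_kdvWave.toLp _‖ ≤ C * ε ^ 2 ∧
        ‖u - h.memLp_kdvWave.toLp _‖ ≤ τ * √ε ∧ dispOp M α ε u = forceOp M β Ψ ε u) ∧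
      ∀ u v : L2, reflect u = u → reflect v = v → ‖u - h.memLp_kdvWave.toLp _‖ ≤ τ * √ε →
        ‖v - h.memLp_kdvWave.toLp _‖ ≤ τ * √ε → dispOp M α ε u = forceOp M β Ψ ε u →
        dispOp M α ε v = forceOp M β Ψ ε v → u = v := by
  obtain ⟨C, ε₁, hC, hε₁, hlin⟩ := exists_norm_le_linearization h.one_le h.alpha_pos h.beta_pos
  obtain ⟨R, hR, hres⟩ := h.exists_norm_residual_le
  set w := h.memLp_kdvWave.toLp (kdvWave M α β) with hw
  set b := ∑ m ∈ Finset.Icc 1 M, β m * (m : ℝ) ^ 3 with hb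
  have hb0 : 0 ≤ b := Finset.sum_nonneg fun m hm => by
    have := h.beta_pos m hm
    positivity
  -- Of the allowed 1/2 for Cθ, this choice spends 1/4 on the quadratic term; small ε keeps the Ψ
  -- term below the other 1/4.
  set τ := min 1 (1 / (8 * C * (b + 1))) with hτ
  have hτ0 : 0 < τ := lt_min one_pos (by positivity)
  have hτ1 : τ ≤ 1 := min_le_left _ _
  have hτb : C * (b * (2 * τ)) ≤ 1 / 4 := by
    have h1 : τ ≤ 1 / (8 * C * (b + 1)) := min_le_right _ _
    rw [le_div_iff₀ (by positivity)] at h1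
    have h2 : 0 ≤ C * τ := by positivity
    linarith
  have hc : Continuous (kdvWave M α β) := continuous_kdvWave M α β
  have hB := h.abs_kdvWave_le_waveHeight
  -- The residual Rε² becomes CRε² under the inverse, which has to be half of the radius of the
  -- ball.
  refine ⟨τ, 2 * C * R, hτ0, hτ1, by positivity, ?_⟩
  filter_upwards [Ioc_mem_nhdsGT hε₁,
    eventually_mul_sq_le (M * (waveHeight M α β + 1)) one_pos,
    eventually_mul_sq_le (C * ((∑ m ∈ Finset.Icc 1 M, γ m * (m : ℝ) ^ 4) *
      (waveHeight M α β + 1) ^ 2)) (by norm_num : (0 : ℝ) < 1 / 4),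
    eventually_mul_sq_le_mul_sqrt (2 * C * R) hτ0] with ε h1 h2 h3 h4
  have hε : 0 < ε := h1.1
  have hεM : M * ε ^ 2 * (waveHeight M α β + 1) ≤ 1 := by linarith
  have hlin' := hlin ε hε h1.2
  have hN := fun u v hu hv => h.norm_forceOp_sub_sub_le hε hεM hτ1 (u := u) (v := v) hu hv
  set θ := b * (2 * τ) + (∑ m ∈ Finset.Icc 1 M, γ m * (m : ℝ) ^ 4) *
    (waveHeight M α β + 1) ^ 2 * ε ^ 2 with hθ
  have hCθ : C * θ ≤ 1 / 2 := by
    rw [hθ, mul_add]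
    linarith
  refine ⟨?_, fun u v hu hv hu' hv' hsu hsv =>
    eq_of_even_solutions hC.le hlin' hCθ hu hv (hN u v hu' hv') hsu hsv⟩
  obtain ⟨u, hu, hur, hsu⟩ := exists_even_solution (w := w) (r := 2 * C * R * ε ^ 2) (θ := θ)
    inner_dispOp_left (inner_quadOp_left hε hc hB) reflect_dispOp
    (reflect_quadOp hε hc hB (kdvWave_neg M α β)) (norm_le_norm_dispOp h.alpha_pos) hC.le hlin'
    (by positivity) h.reflect_kdvWave
    (fun u hu hr => h.reflect_forceOp hε hεM hτ1 (hu.trans h4) hr)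
    (fun u v hu hv => hN u v (hu.trans h4) (hv.trans h4)) hCθ (hres ε hε hεM) (by linarith)
  exact ⟨u, hu, hur, hur.trans h4, hsu⟩

end AtomicChain

/-! ### The error in the sup norm -/

namespace AtomicChain

open scoped RealInnerProductSpace
open Filter Topology

lemma ae_abs_add_le {u v : L2} {a b : ℝ} (hu : ∀ᵐ x, |u x| ≤ a) (hv : ∀ᵐ x, |v x| ≤ b) :
    ∀ᵐ x, |(u + v) x| ≤ a + b := by
  filter_upwards [hu, hv, Lp.coeFn_add u v] with x h1 h2 h3
  rw [h3, Pi.add_apply]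
  exact (abs_add_le _ _).trans (add_le_add h1 h2)

lemma ae_abs_smul_le {u : L2} {a c : ℝ} (hu : ∀ᵐ x, |u x| ≤ a) : ∀ᵐ x, |(c • u) x| ≤ |c| * a := by
  filter_upwards [hu, Lp.coeFn_smul c u] with x h1 h2
  rw [h2, Pi.smul_apply, smul_eq_mul, abs_mul]
  gcongr

lemma ae_abs_sum_le {s : Finset ℕ} {u : ℕ → L2} {a : ℕ → ℝ}
    (hu : ∀ m ∈ s, ∀ᵐ x, |u m x| ≤ a m) : ∀ᵐ x, |(∑ m ∈ s, u m) x| ≤ ∑ m ∈ s, a m := by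
  induction s using Finset.induction_on with
  | empty =>
    filter_upwards [Lp.coeFn_zero ℝ 2 (volume : Measure ℝ)] with x hx
    simp
  | insert m s hm ih =>
    rw [Finset.sum_insert hm, Finset.sum_insert hm]
    exact ae_abs_add_le (hu m (Finset.mem_insert_self _ _))
      (ih fun k hk => hu k (Finset.mem_insert_of_mem hk))

lemma ae_abs_mean_le_of_ae_abs_le {η a : ℝ} (hη : 0 < η) {u : L2} (hu : ∀ᵐ x, |u x| ≤ a) :
    ∀ᵐ x, |mean η u x| ≤ a := by
  filter_upwards [coeFn_mean hη u] with x hx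
  rw [hx]
  exact abs_avg_le_of_abs_le hη hu x

lemma coeFn_mean_toLp {η : ℝ} (hη : 0 < η) {f : ℝ → ℝ} (hf : MemLp f 2 volume) :
    mean η (hf.toLp f) =ᵐ[volume] avg η f := by
  rw [← avg_congr_ae hf.coeFn_toLp]
  exact coeFn_mean hη _

variable {M : ℕ} {α β γ : ℕ → ℝ} {Ψ : ℕ → ℝ → ℝ} {ε τ : ℝ}

lemma soundSpeedSq_pos (hM : 1 ≤ M) (hα : ∀ m ∈ Finset.Icc 1 M, 0 < α m) :
    0 < soundSpeedSq M α :=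
  Finset.sum_pos (fun m hm => by
    have := hα m hm
    have := pos_of_mem_Icc hm
    positivity) ⟨1, by simpa using hM⟩

lemma sq_smul_dispOp (hε : ε ≠ 0) (u : L2) : ε ^ 2 • dispOp M α ε u =
    (soundSpeedSq M α + ε ^ 2) • u -
      ∑ m ∈ Finset.Icc 1 M, (α m * (m : ℝ) ^ 2) • mean (m * ε) (mean (m * ε) u) := by
  rw [dispOp_apply, smul_add, Finset.smul_sum, add_smul, soundSpeedSq, Finset.sum_smul,
    add_sub_right_comm, ← Finset.sum_sub_distrib, add_comm]
  congr 1
  refine Finset.sum_congr rfl fun m _ => ?_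
  rw [smul_smul, ← smul_sub]
  congr 1
  field_simp

/-- Sup bounds are controlled by the operator `B_ε`. -/
lemma ae_abs_le_of_dispOp (hM : 1 ≤ M) (hα : ∀ m ∈ Finset.Icc 1 M, 0 < α m) (hε : 0 < ε)
    {u : L2} {a b : ℝ} (ha : ‖dispOp M α ε u‖ ≤ a)
    (hb : ∀ᵐ x, |dispOp M α ε u x| ≤ b) :
    ∀ᵐ x, |u x| ≤ (1 + √(32 / (α M * (M : ℝ) ^ 2))) * a + ε ^ 2 * b / soundSpeedSq M α := by
  have hc := soundSpeedSq_pos hM hα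
  set K := √(32 / (α M * (M : ℝ) ^ 2)) with hK
  have hK0 : 0 ≤ K := Real.sqrt_nonneg _
  have h1 : ∀ m ∈ Finset.Icc 1 M, ∀ᵐ x,
      |((α m * (m : ℝ) ^ 2) • mean (m * ε) (mean (m * ε) u)) x| ≤
        α m * (m : ℝ) ^ 2 * ((1 + K) * a) := by
    intro m hm
    have hm0 := pos_of_mem_Icc hm
    have hm1 : (1 : ℝ) ≤ m := by exact_mod_cast (Finset.mem_Icc.1 hm).1
    have hmM : (m : ℝ) ≤ M := by exact_mod_cast (Finset.mem_Icc.1 hm).2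
    have hαm := hα m hm
    have hη : 0 < m * ε := by positivity
    rw [← abs_of_nonneg (by positivity : 0 ≤ α m * (m : ℝ) ^ 2)]
    refine ae_abs_smul_le (c := |α m * (m : ℝ) ^ 2|) ?_ |>.mono fun x hx => by
      simpa using hx
    refine ae_abs_mean_le_of_ae_abs_le hη ?_
    filter_upwards [coeFn_mean hη u] with x hx
    rw [hx]
    refine (abs_avg_le hη u x).trans ?_
    have h2 := norm_le_norm_dispOp (ε := ε) hα u
    have h3 := norm_shift_sub_le_dispOp hM hα hε u (s := m * ε)
      (by rw [abs_of_pos hη]; gcongr)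
    have h4 : ‖shift (m * ε) u - u‖ / (m * ε) ≤ K * a := by
      rw [div_le_iff₀ hη]
      refine h3.trans ?_
      have h5 : K * ε * ‖dispOp M α ε u‖ ≤ K * ε * a := by gcongr
      have h6 : 0 ≤ K * ε * a := by
        have := (norm_nonneg _).trans ha
        positivity
      have h7 : K * ε * a ≤ m * (K * ε * a) := le_mul_of_one_le_left h6 hm1
      linarith
    linarith
  -- By `sq_smul_dispOp`, (c₀² + ε²)u is ε² B_ε u plus averages of u. The averages are bounded by
  -- the Sobolev inequality, and B_ε u enters with a factor ε², so its sup norm need not be small.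
  have h2 := ae_abs_add_le (ae_abs_smul_le (c := ε ^ 2) hb) (ae_abs_sum_le h1)
  rw [sq_smul_dispOp hε.ne', sub_add_cancel, ← Finset.sum_mul, ← soundSpeedSq] at h2
  filter_upwards [h2, Lp.coeFn_smul (soundSpeedSq M α + ε ^ 2) u] with x h3 h4
  rw [h4, Pi.smul_apply, smul_eq_mul, abs_mul, abs_of_pos (by positivity : 0 < _ + ε ^ 2),
    abs_of_pos (by positivity : 0 < ε ^ 2)] at h3
  have h5 : soundSpeedSq M α * |u x| ≤ soundSpeedSq M α * ((1 + K) * a) + ε ^ 2 * b := by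
    have h8 : 0 ≤ ε ^ 2 * |u x| := by positivity
    linarith
  calc |u x| = soundSpeedSq M α * |u x| / soundSpeedSq M α := by field_simp
    _ ≤ (soundSpeedSq M α * ((1 + K) * a) + ε ^ 2 * b) / soundSpeedSq M α := by gcongr
    _ = _ := by field_simp

namespace Admissible

variable (h : Admissible M α β γ Ψ)

/-- Consistency: the solitary wave solves the rescaled equation up to `O(1)` in the sup norm. -/
lemma exists_ae_abs_residual_le : ∃ C : ℝ, 0 < C ∧ ∀ ε : ℝ, 0 < ε → ε ≤ 1 →
    M * ε ^ 2 * (waveHeight M α β + 1) ≤ 1 →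
      ∀ᵐ x, |(forceOp M β Ψ ε (h.memLp_kdvWave.toLp _) -
        dispOp M α ε (h.memLp_kdvWave.toLp _) : L2) x| ≤ C := by
  obtain ⟨D, hD0, hD⟩ := exists_second_deriv_bound h.one_le h.alpha_pos h.beta_pos
  set w := h.memLp_kdvWave.toLp (kdvWave M α β) with hw
  set B := waveHeight M α β with hB
  have hB0 : 0 < B := h.waveHeight_pos
  have hF0 : 0 ≤ ∑ m ∈ Finset.Icc 1 M,
      (β m * (m : ℝ) ^ 3 * (B + 1) + γ m * (m : ℝ) ^ 4 * (B + 1) ^ 2) * (B + 1) :=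
    Finset.sum_nonneg fun m hm => by
      have := h.beta_pos m hm
      have := h.gamma_nonneg hm
      positivity
  have hE0 : 0 ≤ ∑ m ∈ Finset.Icc 1 M, α m * (m : ℝ) ^ 4 * (2 * D) :=
    Finset.sum_nonneg fun m hm => by
      have := h.alpha_pos m hm
      positivity
  refine ⟨(∑ m ∈ Finset.Icc 1 M,
    (β m * (m : ℝ) ^ 3 * (B + 1) + γ m * (m : ℝ) ^ 4 * (B + 1) ^ 2) * (B + 1)) +
    (B + ∑ m ∈ Finset.Icc 1 M, α m * (m : ℝ) ^ 4 * (2 * D)), by positivity,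
    fun ε hε hε1 hεM => ?_⟩
  have hwB : ∀ᵐ x, |w x| ≤ B := by
    filter_upwards [h.memLp_kdvWave.coeFn_toLp] with x hx
    rw [hx]
    exact h.abs_kdvWave_le_waveHeight x
  have h0 : ‖w - w‖ ≤ 0 * √ε := by simp
  have hforce : ∀ᵐ x, |forceOp M β Ψ ε w x| ≤ ∑ m ∈ Finset.Icc 1 M,
      (β m * (m : ℝ) ^ 3 * (B + 1) + γ m * (m : ℝ) ^ 4 * (B + 1) ^ 2) * (B + 1) := by
    refine ae_abs_sum_le fun m hm => ?_
    have hm0 := pos_of_mem_Icc hm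
    have hβm := h.beta_pos m hm
    have hγm := h.gamma_nonneg hm
    refine ae_abs_mean_le_of_ae_abs_le (by positivity) ?_
    filter_upwards [h.coeFn_nem_scaledForce hε hεM zero_le_one hm h0,
      h.ae_abs_mean_le hε zero_le_one hm h0] with x h1 h2
    rw [h1]
    refine (abs_scaledForce_le' hε (h.contDiff m hm) (h.deriv_zero m hm) (h.bound m hm) hγm hβm
      (mul_sq_mul_le_one hm (by positivity) hεM) h2).trans ?_
    have h3 : ε ^ 2 ≤ 1 := pow_le_one₀ hε.le hε1
    exact mul_le_mul (add_le_add le_rfl (mul_le_of_le_one_right (by positivity) h3)) h2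
      (abs_nonneg _) (by positivity)
  have hdisp : ∀ᵐ x, |dispOp M α ε w x| ≤
      B + ∑ m ∈ Finset.Icc 1 M, α m * (m : ℝ) ^ 4 * (2 * D) := by
    rw [dispOp_apply]
    refine ae_abs_add_le hwB (ae_abs_sum_le fun m hm => ?_)
    have hm0 := pos_of_mem_Icc hm
    have hαm := h.alpha_pos m hm
    have hη : 0 < m * ε := by positivity
    have h1 : ∀ᵐ x, |(mean (m * ε) w - w : L2) x| ≤ (m * ε) ^ 2 * D := by
      filter_upwards [Lp.coeFn_sub (mean (m * ε) w) w, coeFn_mean_toLp hη h.memLp_kdvWave,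
        h.memLp_kdvWave.coeFn_toLp] with x h1 h2 h3
      rw [h1, Pi.sub_apply, h2, h3]
      exact hD _ hη x
    have h2 := ae_abs_smul_le (c := -(α m * (m : ℝ) ^ 2 / ε ^ 2))
      (ae_abs_add_le h1 (ae_abs_mean_le_of_ae_abs_le hη h1))
    have e : -(α m * (m : ℝ) ^ 2 / ε ^ 2) •
        (mean (m * ε) w - w + mean (m * ε) (mean (m * ε) w - w)) =
        (α m * (m : ℝ) ^ 2 / ε ^ 2) • (w - mean (m * ε) (mean (m * ε) w)) := by
      rw [map_sub]
      module
    rw [e, abs_neg, abs_of_nonneg (by positivity)] at h2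
    filter_upwards [h2] with x h3
    refine h3.trans (le_of_eq ?_)
    field_simp
    ring
  have h1 := ae_abs_add_le hforce (ae_abs_smul_le (c := -1) hdisp)
  rw [neg_one_smul, ← sub_eq_add_neg] at h1
  simpa using h1

/-- The nonlinearity maps `L²` differences to sup norm and `L²` differences. -/
lemma exists_forceOp_sub_le : ∃ K : ℝ, 0 < K ∧ ∀ ε : ℝ, 0 < ε → ε ≤ 1 →
    M * ε ^ 2 * (waveHeight M α β + 1) ≤ 1 → ∀ τ ≤ (1 : ℝ), ∀ u v : L2,
      ‖u - h.memLp_kdvWave.toLp _‖ ≤ τ * √ε → ‖v - h.memLp_kdvWave.toLp _‖ ≤ τ * √ε →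
        ‖forceOp M β Ψ ε u - forceOp M β Ψ ε v‖ ≤ K * ‖u - v‖ ∧
        ∀ᵐ x, |(forceOp M β Ψ ε u - forceOp M β Ψ ε v : L2) x| ≤ K * ‖u - v‖ / √ε := by
  set B := waveHeight M α β with hB
  have hB0 : 0 < B := h.waveHeight_pos
  set k : ℕ → ℝ := fun m => β m * (m : ℝ) ^ 3 * 2 + γ m * (m : ℝ) ^ 4 * (B + 1) ^ 2 +
    2 * β m * (m : ℝ) ^ 3 * B with hk
  have hk0 : ∀ m ∈ Finset.Icc 1 M, 0 ≤ k m := fun m hm => by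
    have := h.beta_pos m hm
    have := h.gamma_nonneg hm
    positivity
  have hK0 : 0 ≤ ∑ m ∈ Finset.Icc 1 M, k m := Finset.sum_nonneg hk0
  refine ⟨∑ m ∈ Finset.Icc 1 M, k m + 1, by positivity, fun ε hε hε1 hεM τ hτ u v hu hv => ?_⟩
  have hτ0 : 0 ≤ τ :=
    nonneg_of_mul_nonneg_left ((norm_nonneg _).trans hu) (by positivity)
  have hG : ∀ m ∈ Finset.Icc 1 M, ‖nem (scaledForce β Ψ ε m) (mean (m * ε) u) -
      nem (scaledForce β Ψ ε m) (mean (m * ε) v)‖ ≤ k m * ‖u - v‖ := by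
    intro m hm
    have hm0 := pos_of_mem_Icc hm
    have hβm := h.beta_pos m hm
    have hγm := h.gamma_nonneg hm
    have hbc : Continuous (avg (m * ε) (kdvWave M α β)) :=
      continuous_avg h.memLp_kdvWave.intervalIntegrable_two
    have hbB : ∀ x, |avg (m * ε) (kdvWave M α β) x| ≤ B :=
      abs_avg_le_of_abs_le (by positivity) (Eventually.of_forall h.abs_kdvWave_le_waveHeight)
    have h1 := h.norm_nem_sub_sub_le hε hεM hτ hm hu hv
    set g := nem (scaledForce β Ψ ε m) (mean (m * ε) u) -
      nem (scaledForce β Ψ ε m) (mean (m * ε) v)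
    have h2 : ‖(2 * β m * (m : ℝ) ^ 3) • mulOp (avg (m * ε) (kdvWave M α β))
        (mean (m * ε) (u - v))‖ ≤ 2 * β m * (m : ℝ) ^ 3 * (B * ‖u - v‖) := by
      rw [norm_smul, Real.norm_of_nonneg (by positivity)]
      gcongr
      refine (norm_mulOp_le hbc hbB _).trans ?_
      gcongr
      exact norm_mean_le _ _
    have h3 := norm_le_norm_sub_add g ((2 * β m * (m : ℝ) ^ 3) •
      mulOp (avg (m * ε) (kdvWave M α β)) (mean (m * ε) (u - v)))
    have h4 : (β m * (m : ℝ) ^ 3 * (2 * τ) + γ m * (m : ℝ) ^ 4 * (B + 1) ^ 2 * ε ^ 2) *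
        ‖u - v‖ ≤ (β m * (m : ℝ) ^ 3 * 2 + γ m * (m : ℝ) ^ 4 * (B + 1) ^ 2) * ‖u - v‖ := by
      have h5 : ε ^ 2 ≤ 1 := pow_le_one₀ hε.le hε1
      refine mul_le_mul_of_nonneg_right (add_le_add ?_
        (mul_le_of_le_one_right (by positivity) h5)) (norm_nonneg _)
      exact mul_le_mul_of_nonneg_left (by linarith) (by positivity)
    simp only [hk]
    linarith
  have e : forceOp M β Ψ ε u - forceOp M β Ψ ε v = ∑ m ∈ Finset.Icc 1 M, mean (m * ε)
      (nem (scaledForce β Ψ ε m) (mean (m * ε) u) -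
        nem (scaledForce β Ψ ε m) (mean (m * ε) v)) := by
    simp only [forceOp, ← Finset.sum_sub_distrib, map_sub]
  have hle : (∑ m ∈ Finset.Icc 1 M, k m) * ‖u - v‖ ≤
      (∑ m ∈ Finset.Icc 1 M, k m + 1) * ‖u - v‖ := by
    gcongr
    linarith
  rw [e]
  constructor
  · refine le_trans (norm_sum_le_of_le _ fun m hm => (norm_mean_le _ _).trans (hG m hm)) ?_
    rwa [← Finset.sum_mul]
  · have h1 := ae_abs_sum_le (s := Finset.Icc 1 M) (u := fun m => mean (m * ε)
      (nem (scaledForce β Ψ ε m) (mean (m * ε) u) -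
        nem (scaledForce β Ψ ε m) (mean (m * ε) v))) (a := fun m => k m * ‖u - v‖ / √ε)
      fun m hm => by
        have hm0 := pos_of_mem_Icc hm
        have hm1 : (1 : ℝ) ≤ m := by exact_mod_cast (Finset.mem_Icc.1 hm).1
        have hη : 0 < m * ε := by positivity
        filter_upwards [coeFn_mean hη (nem (scaledForce β Ψ ε m) (mean (m * ε) u) -
          nem (scaledForce β Ψ ε m) (mean (m * ε) v))] with x hx
        rw [hx]
        refine (abs_avg_coeFn_le hη _ x).trans ?_
        have := hk0 m hm
        gcongr
        · exact hG m hm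
        · exact le_mul_of_one_le_left hε.le hm1
    filter_upwards [h1] with x h2
    refine h2.trans ?_
    rw [← Finset.sum_div, ← Finset.sum_mul]
    gcongr

/-- Existence with error bounds in `L²(ℝ)` and in the sup norm, and local uniqueness. -/
theorem exists_unique_near : ∃ τ C : ℝ, 0 < τ ∧ τ ≤ 1 ∧ 0 < C ∧ ∀ᶠ ε : ℝ in 𝓝[>] 0,
    (∃ u : L2, reflect u = u ∧ ‖u - h.memLp_kdvWave.toLp _‖ ≤ C * ε ^ 2 ∧
      (∀ᵐ x, |(u - h.memLp_kdvWave.toLp _ : L2) x| ≤ C * ε ^ 2) ∧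
      ‖u - h.memLp_kdvWave.toLp _‖ ≤ τ * √ε ∧ dispOp M α ε u = forceOp M β Ψ ε u) ∧
    ∀ u v : L2, reflect u = u → reflect v = v → ‖u - h.memLp_kdvWave.toLp _‖ ≤ τ * √ε →
      ‖v - h.memLp_kdvWave.toLp _‖ ≤ τ * √ε → dispOp M α ε u = forceOp M β Ψ ε u →
      dispOp M α ε v = forceOp M β Ψ ε v → u = v := by
  obtain ⟨τ, C₁, hτ0, hτ1, hC₁, hex⟩ := h.exists_unique_L2
  obtain ⟨R, hR, hres⟩ := h.exists_norm_residual_le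
  obtain ⟨S, hS, hsup⟩ := h.exists_ae_abs_residual_le
  obtain ⟨K, hK, hforce⟩ := h.exists_forceOp_sub_le
  set w := h.memLp_kdvWave.toLp (kdvWave M α β) with hw
  have hc := soundSpeedSq_pos h.one_le h.alpha_pos
  set L := 1 + √(32 / (α M * (M : ℝ) ^ 2)) with hL
  have hL0 : 0 < L := by positivity
  refine ⟨τ, C₁ + (L * (K * C₁ + R) + (K * C₁ + S) / soundSpeedSq M α), hτ0, hτ1, by positivity, ?_⟩
  filter_upwards [hex, Ioc_mem_nhdsGT one_pos,
    eventually_mul_sq_le (M * (waveHeight M α β + 1)) one_pos] with ε hex h1 h2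
  obtain ⟨⟨u, hu, hu1, hu2, hsol⟩, huniq⟩ := hex
  refine ⟨⟨u, hu, hu1.trans ?_, ?_, hu2, hsol⟩, huniq⟩
  · gcongr
    exact le_add_of_nonneg_right (by positivity)
  have hε : 0 < ε := h1.1
  have hεM : M * ε ^ 2 * (waveHeight M α β + 1) ≤ 1 := by linarith
  have hww : ‖w - w‖ ≤ τ * √ε := by
    rw [sub_self, norm_zero]
    positivity
  obtain ⟨h3, h4⟩ := hforce ε hε h1.2 hεM τ hτ1 u w hu2 hww
  have h5 := hres ε hε hεM
  have h6 := hsup ε hε h1.2 hεM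
  have e : dispOp M α ε (u - w) = (forceOp M β Ψ ε u - forceOp M β Ψ ε w) +
      (forceOp M β Ψ ε w - dispOp M α ε w) := by
    rw [map_sub, hsol]
    abel
  have h7 : K * ‖u - w‖ ≤ K * (C₁ * ε ^ 2) := by gcongr
  have h8 : ‖dispOp M α ε (u - w)‖ ≤ (K * C₁ + R) * ε ^ 2 := by
    rw [e]
    refine (norm_add_le _ _).trans ?_
    linarith
  -- A bound O(1) is enough here, because `ae_abs_le_of_dispOp` multiplies it by ε²; the loss of
  -- ε^(-1/2) is harmless.
  have h9 : K * ‖u - w‖ / √ε ≤ K * C₁ := by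
    rw [div_le_iff₀ (Real.sqrt_pos.2 hε)]
    have h10 : ε ^ 2 ≤ √ε := by
      refine Real.le_sqrt_of_sq_le ?_
      rw [← pow_mul]
      exact pow_le_of_le_one hε.le h1.2 (by norm_num)
    have h11 : K * (C₁ * ε ^ 2) ≤ K * (C₁ * √ε) := by gcongr
    linarith
  have h10 : ∀ᵐ x, |dispOp M α ε (u - w) x| ≤ K * C₁ + S := by
    rw [e]
    filter_upwards [ae_abs_add_le h4 h6] with x hx
    linarith
  filter_upwards [ae_abs_le_of_dispOp h.one_le h.alpha_pos hε h8 h10] with x hx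
  refine hx.trans ?_
  rw [← hL]
  have h11 : 0 ≤ C₁ * ε ^ 2 := by positivity
  calc _ = (L * (K * C₁ + R) + (K * C₁ + S) / soundSpeedSq M α) * ε ^ 2 := by ring
    _ ≤ _ := by linarith

end Admissible

end AtomicChain

/-! ### Equivalence with the travelling wave equation -/

namespace AtomicChain

open scoped RealInnerProductSpace
open Filter Topology

variable {M : ℕ} {α β γ : ℕ → ℝ} {Ψ : ℕ → ℝ → ℝ} {ε τ : ℝ}

lemma coeFn_sum (s : Finset ℕ) (u : ℕ → L2) :
    ⇑(∑ m ∈ s, u m) =ᵐ[volume] fun x => ∑ m ∈ s, u m x := by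
  induction s using Finset.induction_on with
  | empty =>
    filter_upwards [Lp.coeFn_zero ℝ 2 (volume : Measure ℝ)] with x hx
    simp
  | insert m s hm ih =>
    filter_upwards [ih, Lp.coeFn_add (u m) (∑ k ∈ s, u k)] with x h1 h2
    rw [Finset.sum_insert hm, Finset.sum_insert hm, h2, Pi.add_apply, h1]

/-- The right-hand side of the travelling wave equation. -/
noncomputable def waveRhs (M : ℕ) (α β : ℕ → ℝ) (Ψ : ℕ → ℝ → ℝ) (ε : ℝ) (V : ℝ → ℝ) (x : ℝ) : ℝ :=
  ∑ m ∈ Finset.Icc 1 M, (m : ℝ) *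
    avg (m * ε) (fun y => deriv (potential α β Ψ m) (m * ε ^ 2 * avg (m * ε) V y)) x

lemma waveRhs_congr_ae {V W : ℝ → ℝ} (h : V =ᵐ[volume] W) :
    waveRhs M α β Ψ ε V = waveRhs M α β Ψ ε W := by
  funext x
  simp only [waveRhs, avg_congr_ae h]

lemma deriv_potential {m : ℕ} (hΨ : Differentiable ℝ (Ψ m)) (r : ℝ) :
    deriv (potential α β Ψ m) r = α m * r + β m * r ^ 2 + deriv (Ψ m) r := by
  have h : HasDerivAt (potential α β Ψ m)
      (1 / 2 * α m * (2 * r) + 1 / 3 * β m * (3 * r ^ 2) + deriv (Ψ m) r) r := by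
    have h2 : HasDerivAt (fun r : ℝ => r ^ 2) (2 * r) r := by simpa using hasDerivAt_pow 2 r
    have h3 : HasDerivAt (fun r : ℝ => r ^ 3) (3 * r ^ 2) r := by simpa using hasDerivAt_pow 3 r
    exact ((h2.const_mul _).add (h3.const_mul _)).add (hΨ r).hasDerivAt
  rw [h.deriv]
  ring

/-- The harmonic part has order ε² and will cancel against ε² c₀² to leading order; everything else
is collected at order ε⁴. -/
lemma mul_deriv_potential {m : ℕ} (hΨ : Differentiable ℝ (Ψ m)) (hε : ε ≠ 0) (y : ℝ) :
    m * deriv (potential α β Ψ m) (m * ε ^ 2 * y) =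
      ε ^ 2 * (α m * (m : ℝ) ^ 2) * y + ε ^ 4 * scaledForce β Ψ ε m y := by
  rw [deriv_potential hΨ, scaledForce]
  field_simp
  ring

lemma waveSpeed_sq (hM : 1 ≤ M) (hα : ∀ m ∈ Finset.Icc 1 M, 0 < α m) :
    waveSpeed M α ε ^ 2 = soundSpeedSq M α + ε ^ 2 := by
  have := soundSpeedSq_pos hM hα
  rw [waveSpeed, Real.sq_sqrt (by positivity)]

namespace Admissible

variable (h : Admissible M α β γ Ψ)

/-- An exact rearrangement, valid for every u in the ball and not only for solutions: the defect of
the original equation is ε⁴ times that of B_ε u = F_ε(u). -/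
lemma waveRhs_ae (hε : 0 < ε) (hεM : M * ε ^ 2 * (waveHeight M α β + 1) ≤ 1) (hτ : τ ≤ 1)
    {u : L2} (hu : ‖u - h.memLp_kdvWave.toLp _‖ ≤ τ * √ε) :
    waveRhs M α β Ψ ε u =ᵐ[volume] fun x =>
      ε ^ 2 * (soundSpeedSq M α + ε ^ 2) * u x -
        ε ^ 4 * (dispOp M α ε u - forceOp M β Ψ ε u : L2) x := by
  have h1 : ∀ᵐ x, ∀ m ∈ Finset.Icc 1 M, (m : ℝ) * avg (m * ε)
      (fun y => deriv (potential α β Ψ m) (m * ε ^ 2 * avg (m * ε) u y)) x =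
      (ε ^ 2 * (α m * (m : ℝ) ^ 2)) * mean (m * ε) (mean (m * ε) u) x +
      ε ^ 4 * mean (m * ε) (nem (scaledForce β Ψ ε m) (mean (m * ε) u)) x := by
    rw [Filter.eventually_all_finset]
    intro m hm
    have hm0 := pos_of_mem_Icc hm
    have hη : 0 < m * ε := by positivity
    filter_upwards [coeFn_mean hη (mean (m * ε) u),
      coeFn_mean hη (nem (scaledForce β Ψ ε m) (mean (m * ε) u))] with x e1 e2
    have hd : Differentiable ℝ (Ψ m) := (h.contDiff m hm).differentiable (by norm_num)
    have hn := h.coeFn_nem_scaledForce hε hεM hτ hm hu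
    rw [e1, e2, ← avg_const_mul, ← avg_const_mul, ← avg_const_mul,
      ← avg_add (fun a b => (intervalIntegrable_coeFn _ a b).const_mul _)
        (fun a b => (intervalIntegrable_coeFn _ a b).const_mul _)]
    refine congrFun (avg_congr_ae ?_) x
    filter_upwards [hn, coeFn_mean hη u] with y h3 h4
    rw [mul_deriv_potential hd hε.ne', h3, h4]
  have e : dispOp M α ε u - forceOp M β Ψ ε u =
      (ε ^ 2)⁻¹ • ((soundSpeedSq M α + ε ^ 2) • u -
        ∑ m ∈ Finset.Icc 1 M, (α m * (m : ℝ) ^ 2) • mean (m * ε) (mean (m * ε) u)) -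
      ∑ m ∈ Finset.Icc 1 M, mean (m * ε) (nem (scaledForce β Ψ ε m) (mean (m * ε) u)) := by
    rw [← sq_smul_dispOp hε.ne', smul_smul, inv_mul_cancel₀ (by positivity), one_smul, forceOp]
  have h2 : ∀ᵐ x, ∀ m ∈ Finset.Icc 1 M,
      ((α m * (m : ℝ) ^ 2) • mean (m * ε) (mean (m * ε) u) : L2) x =
        α m * (m : ℝ) ^ 2 * mean (m * ε) (mean (m * ε) u) x := by
    rw [Filter.eventually_all_finset]
    intro m _
    filter_upwards [Lp.coeFn_smul (α m * (m : ℝ) ^ 2) (mean (m * ε) (mean (m * ε) u))] with x hx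
    rw [hx, Pi.smul_apply, smul_eq_mul]
  rw [e]
  filter_upwards [h1, h2, Lp.coeFn_sub ((ε ^ 2)⁻¹ • ((soundSpeedSq M α + ε ^ 2) • u -
        ∑ m ∈ Finset.Icc 1 M, (α m * (m : ℝ) ^ 2) • mean (m * ε) (mean (m * ε) u)))
      (∑ m ∈ Finset.Icc 1 M, mean (m * ε) (nem (scaledForce β Ψ ε m) (mean (m * ε) u))),
    Lp.coeFn_smul (ε ^ 2)⁻¹ ((soundSpeedSq M α + ε ^ 2) • u -
        ∑ m ∈ Finset.Icc 1 M, (α m * (m : ℝ) ^ 2) • mean (m * ε) (mean (m * ε) u)),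
    Lp.coeFn_sub ((soundSpeedSq M α + ε ^ 2) • u)
      (∑ m ∈ Finset.Icc 1 M, (α m * (m : ℝ) ^ 2) • mean (m * ε) (mean (m * ε) u)),
    Lp.coeFn_smul (soundSpeedSq M α + ε ^ 2) u,
    coeFn_sum (Finset.Icc 1 M) fun m => (α m * (m : ℝ) ^ 2) • mean (m * ε) (mean (m * ε) u),
    coeFn_sum (Finset.Icc 1 M) fun m =>
      mean (m * ε) (nem (scaledForce β Ψ ε m) (mean (m * ε) u))]
    with x h3 h4 h5 h6 h7 h8 h9 h10
  rw [h5, Pi.sub_apply, h6, Pi.smul_apply, h7, Pi.sub_apply, h8, Pi.smul_apply, h9, h10,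
    Finset.sum_congr rfl h4, waveRhs, Finset.sum_congr rfl h3, Finset.sum_add_distrib,
    ← Finset.mul_sum]
  simp only [mul_assoc (ε ^ 2), ← Finset.mul_sum, smul_eq_mul]
  field_simp
  ring

/-- The travelling wave equation as an equation between elements of `L²(ℝ)`. -/
lemma solvesTravelingWave_iff (hε : 0 < ε) (hεM : M * ε ^ 2 * (waveHeight M α β + 1) ≤ 1)
    (hτ : τ ≤ 1) {V : ℝ → ℝ} {u : L2} (hV : V =ᵐ[volume] u)
    (hu : ‖u - h.memLp_kdvWave.toLp _‖ ≤ τ * √ε) :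
    SolvesTravelingWave M (potential α β Ψ) ε (waveSpeed M α ε) V ↔
      dispOp M α ε u = forceOp M β Ψ ε u := by
  have h1 := h.waveRhs_ae hε hεM hτ hu
  rw [← waveRhs_congr_ae hV] at h1
  have h2 : SolvesTravelingWave M (potential α β Ψ) ε (waveSpeed M α ε) V ↔
      ∀ᵐ x, ε ^ 2 * waveSpeed M α ε ^ 2 * V x = waveRhs M α β Ψ ε V x := Iff.rfl
  rw [h2, waveSpeed_sq h.one_le h.alpha_pos, ← sub_eq_zero, Lp.eq_zero_iff_ae_eq_zero]
  refine eventually_congr ?_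
  filter_upwards [h1, hV] with x h3 h4
  rw [h3, h4, Pi.zero_apply]
  constructor
  · intro h5
    have h6 : ε ^ 4 * (dispOp M α ε u - forceOp M β Ψ ε u : L2) x = 0 := by linarith
    exact (mul_eq_zero.1 h6).resolve_left (by positivity)
  · intro h5
    rw [h5]
    ring

lemma norm_sub_le_of_isWaveNear {C : ℝ} {V : ℝ → ℝ} (hC : 0 ≤ C)
    (hV : IsWaveNear M α β Ψ (kdvWave M α β) C ε V) :
    ‖hV.memLp.toLp V - h.memLp_kdvWave.toLp _‖ ≤ C * ε ^ 2 := by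
  rw [← MemLp.toLp_sub, Lp.norm_toLp]
  refine ENNReal.toReal_le_of_le_ofReal (by positivity) (le_trans ?_ hV.near)
  exact le_self_add

/-- The L² and the sup errors are each at most Cε², and their sum is to be bounded, whence 2C ≤ C'.
-/
lemma isWaveNear_of_solution (hε : 0 < ε) (hεM : M * ε ^ 2 * (waveHeight M α β + 1) ≤ 1)
    (hτ : τ ≤ 1) {C C' : ℝ} (hC : 0 ≤ C) (hCC : 2 * C ≤ C') {u : L2} {W : ℝ → ℝ}
    (hW : W =ᵐ[volume] u) (hr : reflect u = u)
    (hu : ‖u - h.memLp_kdvWave.toLp _‖ ≤ C * ε ^ 2)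
    (hsup : ∀ᵐ x, |(u - h.memLp_kdvWave.toLp _ : L2) x| ≤ C * ε ^ 2)
    (hτu : ‖u - h.memLp_kdvWave.toLp _‖ ≤ τ * √ε) (hs : dispOp M α ε u = forceOp M β Ψ ε u) :
    IsWaveNear M α β Ψ (kdvWave M α β) C' ε W := by
  have hm : MemLp W 2 volume := (memLp_congr_ae hW).2 (Lp.memLp u)
  have hd : W - kdvWave M α β =ᵐ[volume] (u - h.memLp_kdvWave.toLp _ : L2) := by
    filter_upwards [hW, Lp.coeFn_sub u (h.memLp_kdvWave.toLp _), h.memLp_kdvWave.coeFn_toLp]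
      with x h1 h2 h3
    rw [h2, Pi.sub_apply, Pi.sub_apply, h1, h3]
  refine ⟨hm, ?_, (h.solvesTravelingWave_iff hε hεM hτ hW hτu).2 hs, ?_⟩
  · have h1 := coeFn_reflect u
    rw [hr] at h1
    filter_upwards [h1, hW, ae_comp_neg hW] with x h2 h3 h4
    rw [h3, h4, h2]
  · rw [eLpNorm_congr_ae hd, eLpNorm_congr_ae hd, eLpNorm_exponent_top, ← Lp.enorm_def]
    have h1 : ‖u - h.memLp_kdvWave.toLp _‖ₑ ≤ ENNReal.ofReal (C * ε ^ 2) := by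
      rw [← ofReal_norm]
      exact ENNReal.ofReal_le_ofReal hu
    have h2 := eLpNormEssSup_le_of_ae_bound (f := (u - h.memLp_kdvWave.toLp _ : L2))
      (hsup.mono fun x hx => by rwa [Real.norm_eq_abs])
    refine (add_le_add h1 h2).trans ?_
    rw [← ENNReal.ofReal_add (by positivity) (by positivity)]
    refine ENNReal.ofReal_le_ofReal ?_
    have := mul_le_mul_of_nonneg_right hCC (sq_nonneg ε)
    linarith

end Admissible

end AtomicChain

/-! ### Smoothness and nonnegativity -/

namespace AtomicChain

open scoped RealInnerProductSpace
open Filter Topology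

/-- An average is a difference of translates of a primitive, so one derivative is gained. -/
lemma contDiff_avg {η : ℝ} {f : ℝ → ℝ} {n : ℕ} (hf : ContDiff ℝ n f) :
    ContDiff ℝ (n + 1) (avg η f) := by
  have hc : Continuous f := hf.continuous
  have hi : ∀ a b, IntervalIntegrable f volume a b := fun a b => hc.intervalIntegrable a b
  have hF : ContDiff ℝ (n + 1) fun x => ∫ t in (0)..x, f t := by
    have hd : ∀ x, HasDerivAt (fun x => ∫ t in (0)..x, f t) (f x) x := fun x =>
      intervalIntegral.integral_hasDerivAt_right (hi _ _)
        (hc.stronglyMeasurableAtFilter _ _) hc.continuousAt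
    refine contDiff_succ_iff_deriv.2 ⟨fun x => (hd x).differentiableAt, by simp, ?_⟩
    rwa [show deriv (fun x => ∫ t in (0)..x, f t) = f from funext fun x => (hd x).deriv]
  have e : avg η f = fun x => 1 / η * ((∫ t in (0)..(x + η / 2), f t) -
      ∫ t in (0)..(x - η / 2), f t) := by
    funext x
    rw [avg, intervalIntegral.integral_interval_sub_left (hi _ _) (hi _ _)]
  rw [e]
  exact contDiff_const.mul ((hF.comp (contDiff_id.add contDiff_const)).sub
    (hF.comp (contDiff_id.sub contDiff_const)))

variable {M : ℕ} {α β γ : ℕ → ℝ} {Ψ : ℕ → ℝ → ℝ} {ε τ : ℝ}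

lemma contDiff_deriv_potential {m n : ℕ} (hΨ : ContDiff ℝ (n + 1) (Ψ m)) :
    ContDiff ℝ n (deriv (potential α β Ψ m)) := by
  have h1 : ContDiff ℝ (n + 1) (potential α β Ψ m) := by
    unfold potential
    fun_prop
  exact (contDiff_succ_iff_deriv.1 h1).2.2

lemma continuous_waveRhs (hΨ : ∀ m ∈ Finset.Icc 1 M, ContDiff ℝ 2 (Ψ m)) {V : ℝ → ℝ}
    (hV : ∀ a b, IntervalIntegrable V volume a b) : Continuous (waveRhs M α β Ψ ε V) := by
  refine continuous_finsetSum _ fun m hm => continuous_const.mul ?_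
  have h1 : Continuous (deriv (potential α β Ψ m)) :=
    (contDiff_deriv_potential (n := 1) (by simpa [one_add_one_eq_two] using hΨ m hm)).continuous
  have h2 : Continuous (avg (m * ε) V) := continuous_avg hV
  exact continuous_avg fun a b => (h1.comp (continuous_const.mul h2)).intervalIntegrable a b

/-- A continuous solution of the travelling wave equation is as smooth as the potentials. -/
lemma contDiff_of_eq_waveRhs {c : ℝ} {W : ℝ → ℝ} (hc : Continuous W)
    (hW : ∀ x, W x = c * waveRhs M α β Ψ ε W x) (n : ℕ)
    (hΨ : ∀ m ∈ Finset.Icc 1 M, ContDiff ℝ n (Ψ m)) : ContDiff ℝ n W := by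
  induction n with
  | zero => exact contDiff_zero.2 hc
  | succ n ih =>
    have hn : ContDiff ℝ n W := ih fun m hm => (hΨ m hm).of_le (by simp)
    -- Bootstrap: Φ_m' has lost one derivative and the integrand is of class n; the outer average
    -- restores n + 1.
    rw [funext hW]
    refine contDiff_const.mul (ContDiff.sum fun m hm => contDiff_const.mul ?_)
    have h1 : ContDiff ℝ n (deriv (potential α β Ψ m)) :=
      contDiff_deriv_potential (by simpa using hΨ m hm)
    have h2 : ContDiff ℝ n (avg (m * ε) W) := (contDiff_avg hn).of_le (by simp)
    have h3 : ContDiff ℝ n fun y => deriv (potential α β Ψ m) (m * ε ^ 2 * avg (m * ε) W y) :=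
      h1.comp (contDiff_const.mul h2)
    push_cast
    exact contDiff_avg h3

lemma mean_mono {η : ℝ} (hη : 0 < η) {u v : L2} (h : u ≤ᵐ[volume] v) :
    mean η u ≤ᵐ[volume] mean η v := by
  filter_upwards [coeFn_mean hη u, coeFn_mean hη v] with x h1 h2
  rw [h1, h2]
  exact avg_mono hη (intervalIntegrable_coeFn u) (intervalIntegrable_coeFn v) h x

lemma mean_nonneg {η : ℝ} (hη : 0 < η) {u : L2} (h : ∀ᵐ x, 0 ≤ u x) : ∀ᵐ x, 0 ≤ mean η u x := by
  have h0 : (0 : L2) ≤ᵐ[volume] u := by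
    filter_upwards [h, Lp.coeFn_zero ℝ 2 (volume : Measure ℝ)] with x h1 h2
    rwa [h2]
  have h1 := mean_mono hη h0
  rw [map_zero] at h1
  filter_upwards [h1, Lp.coeFn_zero ℝ 2 (volume : Measure ℝ)] with x h2 h3
  rw [h3] at h2
  exact h2

/-- The operator `B_ε` has a positive inverse. -/
lemma ae_nonneg_of_dispOp (hα : ∀ m ∈ Finset.Icc 1 M, 0 < α m) (hε : 0 < ε) {u : L2}
    (h : ∀ᵐ x, 0 ≤ dispOp M α ε u x) : ∀ᵐ x, 0 ≤ u x := by
  have hm : MemLp (fun x => max (-u x) 0) 2 volume := (Lp.memLp u).neg.pos_part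
  set p : L2 := hm.toLp _ with hp
  have hpx : p =ᵐ[volume] fun x => max (-u x) 0 := hm.coeFn_toLp
  set Su := ∑ m ∈ Finset.Icc 1 M, (α m * (m : ℝ) ^ 2) • mean (m * ε) (mean (m * ε) u) with hSu
  set Sp := ∑ m ∈ Finset.Icc 1 M, (α m * (m : ℝ) ^ 2) • mean (m * ε) (mean (m * ε) p) with hSp
  have hc : 0 ≤ soundSpeedSq M α := Finset.sum_nonneg fun m hm => by
    have := hα m hm
    positivity
  have h0 : ∀ᵐ x, ∀ m ∈ Finset.Icc 1 M, 0 ≤ mean (m * ε) (mean (m * ε) p) x ∧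
      -mean (m * ε) (mean (m * ε) u) x ≤ mean (m * ε) (mean (m * ε) p) x := by
    rw [Filter.eventually_all_finset]
    intro m hm
    have hm0 := pos_of_mem_Icc hm
    have hη : 0 < m * ε := by positivity
    have h1 : ∀ᵐ x, 0 ≤ p x := by
      filter_upwards [hpx] with x hx
      rw [hx]
      exact le_max_right _ _
    have h2 : (-u : L2) ≤ᵐ[volume] p := by
      filter_upwards [hpx, Lp.coeFn_neg u] with x hx h3
      rw [hx, h3]
      exact le_max_left _ _
    have h3 := mean_mono hη (mean_mono hη h2)
    rw [map_neg, map_neg] at h3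
    filter_upwards [mean_nonneg hη (mean_nonneg hη h1), h3,
      Lp.coeFn_neg (mean (m * ε) (mean (m * ε) u))] with x h4 h5 h6
    rw [h6] at h5
    exact ⟨h4, h5⟩
  have hsum : ∀ v : L2, ∀ᵐ x, (∑ m ∈ Finset.Icc 1 M,
      (α m * (m : ℝ) ^ 2) • mean (m * ε) (mean (m * ε) v) : L2) x =
      ∑ m ∈ Finset.Icc 1 M, α m * (m : ℝ) ^ 2 * mean (m * ε) (mean (m * ε) v) x := fun v => by
    have h1 : ∀ᵐ x, ∀ m ∈ Finset.Icc 1 M,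
        ((α m * (m : ℝ) ^ 2) • mean (m * ε) (mean (m * ε) v) : L2) x =
          α m * (m : ℝ) ^ 2 * mean (m * ε) (mean (m * ε) v) x := by
      rw [Filter.eventually_all_finset]
      intro m _
      filter_upwards [Lp.coeFn_smul (α m * (m : ℝ) ^ 2) (mean (m * ε) (mean (m * ε) v))] with x hx
      rw [hx, Pi.smul_apply, smul_eq_mul]
    filter_upwards [h1, coeFn_sum (Finset.Icc 1 M) fun m =>
      (α m * (m : ℝ) ^ 2) • mean (m * ε) (mean (m * ε) v)] with x h2 h3
    rw [h3, Finset.sum_congr rfl h2]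
  -- For the negative part p of u: where u < 0, the sign of B_ε u gives (c₀² + ε²)(-u) ≤ -Su ≤ Sp,
  -- and elsewhere p = 0 ≤ Sp. As ‖Sp‖ ≤ c₀²‖p‖, the surplus ε² forces p = 0.
  have hkey : ∀ᵐ x, |((soundSpeedSq M α + ε ^ 2) • p : L2) x| ≤ 1 * |Sp x| := by
    have e := sq_smul_dispOp (M := M) (α := α) hε.ne' u
    filter_upwards [h0, h, hsum u, hsum p, hpx, Lp.coeFn_smul (soundSpeedSq M α + ε ^ 2) p,
      Lp.coeFn_smul (ε ^ 2) (dispOp M α ε u), Lp.coeFn_smul (soundSpeedSq M α + ε ^ 2) u,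
      Lp.coeFn_sub ((soundSpeedSq M α + ε ^ 2) • u) Su] with x e1 e2 e3 e4 e5 e6 e7 e8 e9
    rw [e, e9, Pi.sub_apply, e8, Pi.smul_apply, Pi.smul_apply, e3, smul_eq_mul, smul_eq_mul] at e7
    rw [e6, Pi.smul_apply, e5, smul_eq_mul, one_mul, e4]
    have h1 : 0 ≤ ∑ m ∈ Finset.Icc 1 M, α m * (m : ℝ) ^ 2 * mean (m * ε) (mean (m * ε) p) x :=
      Finset.sum_nonneg fun m hm => by
        have := hα m hm
        have := (e1 m hm).1
        positivity
    have h2 : -∑ m ∈ Finset.Icc 1 M, α m * (m : ℝ) ^ 2 * mean (m * ε) (mean (m * ε) u) x ≤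
        ∑ m ∈ Finset.Icc 1 M, α m * (m : ℝ) ^ 2 * mean (m * ε) (mean (m * ε) p) x := by
      rw [← Finset.sum_neg_distrib]
      refine Finset.sum_le_sum fun m hm => ?_
      have := hα m hm
      rw [← mul_neg]
      exact mul_le_mul_of_nonneg_left (e1 m hm).2 (by positivity)
    rw [abs_of_nonneg h1, abs_of_nonneg (by positivity)]
    rcases max_cases (-u x) 0 with ⟨h3, -⟩ | ⟨h3, -⟩
    · rw [h3]
      have h4 : 0 ≤ ε ^ 2 * dispOp M α ε u x := by positivity
      linarith
    · rw [h3, mul_zero]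
      exact h1
  have hn := norm_le_mul_norm_of_ae_le hkey
  have hSpn : ‖Sp‖ ≤ soundSpeedSq M α * ‖p‖ := by
    rw [soundSpeedSq, Finset.sum_mul]
    refine norm_sum_le_of_le _ fun m hm => ?_
    have := hα m hm
    rw [norm_smul, Real.norm_of_nonneg (by positivity)]
    gcongr
    exact (norm_mean_le _ _).trans (norm_mean_le _ _)
  rw [norm_smul, Real.norm_of_nonneg (by positivity)] at hn
  have hp0 : ε ^ 2 * ‖p‖ ≤ 0 := by linarith
  have hp1 : ‖p‖ ≤ 0 := by
    by_contra! h1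
    have : 0 < ε ^ 2 * ‖p‖ := by positivity
    linarith
  have hp2 : p = 0 := norm_le_zero_iff.1 hp1
  rw [hp2] at hpx
  filter_upwards [hpx, Lp.coeFn_zero ℝ 2 (volume : Measure ℝ)] with x h1 h2
  rw [h2, Pi.zero_apply] at h1
  have := le_max_left (-u x) 0
  linarith

namespace Admissible

variable (h : Admissible M α β γ Ψ)

lemma ae_nonneg_forceOp (hε : 0 < ε) (hεM : M * ε ^ 2 * (waveHeight M α β + 1) ≤ 1)
    (hβγ : ∀ m ∈ Finset.Icc 1 M, γ m * m * (waveHeight M α β + 1) * ε ^ 2 ≤ β m) (hτ : τ ≤ 1)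
    {u : L2} (hu : ‖u - h.memLp_kdvWave.toLp _‖ ≤ τ * √ε) :
    ∀ᵐ x, 0 ≤ forceOp M β Ψ ε u x := by
  have hΛ : 0 ≤ waveHeight M α β + 1 := by linarith [h.waveHeight_pos]
  have h1 : ∀ᵐ x, ∀ m ∈ Finset.Icc 1 M,
      0 ≤ mean (m * ε) (nem (scaledForce β Ψ ε m) (mean (m * ε) u)) x := by
    rw [Filter.eventually_all_finset]
    intro m hm
    have hm0 := pos_of_mem_Icc hm
    refine mean_nonneg (by positivity) ?_
    filter_upwards [h.coeFn_nem_scaledForce hε hεM hτ hm hu, h.ae_abs_mean_le hε hτ hm hu]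
      with x e1 e2
    rw [e1]
    exact scaledForce_nonneg hε (h.contDiff m hm) (h.deriv_zero m hm) (h.bound m hm)
      (h.gamma_nonneg hm) (mul_sq_mul_le_one hm hΛ hεM) e2 (hβγ m hm)
  filter_upwards [h1, coeFn_sum (Finset.Icc 1 M) fun m =>
    mean (m * ε) (nem (scaledForce β Ψ ε m) (mean (m * ε) u))] with x h2 h3
  rw [forceOp, h3]
  exact Finset.sum_nonneg h2

/-- A solution in `L²(ℝ)` has a nonnegative representative that is as smooth as the potentials. -/
lemma exists_smooth_representative (hε : 0 < ε)
    (hεM : M * ε ^ 2 * (waveHeight M α β + 1) ≤ 1)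
    (hβγ : ∀ m ∈ Finset.Icc 1 M, γ m * m * (waveHeight M α β + 1) * ε ^ 2 ≤ β m) (hτ : τ ≤ 1)
    {u : L2} (hu : ‖u - h.memLp_kdvWave.toLp _‖ ≤ τ * √ε)
    (hs : dispOp M α ε u = forceOp M β Ψ ε u) :
    ∃ W : ℝ → ℝ, W =ᵐ[volume] u ∧ (∀ x, 0 ≤ W x) ∧ ContDiff ℝ 2 W ∧
      ∀ k : ℕ∞, (∀ m ∈ Finset.Icc 1 M, ContDiff ℝ k (Ψ m)) → ContDiff ℝ k W := by
  have hc := soundSpeedSq_pos h.one_le h.alpha_pos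
  set c := (ε ^ 2 * (soundSpeedSq M α + ε ^ 2))⁻¹ with hcdef
  -- The right-hand side depends only on the class of u and is continuous, so it selects the
  -- representative for which the equation holds everywhere.
  set W : ℝ → ℝ := fun x => c * waveRhs M α β Ψ ε u x with hW
  have hWu : W =ᵐ[volume] u := by
    filter_upwards [h.waveRhs_ae hε hεM hτ hu, Lp.coeFn_zero ℝ 2 (volume : Measure ℝ)] with x h1 h2
    rw [hW]
    simp only
    rw [h1, hs, sub_self, h2, Pi.zero_apply, mul_zero, sub_zero, ← mul_assoc, hcdef,
      inv_mul_cancel₀ (by positivity), one_mul]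
  have hWc : Continuous W :=
    continuous_const.mul (continuous_waveRhs h.contDiff (intervalIntegrable_coeFn u))
  have hWe : ∀ x, W x = c * waveRhs M α β Ψ ε W x := fun x => by
    rw [waveRhs_congr_ae hWu]
  have hsm := contDiff_of_eq_waveRhs hWc hWe
  refine ⟨W, hWu, ?_, hsm 2 h.contDiff, fun k hk => ?_⟩
  · have hf := h.ae_nonneg_forceOp hε hεM hβγ hτ hu
    rw [← hs] at hf
    have h1 : (fun x => max (W x) 0) =ᵐ[volume] W := by
      filter_upwards [ae_nonneg_of_dispOp h.alpha_pos hε hf, hWu] with x h2 h3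
      rw [max_eq_left]
      rwa [h3]
    have h2 := (hWc.max continuous_const).ae_eq_iff_eq volume hWc |>.1 h1
    intro x
    rw [← h2]
    exact le_max_right _ _
  · rw [contDiff_iff_forall_nat_le]
    exact fun n hn => hsm n fun m hm => (hk m hm).of_le (by exact_mod_cast hn)

end Admissible

end AtomicChain

/-! ### Uniqueness of the KdV wave and the conclusion -/

namespace AtomicChain

open Filter Topology

variable {M : ℕ} {α β γ : ℕ → ℝ} {Ψ : ℕ → ℝ → ℝ}

lemma isKdVWave_kdvWave (hM : 1 ≤ M) (hα : ∀ m ∈ Finset.Icc 1 M, 0 < α m)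
    (hβ : ∀ m ∈ Finset.Icc 1 M, 0 < β m) : IsKdVWave M α β (kdvWave M α β) where
  contDiff := contDiff_const.mul (contDiff_sechSq _)
  ode x := by
    have h1 : deriv (kdvWave M α β) = kdvWaveDeriv M α β := funext fun x =>
      (hasDerivAt_kdvWave M α β x).deriv
    rw [h1]
    exact (hasDerivAt_kdvWaveDeriv hM hα hβ x).deriv
  memLp := (exists_hasL2Derivs_kdvWave hM hα hβ).choose
  even := kdvWave_neg M α β
  nontrivial := by
    refine ⟨0, ?_⟩
    have h1 := dOne_pos hM hα
    have h2 := dTwo_pos hM hα hβ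
    rw [kdvWave, sechSq_zero]
    positivity

namespace IsKdVWave

variable {V : ℝ → ℝ}

lemma hasDerivAt (h : IsKdVWave M α β V) (x : ℝ) : HasDerivAt V (deriv V x) x :=
  (h.contDiff.differentiable (by norm_num) x).hasDerivAt

lemma hasDerivAt_deriv (h : IsKdVWave M α β V) (x : ℝ) :
    HasDerivAt (deriv V) (dOne M α * V x - dTwo M α β * V x ^ 2) x := by
  have h1 : ContDiff ℝ (1 + 1) V := by simpa [one_add_one_eq_two] using h.contDiff
  have h2 : ContDiff ℝ 1 (deriv V) := (contDiff_succ_iff_deriv.1 h1).2.2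
  rw [← h.ode]
  exact (h2.differentiable (by norm_num) x).hasDerivAt

lemma deriv_zero (h : IsKdVWave M α β V) : deriv V 0 = 0 := by
  have h1 : HasDerivAt (fun x => V (-x)) (-deriv V 0) 0 := by
    have h2 : HasDerivAt V (deriv V 0) (-0) := by simpa using h.hasDerivAt 0
    simpa [Function.comp_def] using h2.comp 0 (hasDerivAt_neg 0)
  rw [funext h.even] at h1
  have h3 := h1.deriv
  linarith

/-- The difference of two waves solves a linear equation with coefficient d₁ - d₂(V + W), and
evenness makes both slopes at 0 vanish. -/
lemma eq_of_apply_zero_eq {W : ℝ → ℝ} (h : IsKdVWave M α β V) (hW : IsKdVWave M α β W)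
    (h0 : V 0 = W 0) : V = W := by
  have hcV := h.contDiff.continuous
  have hcW := hW.contDiff.continuous
  have key : ∀ x, 0 ≤ x → V x = W x := fun x hx => by
    have := eq_zero_of_linear_ode (D := fun x => V x - W x) (D1 := fun x => deriv V x - deriv W x)
      (c := fun x => dOne M α - dTwo M α β * (V x + W x))
      (fun x => (h.hasDerivAt x).sub (hW.hasDerivAt x))
      (fun x => ((h.hasDerivAt_deriv x).sub (hW.hasDerivAt_deriv x)).congr_deriv (by ring))
      (by fun_prop) (by rw [h0, sub_self]) (by rw [h.deriv_zero, hW.deriv_zero, sub_self]) hx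
    exact sub_eq_zero.1 this
  funext x
  rcases le_total 0 x with hx | hx
  · exact key x hx
  · rw [← h.even, ← hW.even]
    exact key _ (by linarith)

lemma apply_zero (h : IsKdVWave M α β V) (hd : 0 < dTwo M α β) :
    V 0 = 3 * dOne M α / (2 * dTwo M α β) := by
  refine (apply_zero_of_ode hd h.hasDerivAt h.hasDerivAt_deriv h.memLp h.deriv_zero).resolve_left
    fun h0 => ?_
  have hc := h.contDiff.continuous
  have key : ∀ x, 0 ≤ x → V x = 0 := fun x hx =>
    eq_zero_of_linear_ode (c := fun x => dOne M α - dTwo M α β * V x) h.hasDerivAt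
      (fun x => (h.hasDerivAt_deriv x).congr_deriv (by ring)) (by fun_prop) h0 h.deriv_zero hx
  obtain ⟨x, hx⟩ := h.nontrivial
  refine hx ?_
  rcases le_total 0 x with h1 | h1
  · exact key x h1
  · rw [← h.even]
    exact key _ (by linarith)

end IsKdVWave

end AtomicChain

theorem corollary3p6 (M : ℕ) (hM : 1 ≤ M) (α β γ : ℕ → ℝ) (Ψ : ℕ → ℝ → ℝ)
    (hα : ∀ m ∈ Finset.Icc 1 M, 0 < α m)
    (hβ : ∀ m ∈ Finset.Icc 1 M, 0 < β m)
    (hΨ : ∀ m ∈ Finset.Icc 1 M, ContDiff ℝ 2 (Ψ m))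
    (hΨ0 : ∀ m ∈ Finset.Icc 1 M, deriv (Ψ m) 0 = 0)
    (hγ : ∀ m ∈ Finset.Icc 1 M, ∀ r : ℝ, |r| ≤ 1 →
      |deriv (deriv (Ψ m)) r| ≤ γ m * r ^ 2) :
    ∃ W₀ : ℝ → ℝ,
      (AtomicChain.IsKdVWave M α β W₀ ∧ ∀ V, AtomicChain.IsKdVWave M α β V → V = W₀) ∧
      ∃ C₀ : ℝ, 0 < C₀ ∧ ∀ C : ℝ, C₀ ≤ C → ∃ ε₀ : ℝ, 0 < ε₀ ∧ ∀ ε : ℝ, 0 < ε → ε ≤ ε₀ →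
        ∃ W : ℝ → ℝ,
          AtomicChain.IsWaveNear M α β Ψ W₀ C ε W ∧
          (∀ V : ℝ → ℝ, AtomicChain.IsWaveNear M α β Ψ W₀ C ε V → V =ᵐ[MeasureTheory.volume] W) ∧
          (∀ x, 0 ≤ W x) ∧
          ContDiff ℝ 2 W ∧
          (∀ k : ℕ∞, (∀ m ∈ Finset.Icc 1 M, ContDiff ℝ k (Ψ m)) → ContDiff ℝ k W) := by
  have h : AtomicChain.Admissible M α β γ Ψ := ⟨hM, hα, hβ, hΨ, hΨ0, hγ⟩
  have hd2 := AtomicChain.dTwo_pos hM hα hβ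
  have hK := AtomicChain.isKdVWave_kdvWave hM hα hβ
  refine ⟨AtomicChain.kdvWave M α β, ⟨hK, fun V hV =>
    hV.eq_of_apply_zero_eq hK (by rw [hV.apply_zero hd2, hK.apply_zero hd2])⟩, ?_⟩
  obtain ⟨τ, C₁, hτ0, hτ1, hC₁, hev⟩ := h.exists_unique_near
  -- Twice C₁ because two norms are added; existence holds with the same solution for every larger
  -- C.
  refine ⟨2 * C₁, by positivity, fun C hC => ?_⟩
  have hC0 : 0 ≤ C := by linarith
  have hβγ : ∀ᶠ ε : ℝ in nhdsWithin 0 (Set.Ioi 0), ∀ m ∈ Finset.Icc 1 M,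
      γ m * m * (AtomicChain.waveHeight M α β + 1) * ε ^ 2 ≤ β m := by
    rw [Filter.eventually_all_finset]
    exact fun m hm => AtomicChain.eventually_mul_sq_le _ (hβ m hm)
  have hall := hev.and (hβγ.and
    ((AtomicChain.eventually_mul_sq_le (M * (AtomicChain.waveHeight M α β + 1)) one_pos).and
      (AtomicChain.eventually_mul_sq_le_mul_sqrt C hτ0)))
  obtain ⟨ε₀, hε₀, hsub⟩ := mem_nhdsGT_iff_exists_Ioc_subset.1 hall
  refine ⟨ε₀, hε₀, fun ε hε hεε => ?_⟩
  obtain ⟨⟨⟨u, hr, hu, hsup, hτu, hs⟩, huniq⟩, hβγε, hεM', hCτ⟩ := hsub ⟨hε, hεε⟩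
  have hεM : M * ε ^ 2 * (AtomicChain.waveHeight M α β + 1) ≤ 1 := by linarith
  obtain ⟨W, hWu, hW0, hW2, hWk⟩ := h.exists_smooth_representative hε hεM hβγε hτ1 hτu hs
  refine ⟨W, h.isWaveNear_of_solution hε hεM hτ1 hC₁.le hC hWu hr hu hsup hτu hs,
    fun V hV => ?_, hW0, hW2, hWk⟩
  -- Since Cε² ≤ τ√ε, every competitor lies in the uniqueness ball; this is where ε₀ has to depend
  -- on C.
  have hVn := (h.norm_sub_le_of_isWaveNear hC0 hV).trans hCτ
  have hVc := hV.memLp.coeFn_toLp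
  have hVs := (h.solvesTravelingWave_iff hε hεM hτ1 hVc.symm hVn).1 hV.solves
  have hVr : AtomicChain.reflect (hV.memLp.toLp V) = hV.memLp.toLp V := by
    apply Lp.ext
    filter_upwards [AtomicChain.coeFn_reflect (hV.memLp.toLp V), hVc, AtomicChain.ae_comp_neg hVc,
      hV.even] with x h1 h2 h3 h4
    rw [h1, h3, h4, h2]
  have e := huniq _ _ hVr hr hVn hτu hVs hs
  rw [e] at hVc
  exact hVc.symm.trans hWu.symm
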